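/- Let $m\ge 1$ and $l>m+1$ be integers, and let $E_1,\dots,E_{m-1}$ be skew-symmetric real $l\times l$ matrices with $E_i^2=-I$ and $E_iE_j=-E_jE_i$ for $i\ne j$ (a representation of the Clifford algebra $C_{m-1}$ on $\mathbf R^l$). Let $$V_2(C_{m-1})=\{(u,v)\in S^{2l-1}\subset\mathbf R^l\times\mathbf R^l : |u|=|v|=\tfrac1{\sqrt2},\ u\cdot v=0,\ E_iu\cdot v=0,\ 1\le i\le m-1\}$$ be the Clifford–Stiefel manifold. Let $\alpha,\beta>0$ with $\alpha^2+\beta^2=1$ and $\alpha\ne 1/\sqrt2$, let $T_{\alpha,\beta}(u,v)=\sqrt2\,(\alpha u,\beta v)$, and let $V=V_2^{\alpha,\beta}=T_{\alpha,\beta}(V_2(C_{m-1}))$. Conventions. A Legendre submanifold is a $(2l-2)$-dimensional submanifold $B$ of the space of contact elements $(x,\xi)$ of $S^{2l-1}$ (pairs of orthogonal unit vectors) on which $dx\cdot\xi=0$. The contact element $(x,\xi)$ corresponds to the projective line $[(1,x,0),(0,\xi,1)]$ on the Lie quadric $\{-z_1^2+z_2^2+\dots+z_{2l+1}^2-z_{2l+2}^2=0\}$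 in ${\bf P}^{2l+1}$. A number $\kappa\in\mathbf R\cup\{\infty\}$ is a principal curvature of $B$ at $(x,\xi)$ if $d\xi=-\kappa\,dx$ (for $\kappa=\infty$: $dx=0$) on some nonzero tangent vector of $B$. The vectors with this property, together with $0$, form its principal space, and $[\kappa(1,x,0)+(0,\xi,1)]$ (for $\kappa=\infty$: $[(1,x,0)]$) is its curvature sphere. A curvature surface is a connected submanifold of $B$ whose tangent space at each point is a principal space. $B$ is proper Dupin if the corresponding curvature sphere is constant along each curvature surface and the number $g$ of distinct principal curvatures is constant on $B$. If $g=4$ and $\lambda_1<\lambda_2<\lambda_3<\lambda_4\le\infty$ are the principal curvatures, the Lie curvature is $$\Psi=[\lambda_1,\lambda_2;\lambda_3,\lambda_4]=\frac{(\lambda_1-\lambda_2)(\lambda_4-\lambda_3)}{(\lambda_1-\lambda_3)(\lambda_4-\lambda_2)},$$ which is $(\lambda_1-\lambda_2)/(\lambda_1-\lambda_3)$ if $\lambda_4=\infty$. A submanifold of codimension greater than one in $S^{2l-1}$ is represented by its Legendre lift, the unit normal bundle. A hypersurface with unit normal field $\nu$ is represented by $\{(x,\nu(x))\}$, and the definitions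 apply to it through this lift. A Lie sphere transformation is a projective transformation preserving the Lie quadric. Two Legendre submanifolds are Lie equivalent if such a transformation maps one, as a family of lines on the quadric, onto the other. An isoparametric hypersurface is an oriented immersed hypersurface of $S^{2l-1}$ with constant principal curvatures. Then: 1. $V$ is a compact submanifold of $S^{2l-1}$ of codimension $m+1$. 2. $V$ is proper Dupin with exactly four principal curvatures, one of which is $\infty$, at each point of its unit normal bundle $B(V)$. 3. At each $(u,v)\in V$ the vector $\xi(u,v)=\left(-\frac\beta\alpha u,\frac\alpha\beta v\right)$ is a unit normal. At $\xi(u,v)$ the principal curvatures are $-\frac\alpha\beta,\,0,\,\frac\beta\alpha,\,\infty$ and $\Psi=\alpha^2$. At $-\xi(u,v)$ they are $-\frac\beta\alpha,\,0,\,\frac\alpha\beta,\,\infty$ and $\Psi=\beta^2$. 4. $\Psi$ is not constant on $B(V)$. 5. $V$ is not Lie equivalent to an isoparametric hypersurface. 6. There is $t_0>0$ such that for all $0<t<t_0$ the tube $M_t=\{\cos t\,x+\sin t\,\xi : (x,\xi)\in B(V)\}$ is a compact embedded orientable hypersurface of $S^{2l-1}$ and, for every choice of a smooth unit normal field, it is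 proper Dupin with exactly four principal curvatures and is not Lie equivalent to an isoparametric hypersurface. -/

import Mathlib

open scoped ContDiff Manifold RealInnerProductSpace

universe u

noncomputable section

namespace LieSphere

/-! ### Smooth submanifolds of a normed space -/

section Submanifolds

variable {E : Type*} [NormedAddCommGroup E] [NormedSpace ℝ E]

/-- `S` is a smooth embedded submanifold of dimension `k`: near each of its points there is a
smooth diffeomorphism between open sets of `E` that straightens `S` to a `k`-dimensional linear
subspace. -/
def IsSubmanifold (k : ℕ) (S : Set E) : Prop :=
  ∀ p ∈ S, ∃ (Φ : OpenPartialHomeomorph E E) (W : Submodule ℝ E),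
    p ∈ Φ.source ∧ ContDiffOn ℝ ∞ Φ Φ.source ∧ ContDiffOn ℝ ∞ Φ.symm Φ.target ∧
    Module.finrank ℝ W = k ∧ ∀ x ∈ Φ.source, x ∈ S ↔ Φ x ∈ W

/-- `w` is the velocity at `p` of a smooth curve in `S`. -/
def IsTangentVector (S : Set E) (p w : E) : Prop :=
  ∃ γ : ℝ → E, ContDiffAt ℝ ∞ γ 0 ∧ γ 0 = p ∧ HasDerivAt γ w 0 ∧ ∀ᶠ t in nhds (0 : ℝ), γ t ∈ S

/-- The tangent space of `S` at `p` (a linear subspace if `S` is a submanifold and `p ∈ S`). -/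
def tangentVectors (S : Set E) (p : E) : Set E := {w | IsTangentVector S p w}

end Submanifolds

/-! ### The extended line `ℝ ∪ {∞}` and the cross-ratio

`WithTop ℝ` models `ℝ ∪ {∞}`; its order makes `∞ = ⊤` the largest element. -/

/-- Homogeneous coordinates: `κ ↦ (κ, 1)` for real `κ`, and `∞ ↦ (1, 0)`. -/
def homCoord : WithTop ℝ → ℝ × ℝ
  | none => (1, 0)
  | some κ => (κ, 1)

/-- The difference `a - b` in homogeneous coordinates. -/
def homDiff (a b : WithTop ℝ) : ℝ :=
  (homCoord a).1 * (homCoord b).2 - (homCoord b).1 * (homCoord a).2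

/-- The cross-ratio `[a, b; c, d] = (a - b)(d - c) / ((a - c)(d - b))` of four distinct elements
of `ℝ ∪ {∞}`, with the usual conventions for `∞`; `[a, b; c, ∞] = (a - b) / (a - c)`. -/
def crossRatio (a b c d : WithTop ℝ) : ℝ :=
  (homDiff a b * homDiff d c) / (homDiff a c * homDiff d b)

/-! ### Legendre submanifolds

`F` is a Euclidean space and the ambient sphere is its unit sphere, of dimension
`n = dim F - 1`.  A contact element is a pair `(x, ξ)` of orthogonal unit vectors, and it is
identified with the line `[(1, x, 0), (0, ξ, 1)]` on the Lie quadric.  The contact condition on a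
family of contact elements is `⟪dx, ξ⟫ = 0`.  The product `F × F` is only used as a smooth
manifold. -/

section Legendre

variable {F : Type*} [NormedAddCommGroup F] [InnerProductSpace ℝ F]

/-- `B` is an embedded Legendre submanifold of the manifold of contact elements of the unit sphere
of `F`, of dimension `n - 1 = dim F - 2`. -/
structure IsLegendreSubmanifold (B : Set (F × F)) : Prop where
  unit_fst : ∀ p ∈ B, ‖p.1‖ = 1
  unit_snd : ∀ p ∈ B, ‖p.2‖ = 1
  orthogonal : ∀ p ∈ B, ⟪p.1, p.2⟫ = 0
  isSubmanifold : IsSubmanifold (Module.finrank ℝ F - 2) B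
  contact : ∀ p ∈ B, ∀ w ∈ tangentVectors B p, ⟪w.1, p.2⟫ = 0

/-- The ambient space `ℝ × F × ℝ` of the Lie quadric. -/
abbrev LieSpace (F : Type*) : Type _ := ℝ × F × ℝ

/-- The Lie form, of signature `(n + 1, 2)`. -/
def lieForm (z w : LieSpace F) : ℝ := -(z.1 * w.1) + ⟪z.2.1, w.2.1⟫ - z.2.2 * w.2.2

/-- `k₁ = (1, x, 0)`: the point sphere of the contact element `(x, ξ)`. -/
def pointSphere (p : F × F) : LieSpace F := (1, p.1, 0)

/-- `k₂ = (0, ξ, 1)`: the great sphere of the contact element `(x, ξ)`. -/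
def greatSphere (p : F × F) : LieSpace F := (0, p.2, 1)

/-- The projective line `[k₁, k₂]` on the Lie quadric given by a contact element. -/
def lieLine (p : F × F) : Submodule ℝ (LieSpace F) :=
  Submodule.span ℝ {pointSphere p, greatSphere p}

/-- The principal space of `κ` at `p = (x, ξ)`: all tangent vectors `(dx, dξ)` with
`dξ = -κ dx`, and with `dx = 0` for `κ = ∞`. -/
def principalSpace (B : Set (F × F)) (p : F × F) (κ : WithTop ℝ) : Set (F × F) :=
  {w | w ∈ tangentVectors B p ∧ (homCoord κ).1 • w.1 + (homCoord κ).2 • w.2 = 0}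

/-- The principal curvatures of `B` at `p`, in `ℝ ∪ {∞}`. -/
def principalCurvatures (B : Set (F × F)) (p : F × F) : Set (WithTop ℝ) :=
  {κ | ∃ w ∈ principalSpace B p κ, w ≠ 0}

/-- The Lie sphere `[κ k₁ + k₂]` at `p` (and `[k₁]` for `κ = ∞`), as a point of projective space,
that is, as a line through `0`; it is the curvature sphere if `κ` is a principal curvature. -/
def curvatureSphere (p : F × F) (κ : WithTop ℝ) : Submodule ℝ (LieSpace F) :=
  Submodule.span ℝ {(homCoord κ).1 • pointSphere p + (homCoord κ).2 • greatSphere p}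

/-- `S` is a (connected) curvature surface of `B` with corresponding principal curvature `κ`. -/
structure IsCurvatureSurface (B S : Set (F × F)) (κ : F × F → WithTop ℝ) : Prop where
  subset : S ⊆ B
  connected : IsConnected S
  isSubmanifold : ∃ k, IsSubmanifold k S
  principal : ∀ p ∈ S, κ p ∈ principalCurvatures B p
  tangent : ∀ p ∈ S, tangentVectors S p = principalSpace B p (κ p)

/-- `B` is a proper Dupin (Legendre) submanifold with `g` distinct principal curvatures: the
curvature sphere is constant along each curvature surface, and there are exactly `g` of them at
every point. -/
structure IsProperDupin (g : ℕ) (B : Set (F × F)) : Prop where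
  legendre : IsLegendreSubmanifold B
  dupin : ∀ S κ, IsCurvatureSurface B S κ →
    ∀ p ∈ S, ∀ q ∈ S, curvatureSphere p (κ p) = curvatureSphere q (κ q)
  proper : ∀ p ∈ B, (principalCurvatures B p).Finite ∧ (principalCurvatures B p).ncard = g

/-- `B` has exactly four principal curvatures `κ₁ < κ₂ < κ₃ < κ₄ ≤ ∞` at `p`, and its Lie
curvature `[κ₁, κ₂; κ₃, κ₄]` there is `ψ`. -/
def HasLieCurvature (B : Set (F × F)) (p : F × F) (ψ : ℝ) : Prop :=
  ∃ κ₁ κ₂ κ₃ κ₄ : WithTop ℝ, κ₁ < κ₂ ∧ κ₂ < κ₃ ∧ κ₃ < κ₄ ∧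
    principalCurvatures B p = {κ₁, κ₂, κ₃, κ₄} ∧ crossRatio κ₁ κ₂ κ₃ κ₄ = ψ

/-! ### Legendre lifts -/

/-- The unit normal bundle in the unit sphere of a submanifold `V` of the unit sphere; as a set of
contact elements it is the Legendre lift of `V`. -/
def unitNormalBundle (V : Set F) : Set (F × F) :=
  {p | p.1 ∈ V ∧ ‖p.2‖ = 1 ∧ ⟪p.1, p.2⟫ = 0 ∧ ∀ w ∈ tangentVectors V p.1, ⟪w, p.2⟫ = 0}

/-- `ν` is (on `M`) a smooth field of unit normals, in the unit sphere, of a hypersurface `M` of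
the unit sphere. -/
structure IsUnitNormalField (M : Set F) (ν : F → F) : Prop where
  smooth : ContDiffOn ℝ ∞ ν M
  unit : ∀ x ∈ M, ‖ν x‖ = 1
  orthogonal : ∀ x ∈ M, ⟪x, ν x⟫ = 0
  normal : ∀ x ∈ M, ∀ w ∈ tangentVectors M x, ⟪w, ν x⟫ = 0

/-- The Legendre lift of a hypersurface `M` oriented by `ν`.  Its principal curvatures are the
eigenvalues of the shape operator `A`, given by `dν = -A`. -/
def hypersurfaceLift (M : Set F) (ν : F → F) : Set (F × F) := (fun x => (x, ν x)) '' M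

/-- The tube of spherical radius `t` over `V`. -/
def tube (V : Set F) (t : ℝ) : Set F :=
  {y | ∃ p ∈ unitNormalBundle V, y = Real.cos t • p.1 + Real.sin t • p.2}

/-! ### Lie equivalence to an isoparametric hypersurface -/

/-- A Lie sphere transformation, represented by a linear automorphism: a projective
transformation that maps the Lie quadric to itself. -/
def IsLieSphereTransformation (A : LieSpace F ≃ₗ[ℝ] LieSpace F) : Prop :=
  ∀ z, lieForm (A z) (A z) = 0 ↔ lieForm z z = 0

/-- Some Lie sphere transformation maps the Legendre submanifold `B₁`, as a set of lines on the
quadric, onto `B₂`.  (No parametrization enters.  So Lie equivalence of parametrized Legendre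
submanifolds up to a diffeomorphism of their domains implies this.) -/
def LieEquivalent (B₁ B₂ : Set (F × F)) : Prop :=
  ∃ A : LieSpace F ≃ₗ[ℝ] LieSpace F, IsLieSphereTransformation A ∧
    (fun p => (lieLine p).map (A : LieSpace F →ₗ[ℝ] LieSpace F)) '' B₁ = lieLine '' B₂

section Immersed

variable (d : ℕ) {N : Type*} [TopologicalSpace N] [ChartedSpace (EuclideanSpace ℝ (Fin d)) N]

/-- The differential at `x` of a map from a `d`-dimensional manifold to `F`. -/
def differential (h : N → F) (x : N) : TangentSpace (𝓡 d) x →ₗ[ℝ] F :=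
  (mfderiv (𝓡 d) 𝓘(ℝ, F) h x).toLinearMap

/-- An immersed hypersurface `f` of the unit sphere of `F`, oriented by the field `ν` of unit
normals, is isoparametric: its principal curvatures (the eigenvalues `κ` of the shape operator,
`dν = -κ df`), with their multiplicities, are the same at all points. -/
structure IsIsoparametric (f ν : N → F) : Prop where
  smooth_immersion : ContMDiff (𝓡 d) 𝓘(ℝ, F) ∞ f
  smooth_normal : ContMDiff (𝓡 d) 𝓘(ℝ, F) ∞ ν
  dim_eq : d + 2 = Module.finrank ℝ F
  unit_immersion : ∀ x, ‖f x‖ = 1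
  unit_normal : ∀ x, ‖ν x‖ = 1
  orthogonal : ∀ x, ⟪f x, ν x⟫ = 0
  injective : ∀ x, Function.Injective (differential d f x)
  normal : ∀ x X, ⟪differential d f x X, ν x⟫ = 0
  constant : ∀ (x y : N) (κ : ℝ),
    Module.finrank ℝ (LinearMap.ker (differential d ν x + κ • differential d f x)) =
      Module.finrank ℝ (LinearMap.ker (differential d ν y + κ • differential d f y))

end Immersed

/-- The Legendre submanifold `B` is Lie equivalent to (the Legendre lift of) an oriented
isoparametric hypersurface of the unit sphere. -/
def LieEquivalentToIsoparametric (B : Set (F × F)) : Prop :=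
  ∃ (d : ℕ) (N : Type u) (_ : TopologicalSpace N) (_ : T2Space N)
    (_ : SecondCountableTopology N) (_ : ChartedSpace (EuclideanSpace ℝ (Fin d)) N)
    (_ : IsManifold (𝓡 d) ∞ N) (f ν : N → F),
    IsIsoparametric d f ν ∧ LieEquivalent B (Set.range fun x => (f x, ν x))

end Legendre

/-! ### Clifford–Stiefel manifolds and their deformations -/

/-- `ℝ^l × ℝ^l` with its Euclidean structure. -/
abbrev DoubleSpace (l : ℕ) : Type :=
  WithLp 2 (EuclideanSpace ℝ (Fin l) × EuclideanSpace ℝ (Fin l))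

/-- The matrices `E₁, …, E_k` are skew-symmetric and determine a representation of the Clifford
algebra `C_k` on `ℝ^l`. -/
structure IsCliffordRepresentation {k l : ℕ} (E : Fin k → Matrix (Fin l) (Fin l) ℝ) : Prop where
  skew : ∀ i, (E i).transpose = -E i
  sq : ∀ i, E i * E i = -1
  anticomm : ∀ i j, i ≠ j → E i * E j = -(E j * E i)

/-- The Clifford–Stiefel manifold `V₂(C_k)` of Clifford orthogonal 2-frames of length `1/√2`. -/
def cliffordStiefel {k l : ℕ} (E : Fin k → Matrix (Fin l) (Fin l) ℝ) : Set (DoubleSpace l) :=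
  {p | ‖p‖ = 1 ∧ ‖p.fst‖ = 1 / √2 ∧ ‖p.snd‖ = 1 / √2 ∧ ⟪p.fst, p.snd⟫ = 0 ∧
    ∀ i, ⟪Matrix.toEuclideanLin (E i) p.fst, p.snd⟫ = 0}

/-- The linear map `T_{α,β}(u, v) = √2 (α u, β v)`. -/
def stretch {l : ℕ} (α β : ℝ) (p : DoubleSpace l) : DoubleSpace l :=
  √2 • WithLp.toLp 2 (α • p.fst, β • p.snd)

/-- The image `V₂^{α,β} = T_{α,β}(V₂(C_k))`. -/
def stretchedStiefel {k l : ℕ} (E : Fin k → Matrix (Fin l) (Fin l) ℝ) (α β : ℝ) :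
    Set (DoubleSpace l) :=
  stretch α β '' cliffordStiefel E

/-- The vector `ξ(u, v) = (-(β/α) u, (α/β) v)`. -/
def specialNormal {l : ℕ} (α β : ℝ) (p : DoubleSpace l) : DoubleSpace l :=
  WithLp.toLp 2 (-(β / α) • p.fst, (α / β) • p.snd)

end LieSphere

end

namespace LieSphere

open Filter Topology

/-! Let one operator act by `(u, v) ↦ (u, -v)` and the others by `(u, v) ↦ (Aᵀ v, A u)` with `A = 1,
E₁, …, E_{m-1}`. They span a Clifford system: a linear family `P`, indexed by a Euclidean space `Y`
of dimension `m + 1`, of symmetric operators with `(P y)² = ‖y‖²`. By `cliffordStiefel_eq`, the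
Clifford–Stiefel manifold is its focal set, the unit vectors `x` with `⟪P y x, x⟫ = 0` for all `y`.
The stretching `T` is symmetric with `T² = 1 + δ P e`, where `δ = α² - β²` and `e` is the unit
vector of the first operator. Most of the proof uses only these facts.

The unit normals at `T x` are the vectors `T⁻¹ (P y x)` with `‖y‖² = 1 - δ²`
(`unitNormalBundle_stretched`). For a variation `(w, z)` of `(x, y)`, the equation `κ dx + dξ = 0`
becomes, after applying `T`, `κ w + P (y + κ δ e) w + P z x = 0`. The Clifford relations leave only
`κ = 0`, or `z = 0` and `κ² = ‖y + κ δ e‖²` (`eigenvalue_cases`). The last equation is `κ² - 2 s κ -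
1 = 0` with `s = δ ⟪e, y⟫ / (1 - δ²)`, so its roots satisfy `κ₋ < 0 < κ₊`. With `∞`, which belongs
to `w = 0`, there are four principal curvatures, all of them attained. Along a principal vector of a
root `z` vanishes, so `y`, `s` and the root are stationary, while `0` and `∞` are constant. This
gives the Dupin property (`curvatureSystemOn_stretched`, `IsLegendreSubmanifold.isProperDupin`).

A Lie sphere transformation is linear, so it carries the curvature spheres of one line projectively
to those of the image line (`exists_isCurvatureDirection_iff`). An isoparametric hypersurface has
the same principal curvatures everywhere. Hence a Legendre submanifold that is Lie equivalent to one
has curvature spheres containing a harmonic quadruple either at every point or at none. Here `κ₋, 0,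
κ₊, ∞` are harmonic in some order exactly when `s = 0`. That holds for `y` orthogonal to `e` and
fails for `y` parallel to `e`, because `δ ≠ 0`.

Passing to a tube rotates `(x, ξ)`, and homogeneous coordinates of the principal curvatures rotate
with it, so both properties are inherited (`IsMixedNear`). For small radius the tube is embedded,
since `a T x + b T⁻¹ (P y x)` is an injective immersion when `b / a` is small. The normals `±ξ`
belong to `y = ∓2 α β e`, where the quadratic has the stated roots. -/

theorem eventually_preimage_of_isCompact {X X' : Type*} [TopologicalSpace X] [TopologicalSpace X']
    [T2Space X'] {S : Set X} (hS : IsCompact S) {f : X → X'}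
    (hf : Continuous f) (hinj : Set.InjOn f S) :
    ∀ p ∈ S, ∀ U ∈ 𝓝 p, ∀ᶠ y in 𝓝 (f p), ∀ q ∈ S, f q = y → q ∈ U := by
  intro p hp U hU
  -- The part of `S` away from `p` has compact, hence closed, image, and injectivity keeps `f p` out
  -- of it.
  have hc : IsClosed (f '' (S \ interior U)) :=
    ((hS.diff isOpen_interior).image hf).isClosed
  have hmem : f p ∈ (f '' (S \ interior U))ᶜ := by
    rintro ⟨q, hq, hqp⟩
    rw [hinj hq.1 hp hqp] at hq
    exact hq.2 (mem_interior_iff_mem_nhds.2 hU)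
  filter_upwards [hc.isOpen_compl.mem_nhds hmem] with y hy q hq hqy
  by_contra hqU
  exact hy ⟨q, ⟨hq, fun h => hqU (interior_subset h)⟩, hqy⟩

/-! ### Straightening charts, tangent vectors, level sets and embedded images -/

section Straightening

variable {E : Type*} [NormedAddCommGroup E] [NormedSpace ℝ E]
  {E' : Type*} [NormedAddCommGroup E'] [NormedSpace ℝ E']

/-- The inverse function theorem, with smoothness on the whole source and target. -/
theorem exists_smooth_openPartialHomeomorph [CompleteSpace E] {f : E → E'} {U : Set E}
    (hU : IsOpen U) (hf : ContDiffOn ℝ ∞ f U) {p : E} (hp : p ∈ U) {e : E ≃L[ℝ] E'}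
    (he : HasFDerivAt f (e : E →L[ℝ] E') p) :
    ∃ Φ : OpenPartialHomeomorph E E', p ∈ Φ.source ∧ Φ.source ⊆ U ∧ (∀ x, Φ x = f x) ∧
      ContDiffOn ℝ ∞ Φ Φ.source ∧ ContDiffOn ℝ ∞ Φ.symm Φ.target := by
  have hfp : ContDiffAt ℝ ∞ f p := hf.contDiffAt (hU.mem_nhds hp)
  have hstrict : HasStrictFDerivAt f (e : E →L[ℝ] E') p :=
    hfp.hasStrictFDerivAt' he (by simp)
  have hcont : ContinuousOn (fderiv ℝ f) U := hf.continuousOn_fderiv_of_isOpen hU (by simp)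
  set R : Set (E →L[ℝ] E') := Set.range ((↑) : (E ≃L[ℝ] E') → E →L[ℝ] E')
  have hR : IsOpen R := ContinuousLinearEquiv.isOpen
  -- The source is shrunk to points with invertible derivative, so that the inverse is smooth on the
  -- whole target and not only at `f p`.
  have hU' : IsOpen (U ∩ fderiv ℝ f ⁻¹' R) := hcont.isOpen_inter_preimage hU hR
  refine ⟨(hstrict.toOpenPartialHomeomorph f).restrOpen _ hU', ?_, ?_, ?_, ?_, ?_⟩
  · refine ⟨hstrict.mem_toOpenPartialHomeomorph_source, hp, ?_⟩
    exact ⟨e, he.fderiv.symm⟩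
  · exact fun x hx => hx.2.1
  · exact fun x => rfl
  · exact hf.mono fun x hx => hx.2.1
  · intro y hy
    set Ψ := (hstrict.toOpenPartialHomeomorph f).restrOpen _ hU'
    have hx : Ψ.symm y ∈ Ψ.source := Ψ.map_target hy
    obtain ⟨e', he'⟩ := hx.2.2
    have hfx : ContDiffAt ℝ ∞ f (Ψ.symm y) := hf.contDiffAt (hU.mem_nhds hx.2.1)
    have hd : HasFDerivAt f (e' : E →L[ℝ] E') (Ψ.symm y) := by
      rw [he']
      exact (hfx.differentiableAt (by simp)).hasFDerivAt
    exact (Ψ.contDiffAt_symm hy hd hfx).contDiffWithinAt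

/-- `Φ` is a smooth diffeomorphism between open sets that straightens `S` to `W`. -/
structure IsStraightening (S : Set E) (Φ : OpenPartialHomeomorph E E) (W : Submodule ℝ E) :
    Prop where
  contDiffOn : ContDiffOn ℝ ∞ Φ Φ.source
  contDiffOn_symm : ContDiffOn ℝ ∞ Φ.symm Φ.target
  mem_iff : ∀ x ∈ Φ.source, x ∈ S ↔ Φ x ∈ W

theorem isSubmanifold_iff {k : ℕ} {S : Set E} :
    IsSubmanifold k S ↔ ∀ p ∈ S, ∃ (Φ : OpenPartialHomeomorph E E) (W : Submodule ℝ E),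
      p ∈ Φ.source ∧ Module.finrank ℝ W = k ∧ IsStraightening S Φ W :=
  ⟨fun h p hp => let ⟨Φ, W, h1, h2, h3, h4, h5⟩ := h p hp; ⟨Φ, W, h1, h4, h2, h3, h5⟩,
    fun h p hp => let ⟨Φ, W, h1, h4, h⟩ := h p hp; ⟨Φ, W, h1, h.1, h.2, h4, h.3⟩⟩

namespace IsStraightening

variable {S : Set E} {Φ : OpenPartialHomeomorph E E} {W : Submodule ℝ E}

theorem contDiffAt (h : IsStraightening S Φ W) {x : E} (hx : x ∈ Φ.source) :
    ContDiffAt ℝ ∞ Φ x :=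
  h.contDiffOn.contDiffAt (Φ.open_source.mem_nhds hx)

theorem contDiffAt_symm (h : IsStraightening S Φ W) {y : E} (hy : y ∈ Φ.target) :
    ContDiffAt ℝ ∞ Φ.symm y :=
  h.contDiffOn_symm.contDiffAt (Φ.open_target.mem_nhds hy)

theorem hasFDerivAt (h : IsStraightening S Φ W) {x : E} (hx : x ∈ Φ.source) :
    HasFDerivAt Φ (fderiv ℝ Φ x) x :=
  ((h.contDiffAt hx).differentiableAt (by simp)).hasFDerivAt

theorem hasFDerivAt_symm (h : IsStraightening S Φ W) {y : E} (hy : y ∈ Φ.target) :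
    HasFDerivAt Φ.symm (fderiv ℝ Φ.symm y) y :=
  ((h.contDiffAt_symm hy).differentiableAt (by simp)).hasFDerivAt

theorem fderiv_symm_apply (h : IsStraightening S Φ W) {x : E} (hx : x ∈ Φ.source) (w : E) :
    fderiv ℝ Φ.symm (Φ x) (fderiv ℝ Φ x w) = w := by
  have h1 := (h.hasFDerivAt_symm (Φ.map_source hx)).comp x (h.hasFDerivAt hx)
  have h2 : HasFDerivAt (Φ.symm ∘ Φ) (ContinuousLinearMap.id ℝ E) x :=
    (hasFDerivAt_id x).congr_of_eventuallyEq (Φ.eventually_left_inverse hx)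
  exact congrArg (fun T : E →L[ℝ] E => T w) (h1.unique h2)

theorem fderiv_apply_symm (h : IsStraightening S Φ W) {x : E} (hx : x ∈ Φ.source) (w : E) :
    fderiv ℝ Φ x (fderiv ℝ Φ.symm (Φ x) w) = w := by
  have hx' : HasFDerivAt Φ (fderiv ℝ Φ x) (Φ.symm (Φ x)) := by
    rw [Φ.left_inv hx]; exact h.hasFDerivAt hx
  have h1 := hx'.comp (Φ x) (h.hasFDerivAt_symm (Φ.map_source hx))
  have h2 : HasFDerivAt (Φ ∘ Φ.symm) (ContinuousLinearMap.id ℝ E) (Φ x) :=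
    (hasFDerivAt_id _).congr_of_eventuallyEq
      (Φ.eventually_right_inverse (Φ.map_source hx))
  exact congrArg (fun T : E →L[ℝ] E => T w) (h1.unique h2)

theorem symm_mem (h : IsStraightening S Φ W) {y : E} (hy : y ∈ Φ.target) (hW : y ∈ W) :
    Φ.symm y ∈ S :=
  (h.mem_iff _ (Φ.map_target hy)).2 (by rwa [Φ.right_inv hy])

/-- Difference quotients of a curve in `S`, read in the chart, lie in the closed subspace `W`;
conversely a line in `W` pulls back to a curve in `S`. -/
theorem mem_tangentVectors_iff [FiniteDimensional ℝ E] (h : IsStraightening S Φ W) {p w : E}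
    (hp : p ∈ Φ.source) (hpS : p ∈ S) : w ∈ tangentVectors S p ↔ fderiv ℝ Φ p w ∈ W := by
  constructor
  · rintro ⟨γ, hγ, h0, hd, hS⟩
    have hd' : HasDerivAt (Φ ∘ γ) (fderiv ℝ Φ p w) 0 := by
      apply HasFDerivAt.comp_hasDerivAt (0 : ℝ) _ hd
      rw [h0]; exact h.hasFDerivAt hp
    have hclosed : IsClosed (W : Set E) := W.closed_of_finiteDimensional
    refine hclosed.mem_of_tendsto (hasDerivAt_iff_tendsto_slope.1 hd') ?_
    have hsrc : ∀ᶠ t in 𝓝 (0 : ℝ), γ t ∈ Φ.source :=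
      hγ.continuousAt.eventually_mem (by rw [h0]; exact Φ.open_source.mem_nhds hp)
    refine nhdsWithin_le_nhds ?_
    filter_upwards [hS, hsrc] with t ht ht'
    rw [slope_def_module]
    refine W.smul_mem _ (W.sub_mem ((h.mem_iff _ ht').1 ht) ?_)
    rw [Function.comp, h0]
    exact (h.mem_iff _ hp).1 hpS
  · intro hw
    set v := fderiv ℝ Φ p w with hv
    have hc : ContDiffAt ℝ ∞ (fun t : ℝ => Φ p + t • v) 0 := by fun_prop
    have hd : HasDerivAt (fun t : ℝ => Φ p + t • v) v 0 := by
      simpa using ((hasDerivAt_id (0 : ℝ)).smul_const v).const_add (Φ p)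
    have hpt := Φ.map_source hp
    have hΦ : ContDiffAt ℝ ∞ Φ.symm (Φ p + (0 : ℝ) • v) := by
      simpa using h.contDiffAt_symm hpt
    refine ⟨fun t => Φ.symm (Φ p + t • v), hΦ.comp (0 : ℝ) hc, by simp [Φ.left_inv hp], ?_, ?_⟩
    · have h1 : HasFDerivAt Φ.symm (fderiv ℝ Φ.symm (Φ p)) (Φ p + (0 : ℝ) • v) := by
        simpa using h.hasFDerivAt_symm hpt
      have := h1.comp_hasDerivAt (0 : ℝ) hd
      rwa [hv, h.fderiv_symm_apply hp] at this
    · have : ∀ᶠ t in 𝓝 (0 : ℝ), Φ p + t • v ∈ Φ.target :=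
        hc.continuousAt.eventually_mem (by simpa using Φ.open_target.mem_nhds hpt)
      filter_upwards [this] with t ht
      exact h.symm_mem ht (W.add_mem ((h.mem_iff _ hp).1 hpS) (W.smul_mem _ hw))

theorem restr (h : IsStraightening S Φ W) {U : Set E} (hU : IsOpen U) {S' : Set E}
    (hS : ∀ x ∈ U, x ∈ S ↔ x ∈ S') : IsStraightening S' (Φ.restrOpen U hU) W where
  contDiffOn := h.contDiffOn.mono fun _ hx => hx.1
  contDiffOn_symm := h.contDiffOn_symm.mono fun _ hy => hy.1
  mem_iff x hx := (hS x hx.2).symm.trans (h.mem_iff x hx.1)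

end IsStraightening

/-- The tangent vectors of a submanifold form a linear subspace. -/
theorem IsSubmanifold.exists_tangentSpace [FiniteDimensional ℝ E] {k : ℕ} {S : Set E}
    (h : IsSubmanifold k S) {p : E} (hp : p ∈ S) :
    ∃ T : Submodule ℝ E, Module.finrank ℝ T = k ∧ (T : Set E) = tangentVectors S p := by
  obtain ⟨Φ, W, hpΦ, hW, hΦ⟩ := isSubmanifold_iff.1 h p hp
  let e : E ≃ₗ[ℝ] E := LinearEquiv.ofBijective (fderiv ℝ Φ p).toLinearMap
    ⟨Function.LeftInverse.injective (hΦ.fderiv_symm_apply hpΦ),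
      Function.RightInverse.surjective (hΦ.fderiv_apply_symm hpΦ)⟩
  refine ⟨W.comap e.toLinearMap, ?_, ?_⟩
  · rw [← hW, Submodule.comap_equiv_eq_map_symm]
    exact LinearEquiv.finrank_map_eq e.symm W
  · ext w
    exact (hΦ.mem_tangentVectors_iff hpΦ hp).symm

/-- Being a submanifold is a local property. -/
theorem isSubmanifold_of_locally {k : ℕ} {S : Set E}
    (h : ∀ p ∈ S, ∃ S', IsSubmanifold k S' ∧ ∀ᶠ x in 𝓝 p, x ∈ S ↔ x ∈ S') :
    IsSubmanifold k S := by
  rw [isSubmanifold_iff]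
  intro p hp
  obtain ⟨S', hS', hev⟩ := h p hp
  obtain ⟨U, hU, hUo, hpU⟩ := eventually_nhds_iff.1 hev
  obtain ⟨Φ, W, hpΦ, hW, hΦ⟩ := isSubmanifold_iff.1 hS' p ((hU p hpU).1 hp)
  exact ⟨Φ.restrOpen U hUo, W, ⟨hpΦ, hpU⟩, hW, hΦ.restr hUo fun x hx => (hU x hx).symm⟩

theorem mem_tangentVectors_image {S : Set E} {p w : E} {f : E → E'} {f' : E →L[ℝ] E'}
    {S' : Set E'} (hf : ContDiffAt ℝ ∞ f p) (hf' : HasFDerivAt f f' p)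
    (hS : ∀ᶠ x in 𝓝 p, x ∈ S → f x ∈ S') (hw : w ∈ tangentVectors S p) :
    f' w ∈ tangentVectors S' (f p) := by
  obtain ⟨γ, hγ, h0, hd, hγS⟩ := hw
  subst h0
  refine ⟨f ∘ γ, hf.comp (0 : ℝ) hγ, rfl, hf'.comp_hasDerivAt (0 : ℝ) hd, ?_⟩
  filter_upwards [hγS, hγ.continuousAt.eventually hS] with t h1 h2 using h2 h1

variable [FiniteDimensional ℝ E]

/-- With `s` a right inverse of `A = DG(p)`, the map `f x = x - s (A x) + s (G x)` has derivative
`1` at `p` and satisfies `A (f x) = G x`, so it carries the zero set to `ker A`. -/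
theorem exists_straightening_levelSet [FiniteDimensional ℝ E'] {G : E → E'}
    (hG : ContDiff ℝ ∞ G) {p : E} (hp : Function.Surjective (fderiv ℝ G p)) :
    ∃ Φ : OpenPartialHomeomorph E E, p ∈ Φ.source ∧
      IsStraightening {x | G x = 0} Φ (LinearMap.ker (fderiv ℝ G p).toLinearMap) ∧
      HasFDerivAt Φ (ContinuousLinearMap.id ℝ E) p := by
  obtain ⟨s, hs⟩ := (fderiv ℝ G p).toLinearMap.exists_rightInverse_of_surjective
    (LinearMap.range_eq_top.2 hp)
  set A := fderiv ℝ G p with hA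
  have hsA : ∀ y, A (s y) = y := fun y => congrArg (fun T : E' →ₗ[ℝ] E' => T y) hs
  set s' : E' →L[ℝ] E := s.toContinuousLinearMap
  have hs' : ∀ y, A (s' y) = y := hsA
  set f : E → E := fun x => x - s' (A x) + s' (G x) with hf
  have hfs : ContDiff ℝ ∞ f := by fun_prop
  have hGp : HasFDerivAt G A p := (hG.differentiable (by simp) p).hasFDerivAt
  have hfd : HasFDerivAt f ((ContinuousLinearEquiv.refl ℝ E : E ≃L[ℝ] E) : E →L[ℝ] E) p := by
    have h1 := ((hasFDerivAt_id p).sub ((s'.comp A).hasFDerivAt (x := p))).add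
      (s'.hasFDerivAt.comp p hGp)
    refine (h1.congr_fderiv ?_).congr_of_eventuallyEq (Eventually.of_forall fun x => rfl)
    ext x
    simp
  obtain ⟨Φ, h1, -, h2, h3, h4⟩ :=
    exists_smooth_openPartialHomeomorph isOpen_univ hfs.contDiffOn (Set.mem_univ p) hfd
  refine ⟨Φ, h1, ⟨h3, h4, fun x _ => ?_⟩, ?_⟩
  · rw [h2, hf]
    simp [hs']
  · exact (hfd.congr_of_eventuallyEq (Eventually.of_forall h2))

theorem isSubmanifold_levelSet [FiniteDimensional ℝ E'] {G : E → E'} (hG : ContDiff ℝ ∞ G)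
    (hs : ∀ p, G p = 0 → Function.Surjective (fderiv ℝ G p)) {k : ℕ}
    (hk : k + Module.finrank ℝ E' = Module.finrank ℝ E) : IsSubmanifold k {x | G x = 0} := by
  rw [isSubmanifold_iff]
  intro p hp
  obtain ⟨Φ, h1, h2, -⟩ := exists_straightening_levelSet hG (hs p hp)
  refine ⟨Φ, _, h1, ?_, h2⟩
  have := (fderiv ℝ G p).toLinearMap.finrank_range_add_finrank_ker
  rw [LinearMap.range_eq_top.2 (hs p hp), finrank_top] at this
  omega

theorem tangentVectors_levelSet [FiniteDimensional ℝ E'] {G : E → E'} (hG : ContDiff ℝ ∞ G)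
    {p : E} (h0 : G p = 0) (hp : Function.Surjective (fderiv ℝ G p)) :
    tangentVectors {x | G x = 0} p = {w | fderiv ℝ G p w = 0} := by
  obtain ⟨Φ, h1, h2, h3⟩ := exists_straightening_levelSet hG hp
  ext w
  rw [h2.mem_tangentVectors_iff h1 h0, h3.fderiv]
  simp

/-- The image of a submanifold under an embedding is a submanifold, and the embedding has smooth
local left inverses. -/
theorem IsSubmanifold.image_of_embedding [FiniteDimensional ℝ E'] {k : ℕ} {S : Set E}
    (hS : IsSubmanifold k S) {f : E → E'} (hf : ContDiff ℝ ∞ f)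
    (hinv : ∀ p ∈ S, ∀ U ∈ 𝓝 p, ∀ᶠ y in 𝓝 (f p), ∀ q ∈ S, f q = y → q ∈ U)
    (himm : ∀ p ∈ S, ∀ w ∈ tangentVectors S p, fderiv ℝ f p w = 0 → w = 0) :
    IsSubmanifold k (f '' S) ∧ ∀ p ∈ S, ∃ g : E' → E, ContDiffAt ℝ ∞ g (f p) ∧ g (f p) = p ∧
      ∀ᶠ y in 𝓝 (f p), ∀ q ∈ S, f q = y → g y = q := by
  rw [isSubmanifold_iff]
  have key : ∀ p ∈ S, ∃ (Ψ : OpenPartialHomeomorph E' E') (W : Submodule ℝ E'),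
      f p ∈ Ψ.source ∧ Module.finrank ℝ W = k ∧ IsStraightening (f '' S) Ψ W ∧
      ∃ g : E' → E, ContDiffAt ℝ ∞ g (f p) ∧ g (f p) = p ∧
      ∀ᶠ y in 𝓝 (f p), ∀ q ∈ S, f q = y → g y = q := by
    intro p hp
    obtain ⟨Φ, W, hpΦ, hW, hΦ⟩ := isSubmanifold_iff.1 hS p hp
    have hpt := Φ.map_source hpΦ
    have hfd : HasFDerivAt (f ∘ Φ.symm) ((fderiv ℝ f p).comp (fderiv ℝ Φ.symm (Φ p))) (Φ p) := by
      have hfp : HasFDerivAt f (fderiv ℝ f p) (Φ.symm (Φ p)) := by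
        rw [Φ.left_inv hpΦ]; exact (hf.differentiable (by simp) p).hasFDerivAt
      exact hfp.comp (Φ p) (hΦ.hasFDerivAt_symm hpt)
    set A₀ := (fderiv ℝ f p).comp (fderiv ℝ Φ.symm (Φ p)) with hA₀
    set A : W →ₗ[ℝ] E' := A₀.toLinearMap.comp W.subtype with hA
    have hAinj : LinearMap.ker A = ⊥ := by
      rw [LinearMap.ker_eq_bot']
      intro w hw
      have h1 : fderiv ℝ Φ.symm (Φ p) (w : E) ∈ tangentVectors S p := by
        rw [hΦ.mem_tangentVectors_iff hpΦ hp, hΦ.fderiv_apply_symm hpΦ]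
        exact w.2
      have h2 := himm p hp _ h1 hw
      have h3 := hΦ.fderiv_apply_symm hpΦ (w : E)
      rw [h2, map_zero] at h3
      exact Subtype.ext h3.symm
    obtain ⟨π, hπ⟩ := A.exists_leftInverse_of_injective hAinj
    have hπA : ∀ w, π (A w) = w := fun w => congrArg (fun T : W →ₗ[ℝ] W => T w) hπ
    set π' : E' →L[ℝ] E := (W.subtype.comp π).toContinuousLinearMap with hπ'
    have hπ'W : ∀ y, π' y ∈ W := fun y => (π y).2
    set B : E' →L[ℝ] E' := (A.comp π).toContinuousLinearMap with hB
    have hBA : ∀ y, B y = A₀ (π' y) := fun y => rfl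
    have hπ'A : ∀ w : W, π' (A w) = w := fun w => congrArg Subtype.val (hπA w)
    set e₀ : E' := A ⟨Φ p, (hΦ.mem_iff p hpΦ).1 hp⟩ with he₀
    have hπe₀ : π' e₀ = Φ p := hπ'A _
    -- `B` projects to the range of `A` along `ker π`. The map `Θ` is `f` in the chart, thickened by
    -- the identity on `ker π`: its derivative at `e₀` is the identity and it sends `A (Φ q)` to `f
    -- q`, so its local inverse straightens the image.
    set Θ : E' → E' := fun y => f (Φ.symm (π' y)) + (y - B y) with hΘ
    have hUo : IsOpen (π' ⁻¹' Φ.target) := Φ.open_target.preimage π'.continuous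
    have hΘs : ContDiffOn ℝ ∞ Θ (π' ⁻¹' Φ.target) := by
      have h1 : ContDiffOn ℝ ∞ (fun y => Φ.symm (π' y)) (π' ⁻¹' Φ.target) :=
        hΦ.contDiffOn_symm.comp π'.contDiff.contDiffOn (fun y hy => hy)
      exact (hf.comp_contDiffOn h1).add ((contDiff_id.sub B.contDiff).contDiffOn)
    have hΘd : HasFDerivAt Θ ((ContinuousLinearEquiv.refl ℝ E' : E' ≃L[ℝ] E') : E' →L[ℝ] E')
        e₀ := by
      have h0 : HasFDerivAt (f ∘ Φ.symm) A₀ (π' e₀) := by rw [hπe₀]; exact hfd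
      have h1 := (h0.comp e₀ π'.hasFDerivAt).add ((hasFDerivAt_id e₀).sub B.hasFDerivAt)
      refine (h1.congr_fderiv ?_).congr_of_eventuallyEq (Eventually.of_forall fun x => rfl)
      ext y
      simp [hBA]
    obtain ⟨Ψ, h1, h1', h2, h3, h4⟩ := exists_smooth_openPartialHomeomorph hUo hΘs
      (show e₀ ∈ π' ⁻¹' Φ.target by rw [Set.mem_preimage, hπe₀]; exact hpt) hΘd
    have hΘA : ∀ q (hq : q ∈ Φ.source) (hqS : q ∈ S), Θ (A ⟨Φ q, (hΦ.mem_iff q hq).1 hqS⟩) = f q := by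
      intro q hq hqS
      have : B (A ⟨Φ q, (hΦ.mem_iff q hq).1 hqS⟩) = A ⟨Φ q, (hΦ.mem_iff q hq).1 hqS⟩ := by
        rw [hBA, hπ'A]; rfl
      rw [hΘ]
      simp only [this, hπ'A, Φ.left_inv hq, sub_self, add_zero]
    have hΨe₀ : Ψ e₀ = f p := by rw [h2]; exact hΘA p hpΦ hp
    -- nearby points of the image come from nearby points
    have hnear : ∀ᶠ y in 𝓝 (f p), ∀ q ∈ S, f q = y →
        q ∈ Φ.source ∧ ∀ (hq : q ∈ Φ.source) (hqS : q ∈ S),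
          A ⟨Φ q, (hΦ.mem_iff q hq).1 hqS⟩ ∈ Ψ.source := by
      have hcA : ContinuousAt (fun q => A₀ (Φ q)) p :=
        A₀.continuous.continuousAt.comp (hΦ.contDiffAt hpΦ).continuousAt
      have hn : Φ.source ∩ (fun q => A₀ (Φ q)) ⁻¹' Ψ.source ∈ 𝓝 p :=
        inter_mem (Φ.open_source.mem_nhds hpΦ) (hcA (Ψ.open_source.mem_nhds h1))
      filter_upwards [hinv p hp _ hn] with y hy q hq hqy
      exact ⟨(hy q hq hqy).1, fun _ _ => (hy q hq hqy).2⟩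
    obtain ⟨O, hO, hOo, hpO⟩ := eventually_nhds_iff.1 hnear
    have hft : f p ∈ Ψ.target := by rw [← hΨe₀]; exact Ψ.map_source h1
    have hsymm : ∀ q (hq : q ∈ Φ.source) (hqS : q ∈ S), f q ∈ O →
        Ψ.symm (f q) = A ⟨Φ q, (hΦ.mem_iff q hq).1 hqS⟩ ∧ f q ∈ Ψ.target := by
      intro q hq hqS hqO
      have h5 := (hO _ hqO q hqS rfl).2 hq hqS
      have h6 : Ψ (A ⟨Φ q, (hΦ.mem_iff q hq).1 hqS⟩) = f q := by rw [h2]; exact hΘA q hq hqS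
      rw [← h6]
      exact ⟨Ψ.left_inv h5, Ψ.map_source h5⟩
    refine ⟨Ψ.symm.restrOpen O hOo, LinearMap.range A, ⟨hft, hpO⟩, ?_, ⟨?_, ?_, ?_⟩, ?_⟩
    · rw [← hW]
      exact LinearMap.finrank_range_of_inj (LinearMap.ker_eq_bot.1 hAinj)
    · exact h4.mono fun y hy => hy.1
    · exact h3.mono fun y hy => hy.1
    · rintro y ⟨hyt, hyO⟩
      constructor
      · rintro ⟨q, hq, rfl⟩
        exact ⟨_, (hsymm q (hO _ hyO q hq rfl).1 hq hyO).1.symm⟩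
      · rintro ⟨w, hw⟩
        have hw' : A w = Ψ.symm y := hw
        have hsrc : A w ∈ Ψ.source := by rw [hw']; exact Ψ.map_target hyt
        have hwt : (w : E) ∈ Φ.target := by
          have := h1' hsrc
          rwa [Set.mem_preimage, hπ'A] at this
        refine ⟨Φ.symm w, hΦ.symm_mem hwt w.2, ?_⟩
        have h7 := hΘA (Φ.symm w) (Φ.map_target hwt) (hΦ.symm_mem hwt w.2)
        rw [← h7, ← h2]
        have h8 : (⟨Φ (Φ.symm w), (hΦ.mem_iff _ (Φ.map_target hwt)).1
            (hΦ.symm_mem hwt w.2)⟩ : W) = w := Subtype.ext (Φ.right_inv hwt)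
        rw [h8, hw', Ψ.right_inv hyt]
    · refine ⟨fun y => Φ.symm (π' (Ψ.symm y)), ?_, ?_, ?_⟩
      · have h5 : Ψ.symm (f p) = e₀ := (hsymm p hpΦ hp hpO).1
        have h6 : ContDiffAt ℝ ∞ Φ.symm (π' (Ψ.symm (f p))) := by
          rw [h5, hπe₀]; exact hΦ.contDiffAt_symm hpt
        have h7 : ContDiffAt ℝ ∞ Ψ.symm (f p) := h4.contDiffAt (Ψ.open_target.mem_nhds hft)
        exact h6.comp (f p) (π'.contDiff.contDiffAt.comp (f p) h7)
      · simp only [(hsymm p hpΦ hp hpO).1, hπ'A, Φ.left_inv hpΦ]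
      · filter_upwards [hOo.mem_nhds hpO] with y hy q hq hqy
        subst hqy
        have hqs := (hO _ hy q hq rfl).1
        simp only [(hsymm q hqs hq hy).1, hπ'A, Φ.left_inv hqs]
  refine ⟨?_, fun p hp => ?_⟩
  · rintro _ ⟨p, hp, rfl⟩
    obtain ⟨Ψ, W, h1, h2, h3, -⟩ := key p hp
    exact ⟨Ψ, W, h1, h2, h3⟩
  · obtain ⟨_, _, _, _, _, h⟩ := key p hp
    exact h

end Straightening

/-! ### Principal curvatures in homogeneous coordinates and the Dupin property -/

section Dupin

/-- The extended real number with homogeneous coordinates `c`. -/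
noncomputable def affineCoord (c : ℝ × ℝ) : WithTop ℝ :=
  if c.2 = 0 then ⊤ else ((c.1 / c.2 : ℝ) : WithTop ℝ)

/-- The determinant of two pairs of homogeneous coordinates. -/
def cross (c d : ℝ × ℝ) : ℝ := c.1 * d.2 - d.1 * c.2

@[simp] theorem homCoord_top : homCoord ⊤ = (1, 0) := rfl

@[simp] theorem homCoord_coe (a : ℝ) : homCoord (a : WithTop ℝ) = (a, 1) := rfl

theorem homCoord_ne_zero (κ : WithTop ℝ) : homCoord κ ≠ 0 := by
  induction κ using WithTop.recTopCoe <;> simp [Prod.ext_iff]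

theorem exists_homCoord_affineCoord {c : ℝ × ℝ} (hc : c ≠ 0) :
    ∃ a : ℝ, a ≠ 0 ∧ c = a • homCoord (affineCoord c) := by
  by_cases h : c.2 = 0
  · refine ⟨c.1, fun h1 => hc (Prod.ext h1 h), ?_⟩
    simp [affineCoord, h, Prod.ext_iff]
  · refine ⟨c.2, h, ?_⟩
    simp [affineCoord, h, Prod.ext_iff]
    field_simp

theorem affineCoord_homCoord (κ : WithTop ℝ) : affineCoord (homCoord κ) = κ := by
  induction κ using WithTop.recTopCoe <;> simp [affineCoord]

theorem affineCoord_eq_of_cross_eq_zero {c d : ℝ × ℝ} (hc : c ≠ 0) (hd : d ≠ 0) (h : cross c d = 0) :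
    affineCoord c = affineCoord d := by
  unfold cross at h
  unfold affineCoord
  by_cases h1 : c.2 = 0
  · have h2 : c.1 ≠ 0 := fun h2 => hc (Prod.ext h2 h1)
    have h3 : d.2 = 0 := by simpa [h1, h2] using h
    simp [h1, h3]
  · by_cases h2 : d.2 = 0
    · have h3 : d.1 = 0 := by simpa [h1, h2] using h
      exact absurd (Prod.ext h3 h2) hd
    · rw [if_neg h1, if_neg h2]
      congr 1
      rw [div_eq_div_iff h1 h2]
      linarith

theorem cross_eq_zero_of_affineCoord_eq {c d : ℝ × ℝ} (hc : c ≠ 0) (hd : d ≠ 0)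
    (h : affineCoord c = affineCoord d) : cross c d = 0 := by
  obtain ⟨a, -, ha⟩ := exists_homCoord_affineCoord hc
  obtain ⟨b, -, hb⟩ := exists_homCoord_affineCoord hd
  rw [ha, hb, h]
  simp only [cross, Prod.smul_fst, Prod.smul_snd, smul_eq_mul]
  ring

variable {F : Type*} [NormedAddCommGroup F] [InnerProductSpace ℝ F]

/-- Two relations with independent coefficients kill both components: principal spaces of distinct
principal curvatures meet only in `0`. -/
theorem eq_zero_of_cross_ne_zero {c d : ℝ × ℝ} (h : cross c d ≠ 0) {w : F × F}
    (hc : c.1 • w.1 + c.2 • w.2 = 0) (hd : d.1 • w.1 + d.2 • w.2 = 0) : w = 0 := by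
  have h1 : cross c d • w.1 = d.2 • (c.1 • w.1 + c.2 • w.2) - c.2 • (d.1 • w.1 + d.2 • w.2) := by
    unfold cross; module
  have h2 : cross c d • w.2 = c.1 • (d.1 • w.1 + d.2 • w.2) - d.1 • (c.1 • w.1 + c.2 • w.2) := by
    unfold cross; module
  rw [hc, hd, smul_zero, smul_zero, sub_zero] at h1 h2
  exact Prod.ext ((smul_eq_zero.1 h1).resolve_left h) ((smul_eq_zero.1 h2).resolve_left h)

/-- `c` gives homogeneous coordinates of a principal curvature of `B` at `p`. -/
def IsCurvatureDirection (B : Set (F × F)) (p : F × F) (c : ℝ × ℝ) : Prop :=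
  ∃ w ∈ tangentVectors B p, w ≠ 0 ∧ c.1 • w.1 + c.2 • w.2 = 0

theorem mem_principalCurvatures_iff {B : Set (F × F)} {p : F × F} {κ : WithTop ℝ} :
    κ ∈ principalCurvatures B p ↔ IsCurvatureDirection B p (homCoord κ) :=
  ⟨fun ⟨w, hw, h0⟩ => ⟨w, hw.1, h0, hw.2⟩, fun ⟨w, hw, h0, h⟩ => ⟨w, ⟨hw, h⟩, h0⟩⟩

theorem relation_affineCoord_iff {c : ℝ × ℝ} (hc : c ≠ 0) (w : F × F) :
    (homCoord (affineCoord c)).1 • w.1 + (homCoord (affineCoord c)).2 • w.2 = 0 ↔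
      c.1 • w.1 + c.2 • w.2 = 0 := by
  obtain ⟨a, ha, hac⟩ := exists_homCoord_affineCoord hc
  conv_rhs => rw [hac]
  simp only [Prod.smul_fst, Prod.smul_snd, smul_assoc]
  rw [← smul_add, smul_eq_zero, or_iff_right ha]

theorem affineCoord_mem_principalCurvatures_iff {B : Set (F × F)} {p : F × F} {c : ℝ × ℝ} (hc : c ≠ 0) :
    affineCoord c ∈ principalCurvatures B p ↔ IsCurvatureDirection B p c := by
  simp only [mem_principalCurvatures_iff, IsCurvatureDirection, relation_affineCoord_iff hc]

theorem curvatureSphere_affineCoord {c : ℝ × ℝ} (hc : c ≠ 0) (p : F × F) :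
    curvatureSphere p (affineCoord c) = Submodule.span ℝ {(c.1, c.1 • p.1 + c.2 • p.2, c.2)} := by
  obtain ⟨a, ha, hac⟩ := exists_homCoord_affineCoord hc
  unfold curvatureSphere
  rw [← Submodule.span_singleton_smul_eq (IsUnit.mk0 a ha)]
  congr 2
  conv_rhs => rw [hac]
  simp [pointSphere, greatSphere, smul_smul]

/-- In the open set `U`, the functions `ρ j` describe `g` distinct principal curvatures of `B`,
with derivative zero along the corresponding principal spaces. -/
structure CurvatureSystemOn (g : ℕ) (B U : Set (F × F)) (ρ : Fin g → F × F → ℝ × ℝ) : Prop where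
  ne_zero : ∀ p ∈ B, p ∈ U → ∀ j, ρ j p ≠ 0
  independent : ∀ p ∈ B, p ∈ U → ∀ i j, i ≠ j → cross (ρ i p) (ρ j p) ≠ 0
  isCurvatureDirection : ∀ p ∈ B, p ∈ U → ∀ j, IsCurvatureDirection B p (ρ j p)
  complete : ∀ p ∈ B, p ∈ U → ∀ c, c ≠ 0 → IsCurvatureDirection B p c → ∃ j, cross c (ρ j p) = 0
  hasFDerivAt : ∀ p ∈ B, p ∈ U → ∀ j, ∃ D : F × F →L[ℝ] ℝ × ℝ, HasFDerivAt (ρ j) D p ∧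
    ∀ w ∈ tangentVectors B p, (ρ j p).1 • w.1 + (ρ j p).2 • w.2 = 0 → D w = 0

namespace CurvatureSystemOn

variable {g : ℕ} {B U : Set (F × F)} {ρ : Fin g → F × F → ℝ × ℝ}

theorem principalCurvatures_eq (h : CurvatureSystemOn g B U ρ) {p : F × F} (hp : p ∈ B)
    (hpU : p ∈ U) : principalCurvatures B p = Set.range fun j => affineCoord (ρ j p) := by
  ext κ
  constructor
  · intro hκ
    obtain ⟨j, hj⟩ := h.complete p hp hpU _ (homCoord_ne_zero κ) (mem_principalCurvatures_iff.1 hκ)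
    refine ⟨j, ?_⟩
    rw [← affineCoord_homCoord κ]
    exact (affineCoord_eq_of_cross_eq_zero (homCoord_ne_zero κ) (h.ne_zero p hp hpU j) hj).symm
  · rintro ⟨j, rfl⟩
    exact (affineCoord_mem_principalCurvatures_iff (h.ne_zero p hp hpU j)).2
      (h.isCurvatureDirection p hp hpU j)

theorem affineCoord_injective (h : CurvatureSystemOn g B U ρ) {p : F × F} (hp : p ∈ B) (hpU : p ∈ U) :
    Function.Injective fun j => affineCoord (ρ j p) := by
  intro i j hij
  by_contra hne
  exact h.independent p hp hpU i j hne
    (cross_eq_zero_of_affineCoord_eq (h.ne_zero p hp hpU i) (h.ne_zero p hp hpU j) hij)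

variable [FiniteDimensional ℝ F]

/-- No continuity of `κ` is assumed, so one first shows that near `p` it follows a single branch `ρ
j`: a tangent vector of `S` at `p` extends to a continuous tangent field, for which the relations of
the other branches fail at `p` and therefore nearby. Then a segment in the chart joins `p` to `q`
inside `S`, and the sphere does not move along it. -/
theorem eventually_curvatureSphere_eq (h : CurvatureSystemOn g B U ρ) (hU : IsOpen U)
    {S : Set (F × F)} {κ : F × F → WithTop ℝ} (hS : IsCurvatureSurface B S κ) {p : F × F}
    (hp : p ∈ S) (hpU : p ∈ U) :
    ∀ᶠ q in 𝓝[S] p, curvatureSphere q (κ q) = curvatureSphere p (κ p) := by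
  obtain ⟨k, hk⟩ := hS.isSubmanifold
  obtain ⟨Φ, W, hpΦ, -, hΦ⟩ := isSubmanifold_iff.1 hk p hp
  have hpt := Φ.map_source hpΦ
  have htype : ∀ q ∈ S, q ∈ U → ∃ j, affineCoord (ρ j q) = κ q := fun q hq hqU => by
    have := hS.principal q hq
    rwa [h.principalCurvatures_eq (hS.subset hq) hqU] at this
  have hrel : ∀ q ∈ S, q ∈ U → ∀ j, affineCoord (ρ j q) = κ q → ∀ w ∈ tangentVectors S q,
      w ∈ tangentVectors B q ∧ (ρ j q).1 • w.1 + (ρ j q).2 • w.2 = 0 := by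
    intro q hq hqU j hj w hw
    rw [hS.tangent q hq, ← hj] at hw
    exact ⟨hw.1, (relation_affineCoord_iff (h.ne_zero q (hS.subset hq) hqU j) w).1 hw.2⟩
  obtain ⟨j, hj⟩ := htype p hp hpU
  obtain ⟨w, hw, hw0⟩ := hS.principal p hp
  rw [← hS.tangent p hp] at hw
  -- a continuous field of tangent vectors of `S`
  set η : F × F → F × F := fun q => fderiv ℝ Φ.symm (Φ q) (fderiv ℝ Φ p w) with hη
  have hηp : η p = w := hΦ.fderiv_symm_apply hpΦ w
  have hηc : ContinuousAt η p := by
    have h1 : ContinuousAt (fderiv ℝ Φ.symm) (Φ p) :=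
      (hΦ.contDiffOn_symm.continuousOn_fderiv_of_isOpen Φ.open_target (by simp)).continuousAt
        (Φ.open_target.mem_nhds hpt)
    exact (ContinuousAt.comp (f := Φ) h1 (hΦ.contDiffAt hpΦ).continuousAt).clm_apply
      continuousAt_const
  have htan : ∀ v ∈ W, ∀ q ∈ S, q ∈ Φ.source → fderiv ℝ Φ.symm (Φ q) v ∈ tangentVectors S q := by
    intro v hv q hq hqΦ
    rwa [hΦ.mem_tangentVectors_iff hqΦ hq, hΦ.fderiv_apply_symm hqΦ]
  have hwW := (hΦ.mem_tangentVectors_iff hpΦ hp).1 hw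
  have hne : ∀ i, i ≠ j → ∀ᶠ q in 𝓝 p, q ∈ S → q ∈ U → q ∈ Φ.source →
      affineCoord (ρ i q) ≠ κ q := by
    intro i hij
    obtain ⟨D, hD, -⟩ := h.hasFDerivAt p (hS.subset hp) hpU i
    have hc : ContinuousAt (fun q => (ρ i q).1 • (η q).1 + (ρ i q).2 • (η q).2) p :=
      ((hD.continuousAt.fst).smul hηc.fst).add ((hD.continuousAt.snd).smul hηc.snd)
    have h0 : (ρ i p).1 • (η p).1 + (ρ i p).2 • (η p).2 ≠ 0 := by
      rw [hηp]
      intro h1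
      exact hw0 (eq_zero_of_cross_ne_zero (h.independent p (hS.subset hp) hpU i j hij) h1
        (hrel p hp hpU j hj w hw).2)
    filter_upwards [hc.eventually_ne h0] with q hq hqS hqU hqΦ hqκ
    exact hq (hrel q hqS hqU i hqκ _ (htan _ hwW q hqS hqΦ)).2
  have hall : ∀ᶠ q in 𝓝 p, ∀ i, i ≠ j → q ∈ S → q ∈ U → q ∈ Φ.source → affineCoord (ρ i q) ≠ κ q :=
    eventually_all.2 fun i => by
      by_cases hij : i = j
      · exact Eventually.of_forall fun q h => absurd hij h
      · exact (hne i hij).mono fun q h _ => h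
  obtain ⟨O, hO, hOo, hpO⟩ := eventually_nhds_iff.1 hall
  have hO' : ∀ q ∈ O, q ∈ S → q ∈ U → q ∈ Φ.source → affineCoord (ρ j q) = κ q := by
    intro q hqO hqS hqU hqΦ
    obtain ⟨i, hi⟩ := htype q hqS hqU
    by_cases hij : i = j
    · rwa [← hij]
    · exact absurd hi (hO q hqO i hij hqS hqU hqΦ)
  have hnhds : Φ.target ∩ Φ.symm ⁻¹' (O ∩ U) ∈ 𝓝 (Φ p) := by
    refine inter_mem (Φ.open_target.mem_nhds hpt) ?_
    refine (hΦ.contDiffAt_symm hpt).continuousAt ?_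
    rw [Φ.left_inv hpΦ]
    exact (hOo.inter hU).mem_nhds ⟨hpO, hpU⟩
  obtain ⟨ε, hε, hball⟩ := Metric.mem_nhds_iff.1 hnhds
  have hev : ∀ᶠ q in 𝓝 p, q ∈ Φ.source ∧ Φ q ∈ Metric.ball (Φ p) ε :=
    (Φ.open_source.mem_nhds hpΦ |> fun h => (h : ∀ᶠ q in 𝓝 p, q ∈ Φ.source)).and
      ((hΦ.contDiffAt hpΦ).continuousAt (Metric.ball_mem_nhds _ hε))
  refine eventually_nhdsWithin_iff.2 ?_
  filter_upwards [hev] with q ⟨hqΦ, hqb⟩ hqS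
  set v := Φ q - Φ p with hv
  have hpW := (hΦ.mem_iff p hpΦ).1 hp
  have hvW : v ∈ W := W.sub_mem ((hΦ.mem_iff q hqΦ).1 hqS) hpW
  have hseg : ∀ t ∈ Set.Icc (0 : ℝ) 1, Φ p + t • v ∈ Metric.ball (Φ p) ε := by
    intro t ht
    rw [Metric.mem_ball, dist_eq_norm] at hqb ⊢
    rw [add_sub_cancel_left, norm_smul, Real.norm_of_nonneg ht.1]
    exact lt_of_le_of_lt (mul_le_of_le_one_left (norm_nonneg _) ht.2) hqb
  set δ : ℝ → F × F := fun t => Φ.symm (Φ p + t • v) with hδ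
  have hδS : ∀ t ∈ Set.Icc (0 : ℝ) 1, δ t ∈ S ∧ δ t ∈ U ∧ affineCoord (ρ j (δ t)) = κ (δ t) := by
    intro t ht
    have h1 := hball (hseg t ht)
    have h2 : δ t ∈ S := hΦ.symm_mem h1.1 (W.add_mem hpW (W.smul_mem _ hvW))
    exact ⟨h2, h1.2.2, hO' _ h1.2.1 h2 h1.2.2 (Φ.map_target h1.1)⟩
  -- Homogeneous coordinates of the curvature sphere. Along `S` the derivative of `ρ j` vanishes by
  -- hypothesis, and what remains is the relation defining principal vectors.
  set Θ : F × F → ℝ × F × ℝ :=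
    fun q => ((ρ j q).1, (ρ j q).1 • q.1 + (ρ j q).2 • q.2, (ρ j q).2) with hΘ
  have hderiv : ∀ t ∈ Set.Icc (0 : ℝ) 1, HasDerivAt (Θ ∘ δ) 0 t := by
    intro t ht
    have h1 := hball (hseg t ht)
    obtain ⟨h2, h3, h4⟩ := hδS t ht
    have hline : HasDerivAt (fun t : ℝ => Φ p + t • v) v t := by
      simpa using ((hasDerivAt_id t).smul_const v).const_add (Φ p)
    have hd := (hΦ.hasFDerivAt_symm h1.1).comp_hasDerivAt t hline
    set u := fderiv ℝ Φ.symm (Φ p + t • v) v with hu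
    have hut : u ∈ tangentVectors S (δ t) := by
      have := htan v hvW (δ t) h2 (Φ.map_target h1.1)
      rwa [hδ, Φ.right_inv h1.1] at this
    obtain ⟨hB, hr⟩ := hrel _ h2 h3 j h4 u hut
    obtain ⟨D, hD, hD0⟩ := h.hasFDerivAt _ (hS.subset h2) h3 j
    have hρ : HasDerivAt (fun t => ρ j (δ t)) 0 t := by
      have h5 := hD.comp_hasDerivAt t hd
      rwa [hD0 u hB hr] at h5
    have hδ' : HasDerivAt δ u t := hd
    have hρ1 : HasDerivAt (fun t => (ρ j (δ t)).1) 0 t :=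
      (ContinuousLinearMap.fst ℝ ℝ ℝ).hasFDerivAt.comp_hasDerivAt t hρ
    have hρ2 : HasDerivAt (fun t => (ρ j (δ t)).2) 0 t :=
      (ContinuousLinearMap.snd ℝ ℝ ℝ).hasFDerivAt.comp_hasDerivAt t hρ
    have hδ1 : HasDerivAt (fun t => (δ t).1) u.1 t :=
      (ContinuousLinearMap.fst ℝ F F).hasFDerivAt.comp_hasDerivAt t hδ'
    have hδ2 : HasDerivAt (fun t => (δ t).2) u.2 t :=
      (ContinuousLinearMap.snd ℝ F F).hasFDerivAt.comp_hasDerivAt t hδ'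
    have h7 := hρ1.prodMk (((hρ1.smul hδ1).add (hρ2.smul hδ2)).prodMk hρ2)
    refine HasDerivAt.congr_deriv (f := Θ ∘ δ) h7 ?_
    rw [zero_smul, zero_smul, add_zero, add_zero, hr]
    rfl
  have hconst := constant_of_has_deriv_right_zero (f := Θ ∘ δ) (a := 0) (b := 1)
    (fun t ht => (hderiv t ht).continuousAt.continuousWithinAt)
    (fun t ht => (hderiv t ⟨ht.1, ht.2.le⟩).hasDerivWithinAt) 1 (by simp)
  have h0 : δ 0 = p := by simp [hδ, Φ.left_inv hpΦ]
  have h1 : δ 1 = q := by simp [hδ, hv, Φ.left_inv hqΦ]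
  simp only [Function.comp, h0, h1] at hconst
  obtain ⟨-, hqU, hqκ⟩ := hδS 1 (by simp)
  rw [h1] at hqU hqκ
  rw [← hqκ, ← hj, curvatureSphere_affineCoord (h.ne_zero q (hS.subset hqS) hqU j),
    curvatureSphere_affineCoord (h.ne_zero p (hS.subset hp) hpU j)]
  exact congrArg (fun z => Submodule.span ℝ {z}) hconst

end CurvatureSystemOn

variable [FiniteDimensional ℝ F]

/-- A Legendre submanifold is proper Dupin if its principal curvatures are locally described by
functions with derivative zero along the corresponding principal spaces. -/
theorem IsLegendreSubmanifold.isProperDupin {g : ℕ} {B : Set (F × F)}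
    (hB : IsLegendreSubmanifold B)
    (h : ∀ p ∈ B, ∃ U, IsOpen U ∧ p ∈ U ∧ ∃ ρ, CurvatureSystemOn g B U ρ) :
    IsProperDupin g B where
  legendre := hB
  dupin := by
    intro S κ hS p hp q hq
    -- In the discrete topology a locally constant family of spheres is continuous, so connectedness
    -- of `S` applies.
    let _ : TopologicalSpace (Submodule ℝ (LieSpace F)) := ⊥
    have : DiscreteTopology (Submodule ℝ (LieSpace F)) := ⟨rfl⟩
    refine hS.connected.isPreconnected.constant (f := fun p => curvatureSphere p (κ p)) ?_ hp hq
    intro x hx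
    obtain ⟨U, hU, hxU, ρ, hρ⟩ := h x (hS.subset hx)
    have := hρ.eventually_curvatureSphere_eq hU hS hx hxU
    exact tendsto_nhds_of_eventually_eq this
  proper := by
    intro p hp
    obtain ⟨U, hU, hpU, ρ, hρ⟩ := h p hp
    rw [hρ.principalCurvatures_eq hp hpU]
    refine ⟨Set.finite_range _, ?_⟩
    rw [← Set.image_univ, Set.ncard_image_of_injective _ (hρ.affineCoord_injective hp hpU)]
    simp

end Dupin

/-! ### Rotations along normal great circles -/

section Mix

variable {X : Type*} [NormedAddCommGroup X] [NormedSpace ℝ X]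

/-- The linear map `(x, ξ) ↦ (a x + b ξ, ε (-b x + a ξ))`. -/
noncomputable def mix (a b ε : ℝ) : X × X →L[ℝ] X × X :=
  (a • ContinuousLinearMap.fst ℝ X X + b • ContinuousLinearMap.snd ℝ X X).prod
    (ε • (-b • ContinuousLinearMap.fst ℝ X X + a • ContinuousLinearMap.snd ℝ X X))

@[simp] theorem mix_apply (a b ε : ℝ) (p : X × X) :
    mix a b ε p = (a • p.1 + b • p.2, ε • (-b • p.1 + a • p.2)) := rfl

/-- The matrix is orthogonal with determinant `ε`; its transpose has the same form, with `-(ε b)` in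
place of `b`. -/
theorem mix_mix {a b ε : ℝ} (h : a ^ 2 + b ^ 2 = 1) (hε : ε ^ 2 = 1) (p : X × X) :
    mix a (-(ε * b)) ε (mix a b ε p) = p := by
  have hε' : ε * ε = 1 := by rw [← sq, hε]
  have h' : a * a + b * b = 1 := by linarith
  simp only [mix_apply]
  refine Prod.ext ?_ ?_
  · calc _ = (a * a + (ε * ε) * (b * b)) • p.1 + (a * b - (ε * ε) * (a * b)) • p.2 := by module
      _ = p.1 := by rw [hε', one_mul, one_mul, h', sub_self, one_smul, zero_smul, add_zero]
  · calc _ = ((ε * ε) * (a * a + b * b)) • p.2 := by module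
      _ = p.2 := by rw [hε', h', one_mul, one_smul]

theorem mix_mix' {a b ε : ℝ} (h : a ^ 2 + b ^ 2 = 1) (hε : ε ^ 2 = 1) (p : X × X) :
    mix a b ε (mix a (-(ε * b)) ε p) = p := by
  have h' : a ^ 2 + (-(ε * b)) ^ 2 = 1 := by rw [neg_sq, mul_pow, hε, one_mul, h]
  have := mix_mix h' hε p
  have h2 : -(ε * -(ε * b)) = b := by linear_combination b * hε
  rwa [h2] at this

end Mix

theorem cross_mix {a b ε : ℝ} (h : a ^ 2 + b ^ 2 = 1) (c d : ℝ × ℝ) :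
    cross (mix a b ε c) (mix a b ε d) = ε * cross c d := by
  simp only [cross, mix_apply, smul_eq_mul]
  linear_combination ε * (c.1 * d.2 - d.1 * c.2) * h

/-! ### Transfer of the Legendre and Dupin conditions under rotations -/

section Transfer

variable {F : Type*} [NormedAddCommGroup F] [InnerProductSpace ℝ F]

theorem hasDerivAt_inner_zero_of_const {u v : ℝ → F} {u' v' : F} {k : ℝ}
    (hu : HasDerivAt u u' 0) (hv : HasDerivAt v v' 0) (h : ∀ᶠ t in 𝓝 (0 : ℝ), ⟪u t, v t⟫ = k) :
    ⟪u 0, v'⟫ + ⟪u', v 0⟫ = 0 := by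
  have h1 := hu.inner ℝ hv
  have h2 : HasDerivAt (fun t => ⟪u t, v t⟫) 0 0 := (hasDerivAt_const _ k).congr_of_eventuallyEq h
  exact h1.unique h2

namespace IsLegendreSubmanifold

theorem inner_tangent {B : Set (F × F)} (hB : IsLegendreSubmanifold B) {p w : F × F}
    (hw : w ∈ tangentVectors B p) :
    ⟪p.1, w.1⟫ = 0 ∧ ⟪p.2, w.2⟫ = 0 ∧ ⟪p.1, w.2⟫ + ⟪w.1, p.2⟫ = 0 := by
  obtain ⟨γ, hγ, rfl, hd, hS⟩ := hw
  have h1 : HasDerivAt (fun t => (γ t).1) w.1 0 :=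
    (ContinuousLinearMap.fst ℝ F F).hasFDerivAt.comp_hasDerivAt _ hd
  have h2 : HasDerivAt (fun t => (γ t).2) w.2 0 :=
    (ContinuousLinearMap.snd ℝ F F).hasFDerivAt.comp_hasDerivAt _ hd
  refine ⟨?_, ?_, ?_⟩
  · have := hasDerivAt_inner_zero_of_const (k := 1) h1 h1 (by
      filter_upwards [hS] with t ht
      rw [real_inner_self_eq_norm_sq, hB.unit_fst _ ht, one_pow])
    rw [real_inner_comm (γ 0).1 w.1] at this
    linarith
  · have := hasDerivAt_inner_zero_of_const (k := 1) h2 h2 (by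
      filter_upwards [hS] with t ht
      rw [real_inner_self_eq_norm_sq, hB.unit_snd _ ht, one_pow])
    rw [real_inner_comm (γ 0).2 w.2] at this
    linarith
  · exact hasDerivAt_inner_zero_of_const (k := 0) h1 h2 (by
      filter_upwards [hS] with t ht using hB.orthogonal _ ht)

end IsLegendreSubmanifold

/-- Near `p`, the set `B'` is the image of `B` under `mix a b ε`. -/
structure IsMixedNear (a b ε : ℝ) (B B' : Set (F × F)) (p : F × F) : Prop where
  sq_add_sq : a ^ 2 + b ^ 2 = 1
  sq_eq : ε ^ 2 = 1
  mem_iff : ∀ᶠ q in 𝓝 p, q ∈ B' ↔ mix a (-(ε * b)) ε q ∈ B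

namespace IsMixedNear

variable {a b ε : ℝ} {B B' : Set (F × F)} {p : F × F}

theorem mem (h : IsMixedNear a b ε B B' p) (hp : p ∈ B') : mix a (-(ε * b)) ε p ∈ B :=
  h.mem_iff.self_of_nhds.1 hp

theorem tangentVectors_iff (h : IsMixedNear a b ε B B' p) (w : F × F) :
    w ∈ tangentVectors B' p ↔
      mix a (-(ε * b)) ε w ∈ tangentVectors B (mix a (-(ε * b)) ε p) := by
  constructor
  · intro hw
    exact mem_tangentVectors_image (ContinuousLinearMap.contDiff _).contDiffAt
      (ContinuousLinearMap.hasFDerivAt _) (h.mem_iff.mono fun q hq => hq.1) hw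
  · intro hw
    have hp := mix_mix' h.sq_add_sq h.sq_eq p
    have := mem_tangentVectors_image (f := mix a b ε) (S' := B')
      (ContinuousLinearMap.contDiff _).contDiffAt
      (ContinuousLinearMap.hasFDerivAt _) ?_ hw
    · rwa [hp, mix_mix' h.sq_add_sq h.sq_eq] at this
    · have hc : Tendsto (mix a b ε : F × F → F × F) (𝓝 (mix a (-(ε * b)) ε p)) (𝓝 p) := by
        conv => rw [← hp]
        rw [mix_mix h.sq_add_sq h.sq_eq]
        exact (mix a b ε).continuous.continuousAt
      filter_upwards [hc.eventually h.mem_iff] with q hq hqB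
      rw [hq, mix_mix h.sq_add_sq h.sq_eq]
      exact hqB

theorem isCurvatureDirection_iff (h : IsMixedNear a b ε B B' p) (c : ℝ × ℝ) :
    IsCurvatureDirection B' p (mix a b ε c) ↔
      IsCurvatureDirection B (mix a (-(ε * b)) ε p) c := by
  -- The matrix is orthogonal, so pairing `c` with the inverse image of `w` is the same as pairing
  -- the image of `c` with `w`.
  have hrel : ∀ w : F × F, (mix a b ε c).1 • w.1 + (mix a b ε c).2 • w.2 =
      c.1 • (mix a (-(ε * b)) ε w).1 + c.2 • (mix a (-(ε * b)) ε w).2 := by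
    intro w
    have hε : ε * ε = 1 := by rw [← sq, h.sq_eq]
    simp only [mix_apply, smul_eq_mul]
    calc _ = (a * c.1 + b * c.2) • w.1 + (ε * (-b * c.1 + a * c.2)) • w.2 := by module
      _ = (a * c.1 + (ε * ε) * b * c.2) • w.1 + (ε * (-b * c.1 + a * c.2)) • w.2 := by
        rw [hε, one_mul]
      _ = _ := by module
  constructor
  · rintro ⟨w, hw, h0, hr⟩
    refine ⟨_, (h.tangentVectors_iff w).1 hw, fun h1 => h0 ?_, by rw [← hrel, hr]⟩
    rw [← mix_mix' h.sq_add_sq h.sq_eq w, h1, map_zero]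
  · rintro ⟨w, hw, h0, hr⟩
    have h1 := mix_mix h.sq_add_sq h.sq_eq w
    refine ⟨mix a b ε w, (h.tangentVectors_iff _).2 (by rwa [h1]), fun h2 => h0 ?_, ?_⟩
    · rw [← h1, h2, map_zero]
    · rw [hrel, h1, hr]

theorem exists_curvatureSystemOn (h : IsMixedNear a b ε B B' p) {g : ℕ} {U : Set (F × F)}
    (hU : IsOpen U) (hp : mix a (-(ε * b)) ε p ∈ U) {ρ : Fin g → F × F → ℝ × ℝ}
    (hρ : CurvatureSystemOn g B U ρ) :
    ∃ U', IsOpen U' ∧ p ∈ U' ∧ ∃ ρ', CurvatureSystemOn g B' U' ρ' := by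
  obtain ⟨O, hO, hOo, hpO⟩ := eventually_nhds_iff.1 h.mem_iff
  have hε : ε ≠ 0 := by rintro rfl; simpa using h.sq_eq
  have hnear : ∀ q ∈ O, IsMixedNear a b ε B B' q := fun q hq =>
    ⟨h.1, h.2, eventually_nhds_iff.2 ⟨O, hO, hOo, hq⟩⟩
  set K : F × F →L[ℝ] F × F := mix a (-(ε * b)) ε with hK
  refine ⟨O ∩ K ⁻¹' U, hOo.inter (hU.preimage K.continuous), ⟨hpO, hp⟩,
    fun j q => mix a b ε (ρ j (K q)), ?_, ?_, ?_, ?_, ?_⟩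
  · intro q hq hqU j h0
    apply hρ.ne_zero _ ((hnear q hqU.1).mem hq) hqU.2 j
    rw [← mix_mix h.1 h.2 (ρ j (K q)), h0, map_zero]
  · intro q hq hqU i j hij
    rw [cross_mix h.1]
    exact mul_ne_zero hε (hρ.independent _ ((hnear q hqU.1).mem hq) hqU.2 i j hij)
  · intro q hq hqU j
    exact ((hnear q hqU.1).isCurvatureDirection_iff _).2
      (hρ.isCurvatureDirection _ ((hnear q hqU.1).mem hq) hqU.2 j)
  · intro q hq hqU c hc hdir
    rw [← mix_mix' h.1 h.2 c] at hdir hc ⊢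
    obtain ⟨j, hj⟩ := hρ.complete _ ((hnear q hqU.1).mem hq) hqU.2 (mix a (-(ε * b)) ε c)
      (fun h0 => hc (by rw [h0, map_zero])) (((hnear q hqU.1).isCurvatureDirection_iff _).1 hdir)
    exact ⟨j, by rw [cross_mix h.1, hj, mul_zero]⟩
  · intro q hq hqU j
    obtain ⟨D, hD, hD0⟩ := hρ.hasFDerivAt _ ((hnear q hqU.1).mem hq) hqU.2 j
    refine ⟨(mix a b ε).comp (D.comp K),
      (mix a b ε : ℝ × ℝ →L[ℝ] ℝ × ℝ).hasFDerivAt.comp q (HasFDerivAt.comp q hD K.hasFDerivAt),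
      fun w hw hr => ?_⟩
    have hKw := ((hnear q hqU.1).tangentVectors_iff w).1 hw
    have hrel : (ρ j (K q)).1 • (K w).1 + (ρ j (K q)).2 • (K w).2 = 0 := by
      rw [← hr]
      have hε2 : ε * ε = 1 := by rw [← sq, h.sq_eq]
      generalize ρ j (K q) = c
      simp only [hK, mix_apply, smul_eq_mul]
      symm
      calc _ = (a * c.1 + b * c.2) • w.1 + (ε * (-b * c.1 + a * c.2)) • w.2 := by module
        _ = (a * c.1 + (ε * ε) * b * c.2) • w.1 + (ε * (-b * c.1 + a * c.2)) • w.2 := by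
          rw [hε2, one_mul]
        _ = _ := by module
    rw [ContinuousLinearMap.comp_apply, ContinuousLinearMap.comp_apply, hD0 _ hKw hrel, map_zero]

end IsMixedNear

variable [FiniteDimensional ℝ F] {B B' : Set (F × F)}

/-- The rotated contact form expands into `⟪dx, x⟫`, `⟪dξ, ξ⟫`, `⟪dx, ξ⟫` and `⟪dξ, x⟫`, which all
vanish on a Legendre submanifold. The parameters may depend on the point, because a unit normal
field can change sign between components. -/
theorem IsLegendreSubmanifold.of_isMixedNear (hB : IsLegendreSubmanifold B)
    (h : ∀ p ∈ B', ∃ a b ε, IsMixedNear a b ε B B' p) : IsLegendreSubmanifold B' := by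
  have hcomp : ∀ p ∈ B', ∃ a b ε, IsMixedNear a b ε B B' p ∧ ∃ q ∈ B, p = mix a b ε q := by
    intro p hp
    obtain ⟨a, b, ε, hm⟩ := h p hp
    exact ⟨a, b, ε, hm, _, hm.mem hp, (mix_mix' hm.1 hm.2 p).symm⟩
  have hunit : ∀ (a b : ℝ) (x ξ : F), a ^ 2 + b ^ 2 = 1 → ‖x‖ = 1 → ‖ξ‖ = 1 → ⟪x, ξ⟫ = 0 →
      ‖a • x + b • ξ‖ = 1 := by
    intro a b x ξ hab hx hξ h0
    have : ‖a • x + b • ξ‖ ^ 2 = 1 := by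
      rw [norm_add_sq_real, norm_smul, norm_smul, hx, hξ, inner_smul_left, inner_smul_right, h0]
      simpa using hab
    exact (pow_eq_one_iff_of_nonneg (norm_nonneg _) two_ne_zero).1 this
  refine ⟨?_, ?_, ?_, ?_, ?_⟩
  · intro p hp
    obtain ⟨a, b, ε, hm, q, hq, rfl⟩ := hcomp p hp
    exact hunit a b _ _ hm.1 (hB.unit_fst q hq) (hB.unit_snd q hq) (hB.orthogonal q hq)
  · intro p hp
    obtain ⟨a, b, ε, hm, q, hq, rfl⟩ := hcomp p hp
    have hε : ‖ε‖ = 1 := (pow_eq_one_iff_of_nonneg (norm_nonneg _) two_ne_zero).1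
      (by rw [Real.norm_eq_abs, sq_abs, hm.2])
    rw [mix_apply, norm_smul, hε, one_mul]
    refine hunit _ _ _ _ ?_ (hB.unit_fst q hq) (hB.unit_snd q hq) (hB.orthogonal q hq)
    linarith [hm.1, neg_sq b]
  · intro p hp
    obtain ⟨a, b, ε, hm, q, hq, rfl⟩ := hcomp p hp
    have h1 := hB.orthogonal q hq
    have h2 : ⟪q.2, q.1⟫ = 0 := by rw [real_inner_comm, h1]
    simp only [mix_apply, inner_add_left, inner_add_right, inner_smul_left, inner_smul_right, h1,
      h2, real_inner_self_eq_norm_sq, hB.unit_fst q hq, hB.unit_snd q hq]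
    simp
    ring_nf
    simp
  · refine isSubmanifold_of_locally fun p hp => ?_
    obtain ⟨a, b, ε, hm⟩ := h p hp
    refine ⟨mix a b ε '' B, (hB.isSubmanifold.image_of_embedding
      (ContinuousLinearMap.contDiff _) ?_ ?_).1, ?_⟩
    · intro q hq U hU
      have hc : Tendsto (mix a (-(ε * b)) ε : F × F → F × F) (𝓝 (mix a b ε q)) (𝓝 q) := by
        have := (mix a (-(ε * b)) ε : F × F →L[ℝ] F × F).continuous.tendsto (mix a b ε q)
        rwa [mix_mix hm.1 hm.2] at this
      filter_upwards [hc hU] with y hy r hr hry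
      rw [← hry, Set.mem_preimage, mix_mix hm.1 hm.2] at hy
      exact hy
    · intro q hq w hw h0
      rw [ContinuousLinearMap.fderiv] at h0
      rw [← mix_mix hm.1 hm.2 w, h0, map_zero]
    · filter_upwards [hm.mem_iff] with q hq
      rw [hq]
      exact ⟨fun h1 => ⟨_, h1, mix_mix' hm.1 hm.2 q⟩,
        fun ⟨r, hr, hrq⟩ => by rwa [← hrq, mix_mix hm.1 hm.2]⟩
  · intro p hp w hw
    obtain ⟨a, b, ε, hm⟩ := h p hp
    have hq := hm.mem hp
    have hv := (hm.tangentVectors_iff w).1 hw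
    have hpq := mix_mix' hm.1 hm.2 p
    have hwv := mix_mix' hm.1 hm.2 w
    generalize mix a (-(ε * b)) ε p = q at hq hv hpq
    generalize mix a (-(ε * b)) ε w = v at hv hwv
    obtain ⟨h1, h2, h3⟩ := hB.inner_tangent hv
    have h4 := hB.contact q hq v hv
    rw [h4, add_zero] at h3
    rw [real_inner_comm] at h1 h2 h3
    subst hpq hwv
    simp only [mix_apply, inner_add_left, inner_add_right, inner_smul_left, inner_smul_right, h1,
      h2, h3, h4]
    simp

theorem IsLegendreSubmanifold.isProperDupin_of_isMixedNear {g : ℕ} (hB : IsLegendreSubmanifold B)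
    (hρ : ∀ p ∈ B, ∃ U, IsOpen U ∧ p ∈ U ∧ ∃ ρ, CurvatureSystemOn g B U ρ)
    (h : ∀ p ∈ B', ∃ a b ε, IsMixedNear a b ε B B' p) : IsProperDupin g B' := by
  refine (hB.of_isMixedNear h).isProperDupin fun p hp => ?_
  obtain ⟨a, b, ε, hm⟩ := h p hp
  obtain ⟨U, hU, hpU, ρ, hρ⟩ := hρ _ (hm.mem hp)
  exact hm.exists_curvatureSystemOn hU hpU hρ

end Transfer

/-! ### Harmonic quadruples of homogeneous coordinates -/

section Harmonic

/-- `C` contains homogeneous coordinates of four points, two pairs of which are harmonic. -/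
def ContainsHarmonic (C : Set (ℝ × ℝ)) : Prop :=
  ∃ v₁ ∈ C, ∃ v₂ ∈ C, ∃ v₃ ∈ C, ∃ v₄ ∈ C,
    cross v₁ v₂ ≠ 0 ∧ cross v₁ v₃ ≠ 0 ∧ cross v₁ v₄ ≠ 0 ∧ cross v₂ v₃ ≠ 0 ∧ cross v₂ v₄ ≠ 0 ∧
      cross v₃ v₄ ≠ 0 ∧ cross v₁ v₂ * cross v₃ v₄ = cross v₂ v₃ * cross v₁ v₄

/-- Both sides of the harmonic relation are quadratic in `cross`, so `k` contributes `k²` to each.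
Unlike the Lie curvature, the condition refers to no ordering of the points, and a projective map
need not preserve one. -/
theorem ContainsHarmonic.of_mapsTo {C C' : Set (ℝ × ℝ)} (h : ContainsHarmonic C)
    {g : ℝ × ℝ → ℝ × ℝ} {k : ℝ} (hk : k ≠ 0) (hg : ∀ c d, cross (g c) (g d) = k * cross c d)
    (hC : ∀ c ∈ C, g c ∈ C') : ContainsHarmonic C' := by
  obtain ⟨v₁, h₁, v₂, h₂, v₃, h₃, v₄, h₄, h12, h13, h14, h23, h24, h34, h⟩ := h
  refine ⟨g v₁, hC _ h₁, g v₂, hC _ h₂, g v₃, hC _ h₃, g v₄, hC _ h₄, ?_, ?_, ?_, ?_, ?_, ?_, ?_⟩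
  · rw [hg]; exact mul_ne_zero hk h12
  · rw [hg]; exact mul_ne_zero hk h13
  · rw [hg]; exact mul_ne_zero hk h14
  · rw [hg]; exact mul_ne_zero hk h23
  · rw [hg]; exact mul_ne_zero hk h24
  · rw [hg]; exact mul_ne_zero hk h34
  · simp only [hg]
    linear_combination k ^ 2 * h

end Harmonic

/-! ### Lie equivalence and isoparametric hypersurfaces -/

section LieEquivalence

variable {F : Type*} [NormedAddCommGroup F] [InnerProductSpace ℝ F]

theorem mem_lieLine_iff {p : F × F} {z : LieSpace F} :
    z ∈ lieLine p ↔ z = (z.1, z.1 • p.1 + z.2.2 • p.2, z.2.2) := by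
  unfold lieLine
  rw [Submodule.mem_span_pair]
  constructor
  · rintro ⟨a, b, rfl⟩
    simp [pointSphere, greatSphere]
  · intro h
    refine ⟨z.1, z.2.2, ?_⟩
    conv_rhs => rw [h]
    simp [pointSphere, greatSphere]

/-- The contact element of the projective line through `z` and `w`. -/
noncomputable def contactElement (z w : LieSpace F) : F × F :=
  ((z.1 * w.2.2 - z.2.2 * w.1)⁻¹ • (w.2.2 • z.2.1 - z.2.2 • w.2.1),
    (z.1 * w.2.2 - z.2.2 * w.1)⁻¹ • (z.1 • w.2.1 - w.1 • z.2.1))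

/-- Both images lie on `lieLine p`, so their middle components are explicit combinations of `p.1`
and `p.2`, and Cramer's rule recovers `p`. The determinant is nonzero because the images span the
line. -/
theorem contactElement_eq {p q : F × F} {C : LieSpace F ≃ₗ[ℝ] LieSpace F}
    (h : (lieLine q).map (C : LieSpace F →ₗ[ℝ] LieSpace F) = lieLine p) :
    (C (pointSphere q)).1 * (C (greatSphere q)).2.2 -
      (C (pointSphere q)).2.2 * (C (greatSphere q)).1 ≠ 0 ∧
    contactElement (C (pointSphere q)) (C (greatSphere q)) = p := by
  have hz : C (pointSphere q) ∈ lieLine p := by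
    rw [← h]
    exact Submodule.mem_map_of_mem (Submodule.subset_span (by simp))
  have hw : C (greatSphere q) ∈ lieLine p := by
    rw [← h]
    exact Submodule.mem_map_of_mem (Submodule.subset_span (by simp))
  have hex : ∀ v ∈ lieLine p, ∃ r s : ℝ,
      r • C (pointSphere q) + s • C (greatSphere q) = v := by
    intro v hv
    rw [← h] at hv
    obtain ⟨u, hu, rfl⟩ := hv
    obtain ⟨r, s, rfl⟩ := Submodule.mem_span_pair.1 hu
    exact ⟨r, s, by simp⟩
  obtain ⟨r, s, h1⟩ := hex (pointSphere p) (Submodule.subset_span (by simp))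
  obtain ⟨r', s', h2⟩ := hex (greatSphere p) (Submodule.subset_span (by simp))
  have hz' := congrArg (fun v : LieSpace F => v.2.1) (mem_lieLine_iff.1 hz)
  have hw' := congrArg (fun v : LieSpace F => v.2.1) (mem_lieLine_iff.1 hw)
  simp only at hz' hw'
  have e1 := congrArg (fun v : LieSpace F => v.1) h1
  have e2 := congrArg (fun v : LieSpace F => v.2.2) h1
  have e3 := congrArg (fun v : LieSpace F => v.1) h2
  have e4 := congrArg (fun v : LieSpace F => v.2.2) h2
  simp only [pointSphere, greatSphere, Prod.fst_add, Prod.snd_add, Prod.smul_fst, Prod.smul_snd,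
    smul_eq_mul] at e1 e2 e3 e4
  unfold contactElement
  simp only [pointSphere, greatSphere] at hz' hw' ⊢
  generalize C (1, q.1, 0) = z at *
  generalize C (0, q.2, 1) = w at *
  have hΔ : z.1 * w.2.2 - z.2.2 * w.1 ≠ 0 := by
    intro h0
    -- Multiplicativity of the determinant: the outer coordinates of `pointSphere p` and
    -- `greatSphere p` form the identity matrix.
    have : (r * s' - r' * s) * (z.1 * w.2.2 - z.2.2 * w.1) = 1 := by
      calc _ = (r * z.1 + s * w.1) * (r' * z.2.2 + s' * w.2.2)
            - (r * z.2.2 + s * w.2.2) * (r' * z.1 + s' * w.1) := by ring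
        _ = 1 := by rw [e1, e2, e3, e4]; ring
    rw [h0, mul_zero] at this
    exact zero_ne_one this
  refine ⟨hΔ, Prod.ext ?_ ?_⟩
  · rw [inv_smul_eq_iff₀ hΔ]
    rw [hz', hw']
    module
  · rw [inv_smul_eq_iff₀ hΔ]
    rw [hz', hw']
    module

variable [FiniteDimensional ℝ F] {X : Type*} [NormedAddCommGroup X] [NormedSpace ℝ X]

/-- A family of contact elements, all of which are mapped to `B` by a Lie sphere transformation,
has the same curvature directions as `B` up to a linear change of homogeneous coordinates. -/
theorem exists_isCurvatureDirection_iff {k : ℕ} {B : Set (F × F)} (hB : IsSubmanifold k B)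
    (hk : Module.finrank ℝ X = k) (C : LieSpace F ≃ₗ[ℝ] LieSpace F) {f ν : X → F} {x₀ : X}
    (hf : ContDiffAt ℝ ∞ f x₀) (hν : ContDiffAt ℝ ∞ ν x₀)
    (hinj : Function.Injective (fderiv ℝ f x₀))
    (hline : ∀ x, ∃ p ∈ B, (lieLine (f x, ν x)).map (C : LieSpace F →ₗ[ℝ] LieSpace F) = lieLine p)
    {p : F × F} (hp : (lieLine (f x₀, ν x₀)).map (C : LieSpace F →ₗ[ℝ] LieSpace F) = lieLine p) :
    ∃ a b c d : ℝ, a * d - b * c ≠ 0 ∧ ∀ r : ℝ × ℝ,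
      IsCurvatureDirection B p (r.1 * a + r.2 * c, r.1 * b + r.2 * d) ↔
        ∃ v, v ≠ 0 ∧ r.1 • fderiv ℝ f x₀ v + r.2 • fderiv ℝ ν x₀ v = 0 := by
  set C' : LieSpace F ≃L[ℝ] LieSpace F := C.toContinuousLinearEquiv with hC'
  set z : X → LieSpace F := fun x => C' (1, f x, 0) with hz
  set w : X → LieSpace F := fun x => C' (0, ν x, 1) with hw
  have hzs : ContDiffAt ℝ ∞ z x₀ :=
    C'.contDiff.contDiffAt.comp x₀ (contDiffAt_const.prodMk (hf.prodMk contDiffAt_const))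
  have hws : ContDiffAt ℝ ∞ w x₀ :=
    C'.contDiff.contDiffAt.comp x₀ (contDiffAt_const.prodMk (hν.prodMk contDiffAt_const))
  have hΔ : ∀ x, (z x).1 * (w x).2.2 - (z x).2.2 * (w x).1 ≠ 0 := fun x => by
    obtain ⟨q, -, hq⟩ := hline x
    exact (contactElement_eq hq).1
  -- Cramer's formula makes the contact element of the image line a smooth function of `x`.
  set φ : X → F × F := fun x => contactElement (z x) (w x) with hφ
  have hφB : ∀ x, φ x ∈ B := fun x => by
    obtain ⟨q, hqB, hq⟩ := hline x
    rwa [show φ x = q from (contactElement_eq hq).2]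
  have hφp : φ x₀ = p := (contactElement_eq hp).2
  have hφl : ∀ x, (lieLine (f x, ν x)).map (C : LieSpace F →ₗ[ℝ] LieSpace F) = lieLine (φ x) :=
    fun x => by
      obtain ⟨q, hqB, hq⟩ := hline x
      rw [show φ x = q from (contactElement_eq hq).2, hq]
  have hφs : ContDiffAt ℝ ∞ φ x₀ := by
    have h1 : ContDiffAt ℝ ∞ (fun x => ((z x).1 * (w x).2.2 - (z x).2.2 * (w x).1)⁻¹) x₀ := by
      refine ContDiffAt.inv ?_ (hΔ x₀)
      exact (hzs.fst.mul hws.snd.snd).sub (hzs.snd.snd.mul hws.fst)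
    exact (h1.smul ((hws.snd.snd.smul hzs.snd.fst).sub (hzs.snd.snd.smul hws.snd.fst))).prodMk
      (h1.smul ((hzs.fst.smul hws.snd.fst).sub (hws.fst.smul hzs.snd.fst)))
  have hzl : ∀ x, (z x).2.1 = (z x).1 • (φ x).1 + (z x).2.2 • (φ x).2 := fun x => by
    have : z x ∈ lieLine (φ x) := by
      rw [← hφl]; exact Submodule.mem_map_of_mem (Submodule.subset_span (by simp [pointSphere]))
    exact congrArg (fun v : LieSpace F => v.2.1) (mem_lieLine_iff.1 this)
  have hwl : ∀ x, (w x).2.1 = (w x).1 • (φ x).1 + (w x).2.2 • (φ x).2 := fun x => by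
    have : w x ∈ lieLine (φ x) := by
      rw [← hφl]; exact Submodule.mem_map_of_mem (Submodule.subset_span (by simp [greatSphere]))
    exact congrArg (fun v : LieSpace F => v.2.1) (mem_lieLine_iff.1 this)
  -- derivatives
  have hfd := (hf.differentiableAt (by simp)).hasFDerivAt
  have hνd := (hν.differentiableAt (by simp)).hasFDerivAt
  have hφd := (hφs.differentiableAt (by simp)).hasFDerivAt
  have hzd : ∀ v, HasDerivAt (fun t : ℝ => z (x₀ + t • v)) (C' (0, fderiv ℝ f x₀ v, 0)) 0 := by
    intro v
    have hl : HasDerivAt (fun t : ℝ => x₀ + t • v) v 0 := by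
      simpa using ((hasDerivAt_id (0 : ℝ)).smul_const v).const_add x₀
    have h1 : HasDerivAt (fun t : ℝ => f (x₀ + t • v)) (fderiv ℝ f x₀ v) 0 := by
      refine HasFDerivAt.comp_hasDerivAt (0 : ℝ) ?_ hl
      simpa using hfd
    exact C'.hasFDerivAt.comp_hasDerivAt (0 : ℝ)
      ((hasDerivAt_const _ _).prodMk (h1.prodMk (hasDerivAt_const _ _)))
  have hwd : ∀ v, HasDerivAt (fun t : ℝ => w (x₀ + t • v)) (C' (0, fderiv ℝ ν x₀ v, 0)) 0 := by
    intro v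
    have hl : HasDerivAt (fun t : ℝ => x₀ + t • v) v 0 := by
      simpa using ((hasDerivAt_id (0 : ℝ)).smul_const v).const_add x₀
    have h1 : HasDerivAt (fun t : ℝ => ν (x₀ + t • v)) (fderiv ℝ ν x₀ v) 0 := by
      refine HasFDerivAt.comp_hasDerivAt (0 : ℝ) ?_ hl
      simpa using hνd
    exact C'.hasFDerivAt.comp_hasDerivAt (0 : ℝ)
      ((hasDerivAt_const _ _).prodMk (h1.prodMk (hasDerivAt_const _ _)))
  have hφv : ∀ v, HasDerivAt (fun t : ℝ => φ (x₀ + t • v)) (fderiv ℝ φ x₀ v) 0 := by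
    intro v
    have hl : HasDerivAt (fun t : ℝ => x₀ + t • v) v 0 := by
      simpa using ((hasDerivAt_id (0 : ℝ)).smul_const v).const_add x₀
    have hφ0 : HasFDerivAt φ (fderiv ℝ φ x₀) (x₀ + (0 : ℝ) • v) := by simpa using hφd
    exact hφ0.comp_hasDerivAt (0 : ℝ) hl
  have hcomp : ∀ (y : X → LieSpace F) (v : X) (y' : LieSpace F),
      HasDerivAt (fun t : ℝ => y (x₀ + t • v)) y' 0 →
      (∀ x, (y x).2.1 = (y x).1 • (φ x).1 + (y x).2.2 • (φ x).2) →
      y'.2.1 = (y x₀).1 • (fderiv ℝ φ x₀ v).1 + (y x₀).2.2 • (fderiv ℝ φ x₀ v).2 +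
        (y'.1 • (φ x₀).1 + y'.2.2 • (φ x₀).2) := by
    intro y v y' hy hyl
    have d1 : HasDerivAt (fun t : ℝ => (y (x₀ + t • v)).1) y'.1 0 :=
      (ContinuousLinearMap.fst ℝ ℝ (F × ℝ)).hasFDerivAt.comp_hasDerivAt (0 : ℝ) hy
    have d2 : HasDerivAt (fun t : ℝ => (y (x₀ + t • v)).2) y'.2 0 :=
      (ContinuousLinearMap.snd ℝ ℝ (F × ℝ)).hasFDerivAt.comp_hasDerivAt (0 : ℝ) hy
    have d3 : HasDerivAt (fun t : ℝ => (y (x₀ + t • v)).2.1) y'.2.1 0 :=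
      (ContinuousLinearMap.fst ℝ F ℝ).hasFDerivAt.comp_hasDerivAt (0 : ℝ) d2
    have d4 : HasDerivAt (fun t : ℝ => (y (x₀ + t • v)).2.2) y'.2.2 0 :=
      (ContinuousLinearMap.snd ℝ F ℝ).hasFDerivAt.comp_hasDerivAt (0 : ℝ) d2
    have d5 : HasDerivAt (fun t : ℝ => (φ (x₀ + t • v)).1) (fderiv ℝ φ x₀ v).1 0 :=
      (ContinuousLinearMap.fst ℝ F F).hasFDerivAt.comp_hasDerivAt (0 : ℝ) (hφv v)
    have d6 : HasDerivAt (fun t : ℝ => (φ (x₀ + t • v)).2) (fderiv ℝ φ x₀ v).2 0 :=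
      (ContinuousLinearMap.snd ℝ F F).hasFDerivAt.comp_hasDerivAt (0 : ℝ) (hφv v)
    have d7 := (d1.smul d5).add (d4.smul d6)
    have d8 := d3.unique (d7.congr_of_eventuallyEq (Eventually.of_forall fun t => hyl _))
    simp only [zero_smul, add_zero] at d8
    rw [d8]
    module
  -- Put `u = r.1 df v + r.2 dν v`. The vector `(0, u, 0)` lies on the line of `(f x₀, ν x₀)` only
  -- if `u = 0`, while by `hcomp` its image under `C` lies on the line of `φ x₀` exactly when the
  -- combination of the components of `dφ v` vanishes.
  have hiff : ∀ (r : ℝ × ℝ) (v : X), r.1 • fderiv ℝ f x₀ v + r.2 • fderiv ℝ ν x₀ v = 0 ↔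
      (r.1 * (z x₀).1 + r.2 * (w x₀).1) • (fderiv ℝ φ x₀ v).1 +
        (r.1 * (z x₀).2.2 + r.2 * (w x₀).2.2) • (fderiv ℝ φ x₀ v).2 = 0 := by
    intro r v
    have e1 := hcomp z v _ (hzd v) hzl
    have e2 := hcomp w v _ (hwd v) hwl
    have e3 : C' (0, r.1 • fderiv ℝ f x₀ v + r.2 • fderiv ℝ ν x₀ v, 0) =
        r.1 • C' (0, fderiv ℝ f x₀ v, 0) + r.2 • C' (0, fderiv ℝ ν x₀ v, 0) := by
      rw [← map_smul C', ← map_smul C', ← map_add C']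
      simp
    have e4 : (C' (0, r.1 • fderiv ℝ f x₀ v + r.2 • fderiv ℝ ν x₀ v, 0)).2.1 =
        ((r.1 * (z x₀).1 + r.2 * (w x₀).1) • (fderiv ℝ φ x₀ v).1 +
        (r.1 * (z x₀).2.2 + r.2 * (w x₀).2.2) • (fderiv ℝ φ x₀ v).2) +
        ((C' (0, r.1 • fderiv ℝ f x₀ v + r.2 • fderiv ℝ ν x₀ v, 0)).1 • (φ x₀).1 +
        (C' (0, r.1 • fderiv ℝ f x₀ v + r.2 • fderiv ℝ ν x₀ v, 0)).2.2 • (φ x₀).2) := by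
      rw [e3]
      simp only [Prod.fst_add, Prod.snd_add, Prod.smul_fst, Prod.smul_snd, e1, e2, smul_eq_mul]
      module
    set u := r.1 • fderiv ℝ f x₀ v + r.2 • fderiv ℝ ν x₀ v with hu
    constructor
    · intro h0
      rw [h0, show ((0 : ℝ), (0 : F), (0 : ℝ)) = 0 from rfl, map_zero] at e4
      simpa using e4.symm
    · intro h0
      rw [h0, zero_add] at e4
      have e5 : C' (0, u, 0) ∈ lieLine (φ x₀) := mem_lieLine_iff.2 (Prod.ext rfl (Prod.ext e4 rfl))
      rw [← hφl] at e5
      obtain ⟨y, hy, hyC⟩ := e5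
      have e6 : y = (0, u, 0) := C.injective hyC
      rw [e6] at hy
      have e7 := congrArg (fun v : LieSpace F => v.2.1) (mem_lieLine_iff.1 hy)
      simpa using e7
  have hφinj : Function.Injective (fderiv ℝ φ x₀) := by
    rw [injective_iff_map_eq_zero]
    intro v hv
    have h1 := (hiff (1, 0) v).2 (by simp [hv])
    simp only [one_smul, zero_smul, add_zero] at h1
    exact hinj (by rw [h1, map_zero])
  obtain ⟨T, hT, hTB⟩ := hB.exists_tangentSpace (hφB x₀)
  -- `φ` is an immersion into `B` from a space of the same dimension, so its differential reaches
  -- every tangent vector.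
  have hrange : LinearMap.range (fderiv ℝ φ x₀).toLinearMap = T := by
    refine Submodule.eq_of_le_of_finrank_eq ?_ ?_
    · rintro _ ⟨v, rfl⟩
      rw [← SetLike.mem_coe, hTB]
      refine mem_tangentVectors_image (S := Set.univ) hφs hφd
        (Eventually.of_forall fun x _ => hφB x) ?_
      refine ⟨fun t => x₀ + t • v, by fun_prop, by simp, ?_, by simp⟩
      simpa using ((hasDerivAt_id (0 : ℝ)).smul_const v).const_add x₀
    · rw [hT, ← hk]
      exact LinearMap.finrank_range_of_inj hφinj
  refine ⟨(z x₀).1, (z x₀).2.2, (w x₀).1, (w x₀).2.2, hΔ x₀, fun r => ?_⟩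
  rw [← hφp]
  constructor
  · rintro ⟨y, hy, hy0, hr⟩
    rw [← hTB, SetLike.mem_coe, ← hrange] at hy
    obtain ⟨v, rfl⟩ := hy
    refine ⟨v, fun h0 => hy0 (by rw [h0, map_zero]), (hiff r v).2 hr⟩
  · rintro ⟨v, hv, hr⟩
    refine ⟨fderiv ℝ φ x₀ v, ?_, fun h0 => hv (hφinj (by rw [h0, map_zero])), (hiff r v).1 hr⟩
    rw [← hTB, SetLike.mem_coe, ← hrange]
    exact ⟨v, rfl⟩

/-- A Legendre submanifold is not Lie equivalent to an isoparametric hypersurface if the curvature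
spheres contain a harmonic quadruple at one point, but not at another one. -/
theorem not_lieEquivalentToIsoparametric {B : Set (F × F)} (hB : IsLegendreSubmanifold B)
    {p q : F × F} (hp : p ∈ B) (hq : q ∈ B)
    (hharm : ContainsHarmonic {c | IsCurvatureDirection B p c})
    (hnot : ¬ ContainsHarmonic {c | IsCurvatureDirection B q c}) :
    ¬ LieEquivalentToIsoparametric.{u} B := by
  rintro ⟨d, N, _, _, _, _, _, f, ν, hiso, A, -, hA⟩
  have hpoint : ∀ p ∈ B, ∃ x : N, (lieLine (f x, ν x)).map
      (A.symm : LieSpace F →ₗ[ℝ] LieSpace F) = lieLine p := by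
    intro p hp
    have : (lieLine p).map (A : LieSpace F →ₗ[ℝ] LieSpace F) ∈
      lieLine '' (Set.range fun x => (f x, ν x)) := hA ▸ ⟨p, hp, rfl⟩
    obtain ⟨_, ⟨x, rfl⟩, hx⟩ := this
    refine ⟨x, ?_⟩
    rw [hx, ← Submodule.map_comp]
    simp
  have hline : ∀ x : N, ∃ p ∈ B, (lieLine (f x, ν x)).map
      (A.symm : LieSpace F →ₗ[ℝ] LieSpace F) = lieLine p := by
    intro x
    have : lieLine (f x, ν x) ∈
      (fun p => (lieLine p).map (A : LieSpace F →ₗ[ℝ] LieSpace F)) '' B := hA ▸ ⟨_, ⟨x, rfl⟩, rfl⟩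
    obtain ⟨p, hp, hx⟩ := this
    refine ⟨p, hp, ?_⟩
    rw [← hx]
    simp only
    rw [← Submodule.map_comp]
    simp
  -- Each tangent space is by definition the model space; reading the differentials there puts the
  -- kernels at different points into one vector space.
  obtain ⟨Df, hDf⟩ : ∃ Df : N → EuclideanSpace ℝ (Fin d) →ₗ[ℝ] F,
      ∀ x, Df x = differential d f x := ⟨fun x => differential d f x, fun _ => rfl⟩
  obtain ⟨Dν, hDν⟩ : ∃ Dν : N → EuclideanSpace ℝ (Fin d) →ₗ[ℝ] F,
      ∀ x, Dν x = differential d ν x := ⟨fun x => differential d ν x, fun _ => rfl⟩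
  have hDinj : ∀ x, Function.Injective (Df x) := fun x => by
    rw [hDf]; exact hiso.injective x
  have hconst : ∀ x y (κ : ℝ), Module.finrank ℝ (LinearMap.ker (Dν x + κ • Df x)) =
      Module.finrank ℝ (LinearMap.ker (Dν y + κ • Df y)) := fun x y κ => by
    rw [hDf, hDf, hDν, hDν]; exact hiso.constant x y κ
  have hsm : ∀ (x : N) (h : N → F), ContMDiff (𝓡 d) 𝓘(ℝ, F) ∞ h →
      ContDiffAt ℝ ∞ (h ∘ (extChartAt (𝓡 d) x).symm) (extChartAt (𝓡 d) x x) ∧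
      ∀ v : EuclideanSpace ℝ (Fin d), differential d h x v =
        fderiv ℝ (h ∘ (extChartAt (𝓡 d) x).symm) (extChartAt (𝓡 d) x x) v := by
    intro x h hh
    have h1 := (contMDiffAt_iff.1 (hh x)).2
    refine ⟨?_, fun v => ?_⟩
    · rwa [ModelWithCorners.range_eq_univ, contDiffWithinAt_univ, extChartAt_model_space_eq_id]
        at h1
    · have h2 : MDifferentiableAt (𝓡 d) 𝓘(ℝ, F) h x := (hh x).mdifferentiableAt (by simp)
      have h3 : mfderiv (𝓡 d) 𝓘(ℝ, F) h x =
          fderiv ℝ (h ∘ (extChartAt (𝓡 d) x).symm) (extChartAt (𝓡 d) x x) := by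
        rw [h2.mfderiv, ModelWithCorners.range_eq_univ, fderivWithin_univ, writtenInExtChartAt,
          extChartAt_model_space_eq_id]
        rfl
      exact congrArg (fun T : EuclideanSpace ℝ (Fin d) →L[ℝ] F => T v) h3
  have hdir : ∀ p ∈ B, ∃ (x : N) (a b c e : ℝ), a * e - b * c ≠ 0 ∧ ∀ r : ℝ × ℝ,
      IsCurvatureDirection B p (r.1 * a + r.2 * c, r.1 * b + r.2 * e) ↔
        ∃ v, v ≠ 0 ∧ r.1 • Df x v + r.2 • Dν x v = 0 := by
    intro p hp
    obtain ⟨x, hx⟩ := hpoint p hp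
    obtain ⟨hf1, hf2⟩ := hsm x f hiso.smooth_immersion
    obtain ⟨hν1, hν2⟩ := hsm x ν hiso.smooth_normal
    have hdim : Module.finrank ℝ (EuclideanSpace ℝ (Fin d)) = Module.finrank ℝ F - 2 := by
      rw [finrank_euclideanSpace_fin, ← hiso.dim_eq]
      rfl
    have hf2' : ∀ v, Df x v =
        fderiv ℝ (f ∘ (extChartAt (𝓡 d) x).symm) (extChartAt (𝓡 d) x x) v := fun v => by
      rw [hDf]; exact hf2 v
    have hν2' : ∀ v, Dν x v =
        fderiv ℝ (ν ∘ (extChartAt (𝓡 d) x).symm) (extChartAt (𝓡 d) x x) v := fun v => by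
      rw [hDν]; exact hν2 v
    have hinj : Function.Injective
        (fderiv ℝ (f ∘ (extChartAt (𝓡 d) x).symm) (extChartAt (𝓡 d) x x)) := by
      intro v w hvw
      refine hDinj x ?_
      rw [hf2', hf2', hvw]
    obtain ⟨a, b, c, e, h1, h2⟩ := exists_isCurvatureDirection_iff hB.isSubmanifold hdim A.symm
      hf1 hν1 hinj (fun y => hline _) (p := p) (by simpa using hx)
    refine ⟨x, a, b, c, e, h1, fun r => ?_⟩
    rw [h2]
    simp only [hf2', hν2']
  obtain ⟨x, a, b, c, e, hne, hx⟩ := hdir p hp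
  obtain ⟨y, a', b', c', e', hne', hy⟩ := hdir q hq
  -- For `s ≠ 0` solvability means that the kernel belonging to `κ = r / s` is nontrivial, and its
  -- dimension is the same at all points. For `s = 0 ≠ r` there is no solution, since `f` is an
  -- immersion.
  have hxy : ∀ r : ℝ × ℝ, (∃ v, v ≠ 0 ∧ r.1 • Df x v + r.2 • Dν x v = 0) →
      ∃ v, v ≠ 0 ∧ r.1 • Df y v + r.2 • Dν y v = 0 := by
    rintro ⟨r, s⟩ ⟨v, hv, hr⟩
    simp only at hr ⊢
    by_cases hs : s = 0
    · by_cases hr0 : r = 0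
      · exact ⟨v, hv, by simp [hs, hr0]⟩
      · rw [hs, zero_smul, add_zero, smul_eq_zero, or_iff_right hr0] at hr
        exact absurd (hDinj x (by rw [hr, map_zero])) hv
    · have hκ := hconst x y (r / s)
      have hker : ∀ (x : N) (v : EuclideanSpace ℝ (Fin d)),
          v ∈ LinearMap.ker (Dν x + (r / s) • Df x) ↔ r • Df x v + s • Dν x v = 0 := by
        intro x v
        have h1 : r • Df x v + s • Dν x v = s • ((Dν x + (r / s) • Df x) v) := by
          rw [LinearMap.add_apply, LinearMap.smul_apply, smul_add, smul_smul,
            mul_div_cancel₀ _ hs, add_comm]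
        rw [h1, smul_eq_zero, or_iff_right hs, LinearMap.mem_ker]
      have h1 : LinearMap.ker (Dν x + (r / s) • Df x) ≠ ⊥ :=
        (Submodule.ne_bot_iff _).2 ⟨v, (hker x v).2 hr, hv⟩
      have h2 : LinearMap.ker (Dν y + (r / s) • Df y) ≠ ⊥ := by
        intro h0
        rw [h0, finrank_bot] at hκ
        exact h1 (Submodule.finrank_eq_zero.1 hκ)
      obtain ⟨v', hv', hv0⟩ := Submodule.exists_mem_ne_zero_of_ne_bot h2
      exact ⟨v', hv0, (hker y v').1 hv'⟩
  set i := (a * e - b * c)⁻¹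
  have hi : (a * e - b * c) * i = 1 := mul_inv_cancel₀ hne
  -- `g` inverts the change of coordinates at `p` and applies the one at `q`; `k` is the quotient of
  -- their determinants.
  refine hnot (hharm.of_mapsTo (k := (a' * e' - b' * c') * i)
    (g := fun z => (((z.1 * e - z.2 * c) * i) * a' + ((a * z.2 - b * z.1) * i) * c',
      ((z.1 * e - z.2 * c) * i) * b' + ((a * z.2 - b * z.1) * i) * e'))
    (mul_ne_zero hne' (inv_ne_zero hne)) ?_ ?_)
  · intro z w
    simp only [cross]
    linear_combination (i * (a' * e' - b' * c') * (z.1 * w.2 - w.1 * z.2)) * hi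
  · intro z hz
    refine (hy ((z.1 * e - z.2 * c) * i, (a * z.2 - b * z.1) * i)).2 (hxy _ ((hx _).1 ?_))
    have hz' : IsCurvatureDirection B p z := hz
    convert hz' using 1
    refine Prod.ext ?_ ?_
    · simp only
      linear_combination z.1 * hi
    · simp only
      linear_combination z.2 * hi

end LieEquivalence

/-! ### Clifford systems and their focal submanifolds -/

section CliffordSystem

variable {F Y : Type*} [NormedAddCommGroup F] [InnerProductSpace ℝ F]
  [NormedAddCommGroup Y] [InnerProductSpace ℝ Y] {P : Y →L[ℝ] F →L[ℝ] F}

/-- A Clifford system: a linear family of symmetric operators with `(P y)² = ‖y‖²`. -/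
structure IsCliffordSystem (P : Y →L[ℝ] F →L[ℝ] F) : Prop where
  symm : ∀ y u v, ⟪P y u, v⟫ = ⟪u, P y v⟫
  sq : ∀ y u, P y (P y u) = ‖y‖ ^ 2 • u

/-- The focal submanifold `{x | ‖x‖ = 1, ⟪P y x, x⟫ = 0 for all y}` of a Clifford system. -/
def focalSet (P : Y →L[ℝ] F →L[ℝ] F) : Set F := {x | ⟪x, x⟫ = 1 ∧ ∀ y, ⟪P y x, x⟫ = 0}

/-- The vectors orthogonal to `x` and to all `P y x`. -/
def focalTangent (P : Y →L[ℝ] F →L[ℝ] F) (x : F) : Set F :=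
  {w | ⟪x, w⟫ = 0 ∧ ∀ y, ⟪P y x, w⟫ = 0}

namespace IsCliffordSystem

variable {x : F}

/-- Polarization of `(P y)² = ‖y‖²`. -/
theorem anticomm (hP : IsCliffordSystem P) (y z : Y) (u : F) :
    P y (P z u) + P z (P y u) = (2 * ⟪y, z⟫) • u := by
  have h1 := hP.sq (y + z) u
  simp only [map_add, add_apply] at h1
  rw [norm_add_sq_real] at h1
  have h2 := hP.sq y u
  have h3 := hP.sq z u
  have h4 : P y (P z u) + P z (P y u) =
      (P y (P y u) + P z (P y u) + (P y (P z u) + P z (P z u))) - P y (P y u) - P z (P z u) := by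
    abel
  rw [h4, h1, h2, h3]
  module

theorem anticomm_of_orthogonal (hP : IsCliffordSystem P) {y z : Y} (h : ⟪y, z⟫ = 0) (u : F) :
    P y (P z u) = -P z (P y u) := by
  have := hP.anticomm y z u
  rw [h, mul_zero, zero_smul] at this
  exact eq_neg_of_add_eq_zero_left this

theorem inner_apply_apply (hP : IsCliffordSystem P) (y z : Y) (u : F) :
    ⟪P y u, P z u⟫ = ⟪y, z⟫ * ⟪u, u⟫ := by
  have h1 := congrArg (fun v => ⟪v, u⟫) (hP.anticomm y z u)
  simp only [inner_add_left, real_inner_smul_left] at h1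
  have h2 : ⟪P y (P z u), u⟫ = ⟪P y u, P z u⟫ := by rw [hP.symm, real_inner_comm]
  rw [h2, hP.symm z] at h1
  linarith

theorem inner_apply_apply_of_mem (hP : IsCliffordSystem P) (hx : x ∈ focalSet P) (y z : Y) :
    ⟪P y x, P z x⟫ = ⟪y, z⟫ := by
  rw [hP.inner_apply_apply, hx.1, mul_one]

theorem apply_eq_zero (hP : IsCliffordSystem P) (hx : x ∈ focalSet P) {z : Y} (h : P z x = 0) :
    z = 0 := by
  have := hP.inner_apply_apply_of_mem hx z z
  rwa [h, inner_zero_left, eq_comm, inner_self_eq_zero] at this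

/-- Up to multiples of `P y x` and `P z x`, which are orthogonal to `x`, the operators `P y`, `P z`,
`P i` anticommute; reversing their product by symmetry shows that the expression equals its own
negative. -/
theorem inner_triple (hP : IsCliffordSystem P) (hx : x ∈ focalSet P) {y z : Y} (h : ⟪y, z⟫ = 0)
    (i : Y) : ⟪P y (P z x), P i x⟫ = 0 := by
  have e1 : ⟪P y (P z x), P i x⟫ = ⟪x, P z (P y (P i x))⟫ := by rw [hP.symm, hP.symm]
  have e2 : P y (P i x) = (2 * ⟪y, i⟫) • x - P i (P y x) := eq_sub_of_add_eq (hP.anticomm y i x)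
  have e3 : P z (P i (P y x)) = (2 * ⟪z, i⟫) • P y x - P i (P z (P y x)) :=
    eq_sub_of_add_eq (hP.anticomm z i (P y x))
  have e4 : P z (P y x) = -P y (P z x) :=
    hP.anticomm_of_orthogonal (by rw [real_inner_comm, h]) x
  rw [e2, map_sub, map_smul, e3, e4, map_neg, inner_sub_right, inner_sub_right,
    real_inner_smul_right, real_inner_smul_right, inner_neg_right, ← hP.symm z, ← hP.symm y,     hx.2, hx.2, real_inner_comm (P i (P y (P z x))) x] at e1
  have e5 : ⟪P y (P z x), P i x⟫ = ⟪P i (P y (P z x)), x⟫ := by rw [hP.symm i]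
  linarith

theorem inner_apply_apply_apply_self (hP : IsCliffordSystem P) (hx : x ∈ focalSet P) (e y : Y) :
    ⟪P e (P y x), P y x⟫ = 0 := by
  have e1 : P e (P y x) = (2 * ⟪e, y⟫) • x - P y (P e x) := eq_sub_of_add_eq (hP.anticomm e y x)
  rw [e1, inner_sub_left, real_inner_smul_left, hP.symm y (P e x), hP.sq, real_inner_smul_right,
    hx.2, ← hP.symm, hx.2]
  simp

end IsCliffordSystem

theorem isCompact_focalSet [FiniteDimensional ℝ F] : IsCompact (focalSet P) := by
  refine (isCompact_closedBall (0 : F) 1).of_isClosed_subset ?_ ?_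
  · have : focalSet P = {x | ⟪x, x⟫ = 1} ∩ ⋂ y, {x | ⟪P y x, x⟫ = 0} := by
      ext x; simp [focalSet]
    rw [this]
    refine (isClosed_eq (by fun_prop) (by fun_prop)).inter (isClosed_iInter fun y => ?_)
    exact isClosed_eq (by fun_prop) (by fun_prop)
  · intro x hx
    have h1 := hx.1
    rw [real_inner_self_eq_norm_sq] at h1
    rw [mem_closedBall_zero_iff]
    nlinarith [norm_nonneg x]

variable [FiniteDimensional ℝ Y]

/-- The symmetric bilinear map with `⟪Q u v, y⟫ = ⟪P y u, v⟫`. -/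
noncomputable def quadraticMap (P : Y →L[ℝ] F →L[ℝ] F) (u v : F) : Y :=
  ∑ i, ⟪P (stdOrthonormalBasis ℝ Y i) u, v⟫ • stdOrthonormalBasis ℝ Y i

theorem inner_quadraticMap (P : Y →L[ℝ] F →L[ℝ] F) (u v : F) (y : Y) :
    ⟪quadraticMap P u v, y⟫ = ⟪P y u, v⟫ := by
  conv_rhs => rw [← (stdOrthonormalBasis ℝ Y).sum_repr' y]
  simp only [quadraticMap, sum_inner, map_sum, map_smul, sum_apply,
    smul_apply, inner_smul_left]
  exact Finset.sum_congr rfl fun i _ => by simp [mul_comm]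

theorem quadraticMap_eq_iff {u v : F} {b : Y} :
    quadraticMap P u v = b ↔ ∀ y, ⟪P y u, v⟫ = ⟪b, y⟫ := by
  refine ⟨fun h y => by rw [← h, inner_quadraticMap], fun h => ?_⟩
  refine ext_inner_right ℝ fun y => ?_
  rw [inner_quadraticMap, h]

@[fun_prop]
theorem contDiff_quadraticMap {X : Type*} [NormedAddCommGroup X] [NormedSpace ℝ X] {f g : X → F}
    (hf : ContDiff ℝ ∞ f) (hg : ContDiff ℝ ∞ g) :
    ContDiff ℝ ∞ fun x => quadraticMap P (f x) (g x) := by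
  unfold quadraticMap
  refine ContDiff.sum fun i _ => ?_
  exact (((P _).contDiff.comp hf).inner ℝ hg).smul contDiff_const

/-- The product of the focal submanifold with a sphere. -/
def focalProduct (P : Y →L[ℝ] F →L[ℝ] F) (r : ℝ) : Set (F × Y) :=
  {p | p.1 ∈ focalSet P ∧ ⟪p.2, p.2⟫ = r}

theorem hasDerivAt_quadratic {X : Type*} [NormedAddCommGroup X] [NormedSpace ℝ X] (A B C : X) :
    HasDerivAt (fun t : ℝ => A + t • B + t ^ 2 • C) B 0 := by
  have h1 : HasDerivAt (fun t : ℝ => t • B) B 0 := by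
    simpa using (hasDerivAt_id (0 : ℝ)).smul_const B
  have h2 : HasDerivAt (fun t : ℝ => t ^ 2 • C) 0 0 := by
    simpa using (hasDerivAt_pow 2 (0 : ℝ)).smul_const C
  refine ((h1.const_add A).add h2).congr_deriv ?_
  rw [add_zero]

/-- `focalMap`, `normalMap` and `halfSum` are quadratic along lines, so their derivatives are read
off as linear coefficients. -/
theorem fderiv_apply_of_quadratic {X X' : Type*} [NormedAddCommGroup X] [NormedSpace ℝ X]
    [NormedAddCommGroup X'] [NormedSpace ℝ X'] {f : X → X'} {p : X}
    (hf : DifferentiableAt ℝ f p) {w : X} {B C : X'}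
    (h : ∀ t : ℝ, f (p + t • w) = f p + t • B + t ^ 2 • C) : fderiv ℝ f p w = B := by
  have hl : HasDerivAt (fun t : ℝ => p + t • w) w 0 := by
    simpa using ((hasDerivAt_id (0 : ℝ)).smul_const w).const_add p
  have h0 : HasFDerivAt f (fderiv ℝ f p) (p + (0 : ℝ) • w) := by simpa using hf.hasFDerivAt
  have h1 : HasDerivAt (fun t : ℝ => f (p + t • w)) (fderiv ℝ f p w) 0 :=
    h0.comp_hasDerivAt (0 : ℝ) hl
  rw [funext h] at h1
  exact h1.unique (hasDerivAt_quadratic _ _ _)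

theorem inner_line {X : Type*} [NormedAddCommGroup X] [InnerProductSpace ℝ X] (x w : X) (t : ℝ) :
    ⟪x + t • w, x + t • w⟫ = ⟪x, x⟫ + t • (2 * ⟪x, w⟫) + t ^ 2 • ⟪w, w⟫ := by
  simp only [inner_add_left, inner_add_right, inner_smul_left, inner_smul_right,
    real_inner_comm x w, smul_eq_mul]
  simp
  ring

theorem quadraticMap_line (hP : IsCliffordSystem P) (x w : F) (t : ℝ) :
    quadraticMap P (x + t • w) (x + t • w) =
      quadraticMap P x x + t • ((2 : ℝ) • quadraticMap P x w) + t ^ 2 • quadraticMap P w w := by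
  rw [quadraticMap_eq_iff]
  intro y
  simp only [inner_add_left, real_inner_smul_left, inner_quadraticMap, map_add, map_smul,
    inner_add_right, real_inner_smul_right]
  rw [hP.symm y w x, real_inner_comm (P y x) w]
  ring

/-- The equations of the focal submanifold. -/
noncomputable def focalMap (P : Y →L[ℝ] F →L[ℝ] F) (x : F) : ℝ × Y :=
  (⟪x, x⟫ - 1, quadraticMap P x x)

theorem focalMap_eq_zero_iff {x : F} : focalMap P x = 0 ↔ x ∈ focalSet P := by
  simp only [focalMap, Prod.mk_eq_zero, sub_eq_zero, quadraticMap_eq_iff, inner_zero_left]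
  rfl

theorem contDiff_focalMap : ContDiff ℝ ∞ (focalMap P) :=
  ((contDiff_id.inner ℝ contDiff_id).sub contDiff_const).prodMk
    (contDiff_quadraticMap contDiff_id contDiff_id)

theorem fderiv_focalMap (hP : IsCliffordSystem P) (x w : F) :
    fderiv ℝ (focalMap P) x w = (2 * ⟪x, w⟫, (2 : ℝ) • quadraticMap P x w) := by
  refine fderiv_apply_of_quadratic (C := (⟪w, w⟫, quadraticMap P w w))
    (contDiff_focalMap.differentiable (by simp) x) fun t => ?_
  simp only [focalMap, inner_line, quadraticMap_line hP, Prod.mk_add_mk, Prod.smul_mk]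
  refine Prod.ext ?_ rfl
  simp only
  ring

/-- The vectors `x` and `P b x` suffice, because `⟪P y x, P b x⟫ = ⟪y, b⟫` on the focal set: the
gradients of the equations are orthogonal there. -/
theorem focalMap_surjective (hP : IsCliffordSystem P) {x : F} (hx : x ∈ focalSet P) (a : ℝ)
    (b : Y) : ∃ w, (2 * ⟪x, w⟫, (2 : ℝ) • quadraticMap P x w) = (a, b) := by
  refine ⟨(2⁻¹ : ℝ) • (a • x + P b x), Prod.ext ?_ ?_⟩
  · simp only [inner_smul_right, inner_add_right, hx.1, real_inner_comm (P b x) x, hx.2]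
    ring
  · simp only
    have : quadraticMap P x ((2⁻¹ : ℝ) • (a • x + P b x)) = (2⁻¹ : ℝ) • b := by
      rw [quadraticMap_eq_iff]
      intro y
      rw [inner_smul_right, inner_add_right, inner_smul_right, hx.2,
        hP.inner_apply_apply_of_mem hx, inner_smul_left, real_inner_comm]
      simp
    rw [this, smul_smul]
    norm_num

theorem isSubmanifold_focalSet [FiniteDimensional ℝ F] (hP : IsCliffordSystem P) {k : ℕ}
    (hk : k + (1 + Module.finrank ℝ Y) = Module.finrank ℝ F) : IsSubmanifold k (focalSet P) := by
  have h1 : focalSet P = {x | focalMap P x = 0} := by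
    ext x; exact focalMap_eq_zero_iff.symm
  rw [h1]
  refine isSubmanifold_levelSet contDiff_focalMap (fun x hx => ?_) ?_
  · rintro ⟨a, b⟩
    simp only [fderiv_focalMap hP]
    exact focalMap_surjective hP (focalMap_eq_zero_iff.1 hx) a b
  · rw [Module.finrank_prod, Module.finrank_self, hk]

theorem tangentVectors_focalSet [FiniteDimensional ℝ F] (hP : IsCliffordSystem P) {x : F} (hx : x ∈ focalSet P) :
    tangentVectors (focalSet P) x = focalTangent P x := by
  have h1 : focalSet P = {x | focalMap P x = 0} := by
    ext x; exact focalMap_eq_zero_iff.symm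
  rw [h1, tangentVectors_levelSet contDiff_focalMap (focalMap_eq_zero_iff.2 hx)]
  · ext w
    simp only [Set.mem_ofPred_eq, fderiv_focalMap hP, Prod.mk_eq_zero, mul_eq_zero, smul_eq_zero,
      two_ne_zero, false_or, quadraticMap_eq_iff, inner_zero_left]
    rfl
  · rintro ⟨a, b⟩
    simp only [fderiv_focalMap hP]
    exact focalMap_surjective hP hx a b

/-- The equations of the product of the focal submanifold with a sphere. -/
noncomputable def focalProductMap (P : Y →L[ℝ] F →L[ℝ] F) (r : ℝ) (p : F × Y) : (ℝ × Y) × ℝ :=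
  (focalMap P p.1, ⟪p.2, p.2⟫ - r)

theorem focalProductMap_eq_zero_iff {r : ℝ} {p : F × Y} :
    focalProductMap P r p = 0 ↔ p ∈ focalProduct P r := by
  simp only [focalProductMap, Prod.mk_eq_zero, sub_eq_zero, focalMap_eq_zero_iff]
  rfl

theorem contDiff_focalProductMap {r : ℝ} : ContDiff ℝ ∞ (focalProductMap P r) :=
  (contDiff_focalMap.comp contDiff_fst).prodMk
    ((contDiff_snd.inner ℝ contDiff_snd).sub contDiff_const)

theorem fderiv_focalProductMap (hP : IsCliffordSystem P) {r : ℝ} (p w : F × Y) :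
    fderiv ℝ (focalProductMap P r) p w =
      ((2 * ⟪p.1, w.1⟫, (2 : ℝ) • quadraticMap P p.1 w.1), 2 * ⟪p.2, w.2⟫) := by
  refine fderiv_apply_of_quadratic (C := ((⟪w.1, w.1⟫, quadraticMap P w.1 w.1), ⟪w.2, w.2⟫))
    (contDiff_focalProductMap.differentiable (by simp) p) fun t => ?_
  simp only [focalProductMap, focalMap, Prod.fst_add, Prod.snd_add, Prod.smul_fst, Prod.smul_snd,
    inner_line, quadraticMap_line hP, Prod.mk_add_mk, Prod.smul_mk]
  refine Prod.ext (Prod.ext ?_ rfl) ?_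
  · simp only
    ring
  · simp only
    ring

theorem fderiv_focalProductMap_surjective (hP : IsCliffordSystem P) {r : ℝ} (hr : 0 < r)
    {p : F × Y} (hp : p ∈ focalProduct P r) :
    Function.Surjective (fderiv ℝ (focalProductMap P r) p) := by
  rintro ⟨⟨a, b⟩, c⟩
  obtain ⟨w, hw⟩ := focalMap_surjective hP hp.1 a b
  refine ⟨(w, (c / (2 * r)) • p.2), ?_⟩
  rw [fderiv_focalProductMap hP]
  refine Prod.ext hw ?_
  simp only [inner_smul_right, hp.2]
  field_simp

variable [FiniteDimensional ℝ F]

theorem isSubmanifold_focalProduct (hP : IsCliffordSystem P) {r : ℝ} (hr : 0 < r)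
    (hF : 2 ≤ Module.finrank ℝ F) :
    IsSubmanifold (Module.finrank ℝ F - 2) (focalProduct P r) := by
  have h1 : focalProduct P r = {x | focalProductMap P r x = 0} := by
    ext x; exact focalProductMap_eq_zero_iff.symm
  rw [h1]
  refine isSubmanifold_levelSet contDiff_focalProductMap (fun x hx =>
    fderiv_focalProductMap_surjective hP hr (focalProductMap_eq_zero_iff.1 hx)) ?_
  rw [Module.finrank_prod, Module.finrank_prod, Module.finrank_prod, Module.finrank_self]
  omega

theorem mem_tangentVectors_focalProduct (hP : IsCliffordSystem P) {r : ℝ} (hr : 0 < r)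
    {p : F × Y} (hp : p ∈ focalProduct P r) {w : F × Y} :
    w ∈ tangentVectors (focalProduct P r) p ↔ w.1 ∈ focalTangent P p.1 ∧ ⟪p.2, w.2⟫ = 0 := by
  have h1 : focalProduct P r = {x | focalProductMap P r x = 0} := by
    ext x; exact focalProductMap_eq_zero_iff.symm
  rw [h1, tangentVectors_levelSet contDiff_focalProductMap (focalProductMap_eq_zero_iff.2 hp)
    (fderiv_focalProductMap_surjective hP hr hp)]
  simp only [Set.mem_ofPred_eq, fderiv_focalProductMap hP, Prod.mk_eq_zero, mul_eq_zero,
    smul_eq_zero, two_ne_zero, false_or, quadraticMap_eq_iff, inner_zero_left]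
  rfl

theorem isCompact_focalProduct {r : ℝ} : IsCompact (focalProduct P r) := by
  have : focalProduct P r = focalSet P ×ˢ {y | ⟪y, y⟫ = r} := rfl
  rw [this]
  refine isCompact_focalSet.prod ?_
  refine (isCompact_closedBall (0 : Y) (1 + |r|)).of_isClosed_subset
    (isClosed_eq (by fun_prop) (by fun_prop)) fun y hy => ?_
  have h1 : ⟪y, y⟫ = r := hy
  rw [real_inner_self_eq_norm_sq] at h1
  rw [mem_closedBall_zero_iff]
  nlinarith [norm_nonneg y, le_abs_self r, abs_nonneg r]

end CliffordSystem

/-! ### The unit normal bundle of the stretched focal submanifold -/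

section Stretching

variable {F Y : Type*} [NormedAddCommGroup F] [InnerProductSpace ℝ F]
  [NormedAddCommGroup Y] [InnerProductSpace ℝ Y] {P : Y →L[ℝ] F →L[ℝ] F}
  {T : F ≃L[ℝ] F} {e : Y} {δ : ℝ}

/-- `T` is a symmetric automorphism with `T² = 1 + δ P e`. -/
structure IsStretching (P : Y →L[ℝ] F →L[ℝ] F) (T : F ≃L[ℝ] F) (e : Y) (δ : ℝ) : Prop where
  symm : ∀ u v, ⟪T u, v⟫ = ⟪u, T v⟫
  sq : ∀ u, T (T u) = u + δ • P e u
  inner_self : ⟪e, e⟫ = 1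
  sq_lt_one : δ ^ 2 < 1

namespace IsStretching

theorem inv_symm (hT : IsStretching P T e δ) (u v : F) : ⟪T.symm u, v⟫ = ⟪u, T.symm v⟫ := by
  have := hT.symm (T.symm u) (T.symm v)
  rw [T.apply_symm_apply, T.apply_symm_apply] at this
  exact this.symm

theorem pos (hT : IsStretching P T e δ) : 0 < 1 - δ ^ 2 := sub_pos.2 hT.sq_lt_one

/-- Since `(P e)² = 1`, the operator `T⁻²` is `(1 - δ P e) / (1 - δ²)`, and the term with `P e`
contributes nothing by `inner_apply_apply_apply_self`. -/
theorem inner_inv_inv (hT : IsStretching P T e δ) (hP : IsCliffordSystem P) {x : F}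
    (hx : x ∈ focalSet P) (y : Y) :
    (1 - δ ^ 2) * ⟪T.symm (P y x), T.symm (P y x)⟫ = ⟪y, y⟫ := by
  have he : ‖e‖ ^ 2 = 1 := by rw [← real_inner_self_eq_norm_sq, hT.inner_self]
  have h1 : T (T (P y x - δ • P e (P y x))) = (1 - δ ^ 2) • P y x := by
    rw [hT.sq, map_sub, map_smul, hP.sq, he]
    module
  have h2 : (1 - δ ^ 2) • T.symm (T.symm (P y x)) = P y x - δ • P e (P y x) := by
    rw [← map_smul, ← map_smul, ← h1, T.symm_apply_apply, T.symm_apply_apply]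
  rw [← hT.inv_symm, ← real_inner_smul_left, h2, inner_sub_left, real_inner_smul_left,
    hP.inner_apply_apply_apply_self hx, hP.inner_apply_apply_of_mem hx]
  ring

end IsStretching

/-- The parametrization `(x, y) ↦ (T x, T⁻¹ (P y x))` of the unit normal bundle. -/
noncomputable def normalMap (P : Y →L[ℝ] F →L[ℝ] F) (T : F ≃L[ℝ] F) (p : F × Y) : F × F :=
  (T p.1, T.symm (P p.2 p.1))

theorem contDiff_normalMap : ContDiff ℝ ∞ (normalMap P T) := by
  unfold normalMap
  fun_prop

theorem fderiv_normalMap (p w : F × Y) :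
    fderiv ℝ (normalMap P T) p w = (T w.1, T.symm (P w.2 p.1 + P p.2 w.1)) := by
  refine fderiv_apply_of_quadratic (C := (0, T.symm (P w.2 w.1)))
    (contDiff_normalMap.differentiable (by simp) p) fun t => ?_
  simp only [normalMap, Prod.fst_add, Prod.snd_add, Prod.smul_fst, Prod.smul_snd, map_add,
    map_smul, add_apply, smul_apply, Prod.mk_add_mk, Prod.smul_mk]
  refine Prod.ext ?_ ?_
  · simp
  · simp only
    module

variable [FiniteDimensional ℝ Y]

/-- The inverse of the parametrization of the unit normal bundle. -/
noncomputable def normalInv (P : Y →L[ℝ] F →L[ℝ] F) (T : F ≃L[ℝ] F) (q : F × F) : F × Y :=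
  (T.symm q.1, quadraticMap P (T.symm q.1) (T q.2))

theorem contDiff_normalInv : ContDiff ℝ ∞ (normalInv P T) := by
  unfold normalInv
  exact ContDiff.prodMk (by fun_prop) (contDiff_quadraticMap (by fun_prop) (by fun_prop))

theorem normalInv_normalMap (hP : IsCliffordSystem P) {p : F × Y} (hp : p.1 ∈ focalSet P) :
    normalInv P T (normalMap P T p) = p := by
  refine Prod.ext ?_ ?_
  · simp [normalInv, normalMap]
  · simp only [normalInv, normalMap, T.symm_apply_apply, T.apply_symm_apply, quadraticMap_eq_iff]
    intro y
    rw [hP.inner_apply_apply_of_mem hp, real_inner_comm]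

theorem injOn_normalMap (hP : IsCliffordSystem P) {r : ℝ} :
    Set.InjOn (normalMap P T) (focalProduct P r) := fun p hp q hq h => by
  rw [← normalInv_normalMap (T := T) hP hp.1, h, normalInv_normalMap hP hq.1]

variable [FiniteDimensional ℝ F]

theorem mem_tangentVectors_stretched (hP : IsCliffordSystem P) {x : F} (hx : x ∈ focalSet P)
    {v : F} : v ∈ tangentVectors (T '' focalSet P) (T x) ↔ T.symm v ∈ focalTangent P x := by
  rw [← tangentVectors_focalSet hP hx]
  constructor
  · intro hv
    have := mem_tangentVectors_image (S' := focalSet P) T.symm.contDiff.contDiffAt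
      T.symm.hasFDerivAt (Eventually.of_forall ?_) hv
    · simpa using this
    · rintro _ ⟨y, hy, rfl⟩
      simpa using hy
  · intro hv
    have := mem_tangentVectors_image (S' := T '' focalSet P) T.contDiff.contDiffAt
      T.hasFDerivAt (Eventually.of_forall fun y hy => ⟨y, hy, rfl⟩) hv
    simpa using this

/-- The unit normal bundle of the image of the focal submanifold under `T`. -/
theorem unitNormalBundle_stretched (hP : IsCliffordSystem P) (hT : IsStretching P T e δ) :
    unitNormalBundle (T '' focalSet P) = normalMap P T '' focalProduct P (1 - δ ^ 2) := by
  ext ⟨X, Ξ⟩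
  constructor
  · rintro ⟨⟨x, hx, hxX⟩, hunit, horth, hnormal⟩
    simp only at hxX hunit horth hnormal
    subst hxX
    -- `P y x` is the projection of `T Ξ` to the span of the `P z x`, so the remainder `w` is
    -- tangent to the focal submanifold. Normality of `Ξ` makes `T Ξ` orthogonal to such vectors,
    -- hence `w` is orthogonal to itself.
    set y := quadraticMap P x (T Ξ) with hy
    set w := T Ξ - P y x with hw
    have hxT : ⟪x, T Ξ⟫ = 0 := by rw [← hT.symm, horth]
    have hwt : w ∈ focalTangent P x := by
      refine ⟨?_, fun z => ?_⟩
      · rw [hw, inner_sub_right, hxT, real_inner_comm, hx.2, sub_zero]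
      · rw [hw, inner_sub_right, hP.inner_apply_apply_of_mem hx, ← inner_quadraticMap,
          real_inner_comm, sub_self]
    have h1 : ⟪w, T Ξ⟫ = 0 := by
      rw [← hT.symm]
      exact hnormal _ ((mem_tangentVectors_stretched hP hx).2 (by simpa using hwt))
    have h2 : w = 0 := by
      rw [← inner_self_eq_zero (𝕜 := ℝ)]
      conv_lhs => rw [hw]
      rw [inner_sub_left, real_inner_comm, h1, hwt.2, sub_zero]
    have h3 : Ξ = T.symm (P y x) := by
      rw [← sub_eq_zero.1 h2, T.symm_apply_apply]
    refine ⟨(x, y), ⟨hx, ?_⟩, by simp [normalMap, h3]⟩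
    rw [← hT.inner_inv_inv hP hx, ← h3, real_inner_self_eq_norm_sq, hunit]
    ring
  · rintro ⟨⟨x, y⟩, ⟨hx, hy⟩, h⟩
    simp only [normalMap, Prod.mk.injEq] at h hx hy
    obtain ⟨rfl, rfl⟩ := h
    refine ⟨⟨x, hx, rfl⟩, ?_, ?_, ?_⟩
    · have h1 := hT.inner_inv_inv hP hx y
      rw [hy, real_inner_self_eq_norm_sq] at h1
      have h2 := mul_left_cancel₀ hT.pos.ne' (h1.trans (mul_one _).symm)
      exact (pow_eq_one_iff_of_nonneg (norm_nonneg _) two_ne_zero).1 h2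
    · simp only
      rw [← hT.inv_symm, T.symm_apply_apply, real_inner_comm, hx.2]
    · intro v hv
      simp only at hv ⊢
      rw [← hT.inv_symm, real_inner_comm]
      exact ((mem_tangentVectors_stretched hP hx).1 hv).2 y

/-- `normalInv` is a globally smooth map that inverts `normalMap` on the bundle, so `D normalMap ∘ D
normalInv` fixes the velocity of every curve in the bundle. -/
theorem mem_tangentVectors_normalBundle (hP : IsCliffordSystem P) {r : ℝ} (hr : 0 < r)
    {p : F × Y} (hp : p ∈ focalProduct P r) {v : F × F} :
    v ∈ tangentVectors (normalMap P T '' focalProduct P r) (normalMap P T p) ↔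
      ∃ w ∈ focalTangent P p.1, ∃ z, ⟪p.2, z⟫ = 0 ∧ v = (T w, T.symm (P z p.1 + P p.2 w)) := by
  constructor
  · intro hv
    have h1 : fderiv ℝ (normalInv P T) (normalMap P T p) v ∈
        tangentVectors (focalProduct P r) p := by
      have := mem_tangentVectors_image (S' := focalProduct P r) (f := normalInv P T)
        contDiff_normalInv.contDiffAt
        (contDiff_normalInv.differentiable (by simp) _).hasFDerivAt
        (Eventually.of_forall ?_) hv
      · rwa [normalInv_normalMap hP hp.1] at this
      · rintro _ ⟨q, hq, rfl⟩
        rwa [normalInv_normalMap hP hq.1]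
    have h2 : fderiv ℝ (normalMap P T) p (fderiv ℝ (normalInv P T) (normalMap P T p) v) = v := by
      obtain ⟨γ, hγ, h0, hd, hS⟩ := hv
      have d1 : HasFDerivAt (normalInv P T) (fderiv ℝ (normalInv P T) (normalMap P T p)) (γ 0) := by
        rw [h0]; exact (contDiff_normalInv.differentiable (by simp) _).hasFDerivAt
      have d2 : HasFDerivAt (normalMap P T) (fderiv ℝ (normalMap P T) p)
          ((normalInv P T ∘ γ) 0) := by
        rw [Function.comp, h0, normalInv_normalMap hP hp.1]
        exact (contDiff_normalMap.differentiable (by simp) _).hasFDerivAt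
      have d3 := d2.comp_hasDerivAt (0 : ℝ) (d1.comp_hasDerivAt (0 : ℝ) hd)
      refine d3.unique (hd.congr_of_eventuallyEq ?_)
      filter_upwards [hS] with t ⟨q, hq, hqt⟩
      simp only [Function.comp, ← hqt, normalInv_normalMap hP hq.1]
    rw [mem_tangentVectors_focalProduct hP hr hp] at h1
    rw [fderiv_normalMap] at h2
    exact ⟨_, h1.1, _, h1.2, h2.symm⟩
  · rintro ⟨w, hw, z, hz, rfl⟩
    have := mem_tangentVectors_image (S' := normalMap P T '' focalProduct P r)
      contDiff_normalMap.contDiffAt (contDiff_normalMap.differentiable (by simp) p).hasFDerivAt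
      (Eventually.of_forall fun q hq => ⟨q, hq, rfl⟩)
      ((mem_tangentVectors_focalProduct (w := (w, z)) hP hr hp).2 ⟨hw, hz⟩)
    rwa [fderiv_normalMap] at this

theorem isLegendreSubmanifold_unitNormalBundle (hP : IsCliffordSystem P)
    (hT : IsStretching P T e δ) (hF : 2 ≤ Module.finrank ℝ F)
    (hunit : ∀ x ∈ focalSet P, ‖T x‖ = 1) :
    IsLegendreSubmanifold (unitNormalBundle (T '' focalSet P)) where
  unit_fst := by
    rintro p ⟨⟨x, hx, hxp⟩, -⟩
    rw [← hxp, hunit x hx]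
  unit_snd p hp := hp.2.1
  orthogonal p hp := hp.2.2.1
  isSubmanifold := by
    rw [unitNormalBundle_stretched hP hT]
    refine ((isSubmanifold_focalProduct hP hT.pos hF).image_of_embedding contDiff_normalMap
      (eventually_preimage_of_isCompact isCompact_focalProduct contDiff_normalMap.continuous
        (injOn_normalMap hP)) ?_).1
    rintro ⟨x, y⟩ hp ⟨w, z⟩ hwz h0
    rw [fderiv_normalMap, Prod.mk_eq_zero] at h0
    have hw : w = 0 := by simpa using h0.1
    have hz := h0.2
    simp only [hw, map_zero, add_zero] at hz
    have hz' : P z x = 0 := by simpa using hz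
    rw [hw, hP.apply_eq_zero hp.1 hz']
    rfl
  contact p hp w hw :=
    hp.2.2.2 _ (mem_tangentVectors_image contDiff_fst.contDiffAt
      (ContinuousLinearMap.fst ℝ F F).hasFDerivAt (Eventually.of_forall fun q hq => hq.1) hw)

theorem isCompact_unitNormalBundle (hP : IsCliffordSystem P) (hT : IsStretching P T e δ) :
    IsCompact (unitNormalBundle (T '' focalSet P)) := by
  rw [unitNormalBundle_stretched hP hT]
  exact isCompact_focalProduct.image contDiff_normalMap.continuous

end Stretching

/-! ### The eigenvalue equation of the shape operator -/

section Curvature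

variable {F Y : Type*} [NormedAddCommGroup F] [InnerProductSpace ℝ F]
  [NormedAddCommGroup Y] [InnerProductSpace ℝ Y] {P : Y →L[ℝ] F →L[ℝ] F}
  {T : F ≃L[ℝ] F} {e : Y} {δ : ℝ} {x : F} {y : Y}

/-- Apply `T` and use `T² = 1 + δ P e`: the new term `κ δ P e w` is absorbed by shifting `y` to `y +
κ δ e`. -/
theorem relation_iff (hT : IsStretching P T e δ) (κ : ℝ) (w : F) (z : Y) :
    κ • T w + T.symm (P z x + P y w) = 0 ↔ κ • w + P (y + (κ * δ) • e) w + P z x = 0 := by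
  rw [← map_eq_zero_iff T T.injective, map_add, map_smul, hT.sq, T.apply_symm_apply]
  simp only [map_add, map_smul, add_apply, smul_apply]
  have : κ • (w + δ • P e w) + (P z x + P y w) =
    κ • w + (P y w + (κ * δ) • P e w) + P z x := by module
  rw [this]

/-- The only solutions of the eigenvalue equation of the shape operator. -/
theorem eigenvalue_cases (hP : IsCliffordSystem P) (hx : x ∈ focalSet P) {κ : ℝ} {w : F} {z b : Y}
    (hw : w ∈ focalTangent P x) (h : κ • w + P b w + P z x = 0) (hne : w ≠ 0 ∨ z ≠ 0) :
    κ = 0 ∨ (z = 0 ∧ κ ^ 2 = ⟪b, b⟫) := by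
  -- Apply `P b` to the equation and eliminate `P b w`. Pairing the result with `P z x`, which is
  -- orthogonal to both `w` and `P b (P z x)`, then gives `κ ‖z‖² = 0`.
  have h1 : (⟪b, b⟫ - κ ^ 2) • w = κ • P z x - P b (P z x) := by
    have h2 : P b w = -(κ • w) - P z x := by
      rw [eq_sub_iff_add_eq, eq_neg_iff_add_eq_zero, ← h]; abel
    have h3 := hP.sq b w
    rw [← real_inner_self_eq_norm_sq, h2, map_sub, map_neg, map_smul, h2] at h3
    rw [sub_smul, ← h3]
    module
  have hbz : ⟪b, z⟫ = 0 := by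
    have h2 := congrArg (fun v => ⟪x, v⟫) h1
    simp only [real_inner_smul_right, inner_sub_right, hw.1, ← hP.symm, hx.2] at h2
    rw [hP.symm z, hP.inner_apply_apply_of_mem hx] at h2
    linarith
  have hκ : κ * ⟪z, z⟫ = 0 := by
    have h2 := congrArg (fun v => ⟪P z x, v⟫) h1
    simp only [real_inner_smul_right, inner_sub_right, hw.2,
      hP.inner_apply_apply_of_mem hx] at h2
    rw [real_inner_comm (P b (P z x)), hP.inner_apply_apply_apply_self hx] at h2
    linarith
  rcases mul_eq_zero.1 hκ with h2 | h2
  · exact Or.inl h2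
  · have hz : z = 0 := inner_self_eq_zero.1 h2
    refine Or.inr ⟨hz, ?_⟩
    rw [hz, map_zero, zero_apply, smul_zero, map_zero, sub_zero, smul_eq_zero] at h1
    have hw0 : w ≠ 0 := hne.resolve_right (not_not.2 hz)
    linarith [h1.resolve_right hw0]

theorem exists_ne_zero_orthogonal [FiniteDimensional ℝ Y] (hY : 2 ≤ Module.finrank ℝ Y) (y : Y) :
    ∃ z, z ≠ 0 ∧ ⟪y, z⟫ = 0 := by
  have h1 : LinearMap.ker (innerSL ℝ y).toLinearMap ≠ ⊥ :=
    LinearMap.ker_ne_bot_of_finrank_lt (by rw [Module.finrank_self]; omega)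
  obtain ⟨z, hz, hz0⟩ := Submodule.exists_mem_ne_zero_of_ne_bot h1
  exact ⟨z, hz0, hz⟩

/-- The kernel of the second fundamental form is nontrivial. -/
theorem exists_eigenvector_zero [FiniteDimensional ℝ Y] (hP : IsCliffordSystem P)
    (hx : x ∈ focalSet P) (hY : 2 ≤ Module.finrank ℝ Y) (hy : y ≠ 0) :
    ∃ w ∈ focalTangent P x, ∃ z, ⟪y, z⟫ = 0 ∧ z ≠ 0 ∧ P y w + P z x = 0 := by
  obtain ⟨z, hz, hyz⟩ := exists_ne_zero_orthogonal hY y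
  have hy' : ‖y‖ ^ 2 ≠ 0 := pow_ne_zero 2 (norm_ne_zero_iff.2 hy)
  -- `P y` is invertible, so the equation forces this `w`; it is tangent by `inner_triple`, because
  -- `z` is orthogonal to `y`.
  refine ⟨(-(‖y‖ ^ 2)⁻¹) • P y (P z x), ⟨?_, fun i => ?_⟩, z, hyz, hz, ?_⟩
  · rw [real_inner_smul_right, ← hP.symm, hP.inner_apply_apply_of_mem hx, hyz, mul_zero]
  · rw [real_inner_smul_right, real_inner_comm, hP.inner_triple hx hyz, mul_zero]
  · rw [map_smul, hP.sq, smul_smul, neg_mul, inv_mul_cancel₀ hy', neg_one_smul, neg_add_cancel]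

/-- The eigenspaces of `P b` meet the tangent spaces of the focal submanifold. -/
theorem exists_eigenvector [FiniteDimensional ℝ F] [FiniteDimensional ℝ Y]
    (hP : IsCliffordSystem P) (hY : 2 ≤ Module.finrank ℝ Y)
    (hF : 2 * Module.finrank ℝ Y < Module.finrank ℝ F) {κ : ℝ} (hκ : κ ≠ 0) {b : Y}
    (hb : κ ^ 2 = ⟪b, b⟫) : ∃ w ∈ focalTangent P x, w ≠ 0 ∧ κ • w + P b w = 0 := by
  -- `P z` anticommutes with `P b` and is injective, so it embeds the other eigenspace of `P b` into
  -- `E`, and `E` has at least half the dimension of `F`. As this exceeds `dim Y`, some nonzero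
  -- vector of `E` is orthogonal to every `P y x`; the eigenvalue equation then makes it orthogonal
  -- to `x` as well.
  obtain ⟨z, hz, hbz⟩ := exists_ne_zero_orthogonal hY b
  set R : F →ₗ[ℝ] F := (P b).toLinearMap with hR
  set A : F →ₗ[ℝ] F := κ • LinearMap.id - R with hA
  set E : Submodule ℝ F := LinearMap.ker (κ • LinearMap.id + R) with hE
  have hmemE : ∀ u, u ∈ E ↔ κ • u + P b u = 0 := fun u => Iff.rfl
  have hmemA : ∀ u, u ∈ LinearMap.ker A ↔ κ • u - P b u = 0 := fun u => Iff.rfl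
  have h1 : LinearMap.range A ≤ E := by
    rintro _ ⟨u, rfl⟩
    rw [hmemE]
    have : A u = κ • u - P b u := rfl
    rw [this, map_sub, map_smul, hP.sq, ← real_inner_self_eq_norm_sq, ← hb]
    module
  have hinj : Function.Injective (P z) := by
    intro u v huv
    have h2 := hP.sq z u
    rw [huv, hP.sq] at h2
    exact (smul_right_injective F (pow_ne_zero 2 (norm_ne_zero_iff.2 hz)) h2).symm
  have h2 : Module.finrank ℝ (LinearMap.ker A) ≤ Module.finrank ℝ E := by
    have h3 : (LinearMap.ker A).map (P z).toLinearMap ≤ E := by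
      rintro _ ⟨u, hu, rfl⟩
      rw [hmemE]
      have hu' := (hmemA u).1 hu
      simp only [ContinuousLinearMap.coe_coe]
      rw [hP.anticomm_of_orthogonal hbz, ← map_smul, ← sub_eq_add_neg, ← map_sub, hu', map_zero]
    rw [((LinearMap.ker A).equivMapOfInjective (P z).toLinearMap hinj).finrank_eq]
    exact Submodule.finrank_mono h3
  have h3 := A.finrank_range_add_finrank_ker
  have h4 := Submodule.finrank_mono h1
  set q : F →ₗ[ℝ] Y :=
    { toFun := quadraticMap P x
      map_add' := fun u v => by
        rw [quadraticMap_eq_iff]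
        intro y
        rw [inner_add_left, inner_quadraticMap, inner_quadraticMap, inner_add_right]
      map_smul' := fun c u => by
        rw [quadraticMap_eq_iff]
        intro y
        rw [RingHom.id_apply, real_inner_smul_left, inner_quadraticMap, real_inner_smul_right] }
    with hq
  have h5 : LinearMap.ker (q.comp E.subtype) ≠ ⊥ :=
    LinearMap.ker_ne_bot_of_finrank_lt (by omega)
  obtain ⟨⟨w, hwE⟩, hw, hw0⟩ := Submodule.exists_mem_ne_zero_of_ne_bot h5
  have hw' : ∀ y, ⟪P y x, w⟫ = 0 := fun y => by
    have : quadraticMap P x w = 0 := hw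
    rw [← inner_quadraticMap, this, inner_zero_left]
  rw [hmemE] at hwE
  refine ⟨w, ⟨?_, hw'⟩, fun h => hw0 (Subtype.ext h), hwE⟩
  have h6 : κ * ⟪x, w⟫ = 0 := by
    rw [← real_inner_smul_right, eq_neg_of_add_eq_zero_left hwE, inner_neg_right, ← hP.symm, hw',
      neg_zero]
  exact (mul_eq_zero.1 h6).resolve_left hκ

end Curvature

/-! ### Parallel hypersurfaces and their unit normals -/

section Parallel

variable {F : Type*} [NormedAddCommGroup F] [InnerProductSpace ℝ F]

/-- The point `a x + b ξ` of the normal great circle of a contact element. -/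
noncomputable def parallelPoint (a b : ℝ) : F × F →L[ℝ] F :=
  a • ContinuousLinearMap.fst ℝ F F + b • ContinuousLinearMap.snd ℝ F F

/-- The normal `-b x + a ξ` at the point `a x + b ξ`. -/
noncomputable def parallelNormal (a b : ℝ) : F × F →L[ℝ] F :=
  -b • ContinuousLinearMap.fst ℝ F F + a • ContinuousLinearMap.snd ℝ F F

theorem parallelPoint_apply (a b : ℝ) (p : F × F) : parallelPoint a b p = a • p.1 + b • p.2 := rfl

theorem parallelNormal_apply (a b : ℝ) (p : F × F) :
    parallelNormal a b p = -b • p.1 + a • p.2 := rfl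

theorem mix_eq (a b ε : ℝ) (p : F × F) :
    mix a b ε p = (parallelPoint a b p, ε • parallelNormal a b p) := rfl

namespace IsLegendreSubmanifold

variable {B : Set (F × F)} {a b : ℝ}

theorem inner_parallel (hB : IsLegendreSubmanifold B) (hab : a ^ 2 + b ^ 2 = 1) {p : F × F}
    (hp : p ∈ B) : ⟪parallelPoint a b p, parallelPoint a b p⟫ = 1 ∧
      ⟪parallelNormal a b p, parallelNormal a b p⟫ = 1 ∧
      ⟪parallelPoint a b p, parallelNormal a b p⟫ = 0 := by
  have h1 : ⟪p.1, p.1⟫ = 1 := by rw [real_inner_self_eq_norm_sq, hB.unit_fst p hp, one_pow]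
  have h2 : ⟪p.2, p.2⟫ = 1 := by rw [real_inner_self_eq_norm_sq, hB.unit_snd p hp, one_pow]
  have h3 := hB.orthogonal p hp
  have h4 : ⟪p.2, p.1⟫ = 0 := by rw [real_inner_comm, h3]
  simp only [parallelPoint_apply, parallelNormal_apply, inner_add_left, inner_add_right,
    real_inner_smul_left, real_inner_smul_right, h1, h2, h3, h4]
  refine ⟨?_, ?_, ?_⟩
  · linear_combination hab
  · linear_combination hab
  · ring

theorem inner_parallel_tangent (hB : IsLegendreSubmanifold B) {p w : F × F} (hp : p ∈ B)
    (hw : w ∈ tangentVectors B p) : ⟪parallelPoint a b w, parallelPoint a b p⟫ = 0 ∧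
      ⟪parallelPoint a b w, parallelNormal a b p⟫ = 0 := by
  obtain ⟨h1, h2, h3⟩ := hB.inner_tangent hw
  have h4 := hB.contact p hp w hw
  rw [h4, add_zero] at h3
  rw [real_inner_comm] at h1 h2 h3
  simp only [parallelPoint_apply, parallelNormal_apply, inner_add_left, inner_add_right,
    real_inner_smul_left, real_inner_smul_right, h1, h2, h3, h4]
  simp

variable [FiniteDimensional ℝ F]

/-- The tangent space of the parallel hypersurface has dimension `dim F - 2`, so its orthogonal
complement is the plane spanned by the point and `parallelNormal`; orthogonality to the point leaves
only multiples of the latter. -/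
theorem eq_or_eq_neg_parallelNormal (hB : IsLegendreSubmanifold B) (hab : a ^ 2 + b ^ 2 = 1)
    (hF : 2 ≤ Module.finrank ℝ F)
    (himm : ∀ p ∈ B, ∀ w ∈ tangentVectors B p, parallelPoint a b w = 0 → w = 0)
    {p : F × F} (hp : p ∈ B) {n : F} (hn : ‖n‖ = 1) (hpn : ⟪parallelPoint a b p, n⟫ = 0)
    (hwn : ∀ w ∈ tangentVectors B p, ⟪parallelPoint a b w, n⟫ = 0) :
    n = ⟪n, parallelNormal a b p⟫ • parallelNormal a b p ∧
      ⟪n, parallelNormal a b p⟫ ^ 2 = 1 := by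
  obtain ⟨S, hS, hST⟩ := hB.isSubmanifold.exists_tangentSpace hp
  set h := parallelPoint (F := F) a b
  set k := parallelNormal (F := F) a b
  set U : Submodule ℝ F := S.map h.toLinearMap with hU
  obtain ⟨e1, e2, e3⟩ : ⟪h p, h p⟫ = 1 ∧ ⟪k p, k p⟫ = 1 ∧ ⟪h p, k p⟫ = 0 :=
    hB.inner_parallel hab hp
  have e4 : ⟪k p, h p⟫ = 0 := by rw [real_inner_comm, e3]
  have hmem : ∀ v, v ∈ Uᗮ ↔ ∀ w ∈ tangentVectors B p, ⟪h w, v⟫ = 0 := by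
    intro v
    rw [Submodule.mem_orthogonal, ← hST]
    exact ⟨fun H w hw => H _ ⟨w, hw, rfl⟩, by rintro H _ ⟨w, hw, rfl⟩; exact H w hw⟩
  have hUrank : Module.finrank ℝ U = Module.finrank ℝ F - 2 := by
    rw [← hS]
    have hinj : Function.Injective (h.toLinearMap.comp S.subtype) := by
      rw [← LinearMap.ker_eq_bot, LinearMap.ker_eq_bot']
      rintro ⟨w, hw⟩ hw0
      exact Subtype.ext (himm p hp w (hST ▸ hw) hw0)
    rw [← LinearMap.finrank_range_of_inj hinj, LinearMap.range_comp, Submodule.range_subtype]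
  have hperp : Module.finrank ℝ Uᗮ = Module.finrank ℝ (ℝ × ℝ) := by
    have := U.finrank_add_finrank_orthogonal
    rw [Module.finrank_prod, Module.finrank_self]
    omega
  set L : Uᗮ →ₗ[ℝ] ℝ × ℝ :=
    ((innerSL ℝ (h p)).toLinearMap.prod (innerSL ℝ (k p)).toLinearMap).comp Uᗮ.subtype with hL
  have hLv : ∀ v : Uᗮ, L v = (⟪h p, (v : F)⟫, ⟪k p, (v : F)⟫) := fun v => rfl
  have hhU : h p ∈ Uᗮ := (hmem _).2 fun w hw => (hB.inner_parallel_tangent hp hw).1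
  have hkU : k p ∈ Uᗮ := (hmem _).2 fun w hw => (hB.inner_parallel_tangent hp hw).2
  have hnU : n ∈ Uᗮ := (hmem _).2 hwn
  have hsurj : Function.Surjective L := by
    rintro ⟨r, s⟩
    refine ⟨r • ⟨h p, hhU⟩ + s • ⟨k p, hkU⟩, ?_⟩
    rw [map_add, map_smul, map_smul, hLv, hLv, e1, e2, e3, e4]
    simp
  have hinj : Function.Injective L :=
    (LinearMap.injective_iff_surjective_of_finrank_eq_finrank hperp).2 hsurj
  have hz : (⟨n, hnU⟩ : Uᗮ) = ⟪n, k p⟫ • ⟨k p, hkU⟩ := by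
    apply hinj
    rw [map_smul, hLv, hLv, e2, e3, hpn, real_inner_comm (k p) n]
    simp
  have hz' : n = ⟪n, k p⟫ • k p := congrArg Subtype.val hz
  refine ⟨hz', ?_⟩
  have h1 : ⟪n, n⟫ = 1 := by rw [real_inner_self_eq_norm_sq, hn, one_pow]
  have h2 : ⟪n, n⟫ = ⟪n, k p⟫ * ⟪n, k p⟫ := by
    conv_lhs =>
      arg 2
      rw [hz']
    rw [real_inner_smul_left, real_inner_comm n (k p)]
  rw [sq, ← h2, h1]

theorem parallel_embedding (hB : IsLegendreSubmanifold B) (hc : IsCompact B)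
    (hinj : Set.InjOn (parallelPoint a b) B)
    (himm : ∀ p ∈ B, ∀ w ∈ tangentVectors B p, parallelPoint a b w = 0 → w = 0) :
    IsSubmanifold (Module.finrank ℝ F - 2) (parallelPoint a b '' B) ∧
      ∀ p ∈ B, ∃ g : F → F × F, ContDiffAt ℝ ∞ g (parallelPoint a b p) ∧
        g (parallelPoint a b p) = p ∧
        ∀ᶠ y in 𝓝 (parallelPoint a b p), ∀ q ∈ B, parallelPoint a b q = y → g y = q :=
  hB.isSubmanifold.image_of_embedding (ContinuousLinearMap.contDiff _)
    (eventually_preimage_of_isCompact hc (ContinuousLinearMap.continuous _) hinj)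
    fun p hp w hw h0 => himm p hp w hw (by rwa [ContinuousLinearMap.fderiv] at h0)

theorem mem_tangentVectors_parallel (hB : IsLegendreSubmanifold B) (hc : IsCompact B)
    (hinj : Set.InjOn (parallelPoint a b) B)
    (himm : ∀ p ∈ B, ∀ w ∈ tangentVectors B p, parallelPoint a b w = 0 → w = 0)
    {p : F × F} (hp : p ∈ B) {v : F} :
    v ∈ tangentVectors (parallelPoint a b '' B) (parallelPoint a b p) ↔
      ∃ w ∈ tangentVectors B p, parallelPoint a b w = v := by
  constructor
  · intro hv
    obtain ⟨g, hg, hgp, hgB⟩ := (hB.parallel_embedding hc hinj himm).2 p hp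
    have hgd := (hg.differentiableAt (by simp)).hasFDerivAt
    have h1 := mem_tangentVectors_image (S' := B) hg hgd
      (hgB.mono fun y hy hyB => by
        obtain ⟨q, hq, hqy⟩ := hyB
        rwa [hy q hq hqy]) hv
    rw [hgp] at h1
    refine ⟨_, h1, ?_⟩
    obtain ⟨γ, hγ, h0, hd, hS⟩ := hv
    rw [← h0] at hgd
    have d1 := (parallelPoint (F := F) a b).hasFDerivAt.comp_hasDerivAt (0 : ℝ)
      (hgd.comp_hasDerivAt (0 : ℝ) hd)
    rw [h0] at d1
    refine d1.unique (hd.congr_of_eventuallyEq ?_)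
    filter_upwards [hS, hγ.continuousAt.eventually (h0.symm ▸ hgB)] with t ⟨q, hq, hqt⟩ h2
    simp only [Function.comp, h2 q hq hqt, hqt]
  · rintro ⟨w, hw, rfl⟩
    exact mem_tangentVectors_image (ContinuousLinearMap.contDiff _).contDiffAt
      (parallelPoint (F := F) a b).hasFDerivAt (Eventually.of_forall fun q hq => ⟨q, hq, rfl⟩) hw

/-- A smooth unit normal field of a parallel hypersurface. -/
theorem exists_parallelNormalField (hB : IsLegendreSubmanifold B) (hc : IsCompact B)
    (hab : a ^ 2 + b ^ 2 = 1) (hinj : Set.InjOn (parallelPoint a b) B)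
    (himm : ∀ p ∈ B, ∀ w ∈ tangentVectors B p, parallelPoint a b w = 0 → w = 0) :
    ∃ ν, IsUnitNormalField (parallelPoint a b '' B) ν ∧
      ∀ p ∈ B, ν (parallelPoint a b p) = parallelNormal a b p := by
  set inv := Function.invFunOn (parallelPoint (F := F) a b) B
  have hinv : ∀ p ∈ B, inv (parallelPoint a b p) = p := fun p hp =>
    hinj.leftInvOn_invFunOn hp
  set ν : F → F := fun y => parallelNormal a b (inv y) with hν
  have hνB : ∀ p ∈ B, ν (parallelPoint a b p) = parallelNormal a b p := fun p hp => by
    simp only [hν, hinv p hp]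
  refine ⟨ν, ⟨?_, ?_, ?_, ?_⟩, hνB⟩
  · rintro _ ⟨p, hp, rfl⟩
    obtain ⟨g, hg, hgp, hgB⟩ := (hB.parallel_embedding hc hinj himm).2 p hp
    have h1 : ContDiffAt ℝ ∞ (fun y => parallelNormal a b (g y)) (parallelPoint a b p) :=
      (ContinuousLinearMap.contDiff _).contDiffAt.comp _ hg
    refine h1.contDiffWithinAt.congr_of_eventuallyEq ?_ (by rw [hνB p hp, hgp])
    refine eventually_nhdsWithin_iff.2 (hgB.mono ?_)
    rintro _ hy ⟨q, hq, rfl⟩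
    simp only [hνB q hq, hy q hq rfl]
  · rintro _ ⟨p, hp, rfl⟩
    have := (hB.inner_parallel hab hp).2.1
    rw [hνB p hp]
    rw [real_inner_self_eq_norm_sq] at this
    exact (pow_eq_one_iff_of_nonneg (norm_nonneg _) two_ne_zero).1 this
  · rintro _ ⟨p, hp, rfl⟩
    rw [hνB p hp, (hB.inner_parallel hab hp).2.2]
  · rintro _ ⟨p, hp, rfl⟩ v hv
    obtain ⟨w, hw, rfl⟩ := (hB.mem_tangentVectors_parallel hc hinj himm hp).1 hv
    rw [hνB p hp, (hB.inner_parallel_tangent hp hw).2]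

/-- The Legendre lift of a parallel hypersurface is locally the image of `B` under `mix`. -/
theorem isMixedNear_hypersurfaceLift (hB : IsLegendreSubmanifold B) (hc : IsCompact B)
    (hab : a ^ 2 + b ^ 2 = 1) (hF : 2 ≤ Module.finrank ℝ F)
    (hinj : Set.InjOn (parallelPoint a b) B)
    (himm : ∀ p ∈ B, ∀ w ∈ tangentVectors B p, parallelPoint a b w = 0 → w = 0)
    {ν : F → F} (hν : IsUnitNormalField (parallelPoint a b '' B) ν) {p : F × F} (hp : p ∈ B) :
    ∃ ε, ν (parallelPoint a b p) = ε • parallelNormal a b p ∧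
      IsMixedNear a b ε B (hypersurfaceLift (parallelPoint a b '' B) ν)
        (parallelPoint a b p, ν (parallelPoint a b p)) := by
  obtain ⟨ν₀, hν₀, hν₀B⟩ := hB.exists_parallelNormalField hc hab hinj himm
  -- Continuous with values `±1`, hence locally constant on the hypersurface. It may differ between
  -- components, so the comparison with `B` has to be local.
  set sgn : F → ℝ := fun y => ⟪ν y, ν₀ y⟫ with hsgn
  have hpm : ∀ q ∈ B, ν (parallelPoint a b q) =
      sgn (parallelPoint a b q) • parallelNormal a b q ∧ sgn (parallelPoint a b q) ^ 2 = 1 := by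
    intro q hq
    have hmem : parallelPoint a b q ∈ parallelPoint a b '' B := ⟨q, hq, rfl⟩
    simp only [hsgn, hν₀B q hq]
    refine hB.eq_or_eq_neg_parallelNormal hab hF himm hq (hν.unit _ hmem) (hν.orthogonal _ hmem)
      fun w hw => hν.normal _ hmem _ ?_
    exact (hB.mem_tangentVectors_parallel hc hinj himm hq).2 ⟨w, hw, rfl⟩
  have hmem : parallelPoint a b p ∈ parallelPoint a b '' B := ⟨p, hp, rfl⟩
  set y₀ := parallelPoint a b p with hy₀
  have hcont : ContinuousWithinAt sgn (parallelPoint a b '' B) y₀ :=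
    (hν.smooth.continuousOn y₀ hmem).inner (hν₀.smooth.continuousOn y₀ hmem)
  have hloc : ∀ᶠ y in 𝓝 y₀, y ∈ parallelPoint a b '' B → sgn y = sgn y₀ := by
    refine eventually_nhdsWithin_iff.1 ?_
    filter_upwards [hcont (Metric.ball_mem_nhds _ one_pos), self_mem_nhdsWithin] with y h1 h2
    obtain ⟨q, hq, rfl⟩ := h2
    have h3 : |sgn (parallelPoint a b q) - sgn y₀| < 1 := by
      rw [← Real.dist_eq]; exact h1
    rcases sq_eq_one_iff.1 (hpm q hq).2 with h4 | h4 <;>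
    rcases sq_eq_one_iff.1 (hpm p hp).2 with h5 | h5 <;>
    rw [← hy₀] at h5 <;> rw [h4, h5] at h3 ⊢ <;> norm_num at h3
  refine ⟨sgn y₀, (hpm p hp).1, hab, (hpm p hp).2, ?_⟩
  have hε := (hpm p hp).2
  filter_upwards [(continuous_fst.tendsto (y₀, ν y₀)).eventually hloc] with r hr
  constructor
  · rintro ⟨_, ⟨q, hq, rfl⟩, rfl⟩
    have h1 : (parallelPoint a b q, ν (parallelPoint a b q)) = mix a b (sgn y₀) q := by
      rw [mix_eq, (hpm q hq).1, hr ⟨q, hq, rfl⟩]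
    simp only
    rw [h1, mix_mix hab hε]
    exact hq
  · intro hrB
    have h1 := mix_mix' hab hε r
    set q := mix a (-(sgn y₀ * b)) (sgn y₀) r with hq
    have h2 : r.1 = parallelPoint a b q := by rw [← h1]; rfl
    have h3 : r.2 = sgn y₀ • parallelNormal a b q := by rw [← h1]; rfl
    refine ⟨r.1, ⟨q, hrB, h2.symm⟩, Prod.ext rfl ?_⟩
    simp only
    rw [h2, (hpm q hrB).1, ← h2, hr ⟨q, hrB, h2.symm⟩, h3]

end IsLegendreSubmanifold

end Parallel

/-! ### The roots of the curvature equation -/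

section Roots

/-- The negative root of `κ² - 2 s κ - 1`. -/
noncomputable def rootNeg (s : ℝ) : ℝ := s - √(s ^ 2 + 1)

/-- The positive root of `κ² - 2 s κ - 1`. -/
noncomputable def rootPos (s : ℝ) : ℝ := s + √(s ^ 2 + 1)

theorem sq_sqrt_sq_add_one (s : ℝ) : √(s ^ 2 + 1) ^ 2 = s ^ 2 + 1 := Real.sq_sqrt (by positivity)

theorem abs_lt_sqrt (s : ℝ) : |s| < √(s ^ 2 + 1) := by
  rw [← Real.sqrt_sq_eq_abs]
  exact Real.sqrt_lt_sqrt (sq_nonneg s) (by linarith)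

theorem rootNeg_neg (s : ℝ) : rootNeg s < 0 := by
  have := abs_lt_sqrt s
  have := le_abs_self s
  unfold rootNeg; linarith

theorem rootPos_pos (s : ℝ) : 0 < rootPos s := by
  have := abs_lt_sqrt s
  have := neg_abs_le s
  unfold rootPos; linarith

theorem eq_root_iff {s κ : ℝ} :
    κ ^ 2 - 2 * s * κ - 1 = 0 ↔ κ = rootNeg s ∨ κ = rootPos s := by
  have h : κ ^ 2 - 2 * s * κ - 1 = (κ - rootNeg s) * (κ - rootPos s) := by
    unfold rootNeg rootPos
    linear_combination sq_sqrt_sq_add_one s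
  rw [h, mul_eq_zero, sub_eq_zero, sub_eq_zero]

theorem differentiable_rootNeg : Differentiable ℝ rootNeg := by
  unfold rootNeg
  exact differentiable_id.sub (Differentiable.sqrt (by fun_prop) fun s => by positivity)

theorem differentiable_rootPos : Differentiable ℝ rootPos := by
  unfold rootPos
  exact differentiable_id.add (Differentiable.sqrt (by fun_prop) fun s => by positivity)

theorem rootPos_eq {s κ : ℝ} (hκ : 0 < κ) (h : κ ^ 2 - 2 * s * κ - 1 = 0) : rootPos s = κ := by
  rcases eq_root_iff.1 h with h1 | h1
  · linarith [rootNeg_neg s]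
  · exact h1.symm

theorem rootNeg_eq {s κ : ℝ} (hκ : κ < 0) (h : κ ^ 2 - 2 * s * κ - 1 = 0) : rootNeg s = κ := by
  rcases eq_root_iff.1 h with h1 | h1
  · exact h1.symm
  · linarith [rootPos_pos s]

end Roots

/-! ### Harmonicity of quadruples `a, 0, b, ∞` with `a < 0 < b` -/

section Harmonic

theorem containsHarmonic_of_symmetric {C : Set (ℝ × ℝ)} {κ : ℝ} (hκ : κ ≠ 0) (h1 : (-κ, 1) ∈ C)
    (h2 : (0, 1) ∈ C) (h3 : (κ, 1) ∈ C) (h4 : (1, 0) ∈ C) : ContainsHarmonic C := by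
  refine ⟨_, h1, _, h2, _, h3, _, h4, ?_, ?_, ?_, ?_, ?_, ?_, ?_⟩ <;> simp [cross, hκ]
  intro h
  exact hκ (by linarith)

/-- The points split into two pairs in three ways. Harmonicity of `{a, b}` and `{0, ∞}` means `a + b
= 0`; the other two splittings give `a = 2 b` or `b = 2 a`, impossible for opposite signs. -/
theorem not_containsHarmonic {C : Set (ℝ × ℝ)} {a b : ℝ} (ha : a < 0) (hb : 0 < b)
    (hab : a + b ≠ 0) (hC : ∀ c ∈ C, c ≠ 0 → cross c (a, 1) = 0 ∨ cross c (0, 1) = 0 ∨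
      cross c (b, 1) = 0 ∨ cross c (1, 0) = 0) : ¬ ContainsHarmonic C := by
  have hparam : ∀ c ∈ C, c ≠ 0 → ∃ t : ℝ, t ≠ 0 ∧ ∃ d : ℝ × ℝ,
      (d = (a, 1) ∨ d = (0, 1) ∨ d = (b, 1) ∨ d = (1, 0)) ∧ c = t • d := by
    intro c hc hc0
    have hfin : ∀ k : ℝ, cross c (k, 1) = 0 → c.2 ≠ 0 ∧ c = c.2 • (k, (1 : ℝ)) := by
      intro k hk
      have h1 : c.1 = k * c.2 := by unfold cross at hk; linarith
      refine ⟨fun h2 => hc0 (Prod.ext (by rw [h1, h2, mul_zero]; rfl) h2), Prod.ext ?_ ?_⟩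
      · simp [h1, mul_comm]
      · simp
    rcases hC c hc hc0 with h | h | h | h
    · exact ⟨_, (hfin _ h).1, _, Or.inl rfl, (hfin _ h).2⟩
    · exact ⟨_, (hfin _ h).1, _, Or.inr (Or.inl rfl), (hfin _ h).2⟩
    · exact ⟨_, (hfin _ h).1, _, Or.inr (Or.inr (Or.inl rfl)), (hfin _ h).2⟩
    · have h2 : c.2 = 0 := by unfold cross at h; simpa using h
      refine ⟨c.1, fun h1 => hc0 (Prod.ext h1 h2), _, Or.inr (Or.inr (Or.inr rfl)), Prod.ext ?_ ?_⟩
      · simp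
      · simp [h2]
  rintro ⟨v₁, m₁, v₂, m₂, v₃, m₃, v₄, m₄, h12, h13, h14, h23, h24, h34, h⟩
  have hne : ∀ u v : ℝ × ℝ, cross u v ≠ 0 → u ≠ 0 ∧ v ≠ 0 := by
    refine fun u v huv => ⟨?_, ?_⟩ <;> rintro rfl <;> simp [cross] at huv
  obtain ⟨t₁, n₁, d₁, e₁, rfl⟩ := hparam v₁ m₁ (hne _ _ h12).1
  obtain ⟨t₂, n₂, d₂, e₂, rfl⟩ := hparam v₂ m₂ (hne _ _ h12).2
  obtain ⟨t₃, n₃, d₃, e₃, rfl⟩ := hparam v₃ m₃ (hne _ _ h34).1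
  obtain ⟨t₄, n₄, d₄, e₄, rfl⟩ := hparam v₄ m₄ (hne _ _ h34).2
  have hcr : ∀ (s t : ℝ) (c d : ℝ × ℝ), cross (s • c) (t • d) = s * t * cross c d := by
    intro s t c d
    simp only [cross, Prod.smul_fst, Prod.smul_snd, smul_eq_mul]
    ring
  simp only [hcr] at h12 h13 h14 h23 h24 h34 h
  have key : cross d₁ d₂ * cross d₃ d₄ = cross d₂ d₃ * cross d₁ d₄ := by
    have hn : t₁ * t₂ * t₃ * t₄ ≠ 0 := mul_ne_zero (mul_ne_zero (mul_ne_zero n₁ n₂) n₃) n₄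
    apply mul_left_cancel₀ hn
    linear_combination h
  have hself : ∀ c, cross c c = 0 := fun c => by unfold cross; ring
  replace h12 := right_ne_zero_of_mul h12
  replace h13 := right_ne_zero_of_mul h13
  replace h14 := right_ne_zero_of_mul h14
  replace h23 := right_ne_zero_of_mul h23
  replace h24 := right_ne_zero_of_mul h24
  replace h34 := right_ne_zero_of_mul h34
  clear h m₁ m₂ m₃ m₄ hparam hC hcr hne
  rcases e₁ with rfl | rfl | rfl | rfl <;> rcases e₂ with rfl | rfl | rfl | rfl <;>
    first
    | exact h12 (hself _)
    | (rcases e₃ with rfl | rfl | rfl | rfl <;>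
        first
        | exact h13 (hself _)
        | exact h23 (hself _)
        | (rcases e₄ with rfl | rfl | rfl | rfl <;>
            first
            | exact h14 (hself _)
            | exact h24 (hself _)
            | exact h34 (hself _)
            | (simp only [cross] at key
               first
               | linarith
               | exact hab (by linarith))))

end Harmonic

/-! ### The four principal curvatures and their constancy along principal spaces -/

section CurvatureSystem

variable {F Y : Type*} [NormedAddCommGroup F] [InnerProductSpace ℝ F]
  [NormedAddCommGroup Y] [InnerProductSpace ℝ Y] {P : Y →L[ℝ] F →L[ℝ] F}
  {T : F ≃L[ℝ] F} {e : Y} {δ : ℝ}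

/-- Half the sum of the two principal curvatures different from `0` and `∞`. -/
noncomputable def halfSum (P : Y →L[ℝ] F →L[ℝ] F) (T : F ≃L[ℝ] F) (e : Y) (δ : ℝ)
    (q : F × F) : ℝ := δ / (1 - δ ^ 2) * ⟪P e (T.symm q.1), T q.2⟫

/-- On the bundle the ambient formula sees only `y`, through `⟪P e x, P y x⟫ = ⟪e, y⟫`. -/
theorem halfSum_normalMap (hP : IsCliffordSystem P) {p : F × Y} (hp : p.1 ∈ focalSet P) :
    halfSum P T e δ (normalMap P T p) = δ / (1 - δ ^ 2) * ⟪e, p.2⟫ := by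
  simp only [halfSum, normalMap, T.symm_apply_apply, T.apply_symm_apply,
    hP.inner_apply_apply_of_mem hp]

theorem contDiff_halfSum : ContDiff ℝ ∞ (halfSum P T e δ) := by
  unfold halfSum
  exact contDiff_const.mul (ContDiff.inner ℝ (by fun_prop) (by fun_prop))

theorem fderiv_halfSum (q v : F × F) : fderiv ℝ (halfSum P T e δ) q v =
    δ / (1 - δ ^ 2) * (⟪P e (T.symm q.1), T v.2⟫ + ⟪P e (T.symm v.1), T q.2⟫) := by
  refine fderiv_apply_of_quadratic (C := δ / (1 - δ ^ 2) * ⟪P e (T.symm v.1), T v.2⟫)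
    (contDiff_halfSum.differentiable (by simp) q) fun t => ?_
  simp only [halfSum, Prod.fst_add, Prod.snd_add, Prod.smul_fst, Prod.smul_snd, map_add,
    map_smul, inner_add_left, inner_add_right, real_inner_smul_left, real_inner_smul_right,
    smul_eq_mul]
  ring

/-- The four principal curvatures of the stretched focal submanifold. -/
noncomputable def stretchedCurvatures (P : Y →L[ℝ] F →L[ℝ] F) (T : F ≃L[ℝ] F) (e : Y) (δ : ℝ) :
    Fin 4 → F × F → ℝ × ℝ :=
  ![fun q => (rootNeg (halfSum P T e δ q), 1), fun _ => (0, 1),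
    fun q => (rootPos (halfSum P T e δ q), 1), fun _ => (1, 0)]

/-- Because `‖y‖² = 1 - δ²` and `‖e‖ = 1`, the leading and constant coefficients are both `1 - δ²`
up to sign. Dividing by it gives a quadratic whose roots have product `-1`. -/
theorem eigenvalue_iff (hT : IsStretching P T e δ) {y : Y} (hy : ⟪y, y⟫ = 1 - δ ^ 2) {κ : ℝ} :
    κ ^ 2 = ⟪y + (κ * δ) • e, y + (κ * δ) • e⟫ ↔
      κ ^ 2 - 2 * (δ / (1 - δ ^ 2) * ⟪e, y⟫) * κ - 1 = 0 := by
  have h1 : ⟪y + (κ * δ) • e, y + (κ * δ) • e⟫ =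
      1 - δ ^ 2 + 2 * κ * δ * ⟪e, y⟫ + κ ^ 2 * δ ^ 2 := by
    simp only [inner_add_left, inner_add_right, real_inner_smul_left, real_inner_smul_right, hy,
      hT.inner_self, real_inner_comm e y]
    ring
  have h0 := hT.pos.ne'
  have h2 : (1 - δ ^ 2) * (κ ^ 2 - 2 * (δ / (1 - δ ^ 2) * ⟪e, y⟫) * κ - 1) =
      κ ^ 2 - (1 - δ ^ 2 + 2 * κ * δ * ⟪e, y⟫ + κ ^ 2 * δ ^ 2) := by
    field_simp
    ring
  rw [h1, ← sub_eq_zero, ← h2, mul_eq_zero, or_iff_right h0]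

variable [FiniteDimensional ℝ F] [FiniteDimensional ℝ Y]

/-- `κ ≠ 0` forces `z = 0`, so `y` is stationary in the direction `v`. In ambient terms, the two
parts of the derivative of `halfSum` combine by anticommutation to a multiple of `⟪x, w⟫ = 0`. -/
theorem tangent_root (hP : IsCliffordSystem P) (hT : IsStretching P T e δ) {p : F × Y}
    (hp : p ∈ focalProduct P (1 - δ ^ 2)) {v : F × F}
    (hv : v ∈ tangentVectors (normalMap P T '' focalProduct P (1 - δ ^ 2)) (normalMap P T p))
    {κ : ℝ} (hκ : κ ≠ 0) (hr : κ • v.1 + v.2 = 0) :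
    fderiv ℝ (halfSum P T e δ) (normalMap P T p) v = 0 := by
  obtain ⟨w, hw, z, hz, rfl⟩ := (mem_tangentVectors_normalBundle hP hT.pos hp).1 hv
  have hz0 : z = 0 := by
    by_contra hne
    rcases eigenvalue_cases hP hp.1 hw ((relation_iff hT κ w z).1 hr) (Or.inr hne) with h | h
    · exact hκ h
    · exact hne h.1
  rw [fderiv_halfSum]
  simp only [normalMap, hz0, map_zero, zero_apply, zero_add, T.symm_apply_apply,
    T.apply_symm_apply]
  have h1 : ⟪P e p.1, P p.2 w⟫ + ⟪P e w, P p.2 p.1⟫ = 0 := by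
    have e1 : ⟪P e p.1, P p.2 w⟫ = ⟪P p.2 (P e p.1), w⟫ := (hP.symm _ _ _).symm
    have e2 : ⟪P e w, P p.2 p.1⟫ = ⟪P e (P p.2 p.1), w⟫ := by rw [hP.symm, real_inner_comm]
    rw [e1, e2, ← inner_add_left, hP.anticomm, real_inner_smul_left, hw.1, mul_zero]
  rw [h1, mul_zero]

/-- The branches are separated by sign: `rootNeg < 0 < rootPos`, with `0` and `∞` beside them. Only
the two roots vary, and they do so through `halfSum` alone, so `tangent_root` and the chain rule
give the Dupin condition. -/
theorem curvatureSystemOn_stretched (hP : IsCliffordSystem P) (hT : IsStretching P T e δ)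
    (hY : 2 ≤ Module.finrank ℝ Y) (hF : 2 * Module.finrank ℝ Y < Module.finrank ℝ F) :
    CurvatureSystemOn 4 (unitNormalBundle (T '' focalSet P)) Set.univ
      (stretchedCurvatures P T e δ) := by
  rw [unitNormalBundle_stretched hP hT]
  have hroot : ∀ p ∈ focalProduct P (1 - δ ^ 2), ∀ κ : ℝ, κ ≠ 0 →
      κ ^ 2 - 2 * halfSum P T e δ (normalMap P T p) * κ - 1 = 0 →
      IsCurvatureDirection (normalMap P T '' focalProduct P (1 - δ ^ 2)) (normalMap P T p)
        (κ, 1) := by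
    intro p hp κ hκ h
    rw [halfSum_normalMap hP hp.1, ← eigenvalue_iff hT hp.2] at h
    obtain ⟨w, hw, hw0, hwr⟩ := exists_eigenvector (x := p.1) hP hY hF hκ h
    refine ⟨_, (mem_tangentVectors_normalBundle hP hT.pos hp).2
      ⟨w, hw, 0, inner_zero_right _, rfl⟩, fun h0 => hw0 ?_, ?_⟩
    · simpa using (Prod.mk_eq_zero.1 h0).1
    · simp only [one_smul]
      rw [relation_iff hT, map_zero, zero_apply, add_zero, hwr]
  refine ⟨?_, ?_, ?_, ?_, ?_⟩
  · intro q _ _ j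
    fin_cases j <;> simp [stretchedCurvatures]
  · intro q _ _ i j hij
    have h1 := rootNeg_neg (halfSum P T e δ q)
    have h2 := rootPos_pos (halfSum P T e δ q)
    have h3 : rootNeg (halfSum P T e δ q) - rootPos (halfSum P T e δ q) ≠ 0 := by linarith
    have h4 : rootPos (halfSum P T e δ q) - rootNeg (halfSum P T e δ q) ≠ 0 := by linarith
    fin_cases i <;> fin_cases j <;>
      simp [stretchedCurvatures, cross, h1.ne, h2.ne', h3, h4] at hij ⊢
  · rintro _ ⟨p, hp, rfl⟩ _ j
    fin_cases j
    · exact hroot p hp _ (rootNeg_neg _).ne (eq_root_iff.2 (Or.inl rfl))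
    · have hy : p.2 ≠ 0 := by
        intro h0
        have := hp.2
        rw [h0, inner_zero_left] at this
        exact hT.pos.ne this
      obtain ⟨w, hw, z, hz, hz0, hr⟩ := exists_eigenvector_zero hP hp.1 hY hy
      refine ⟨_, (mem_tangentVectors_normalBundle hP hT.pos hp).2 ⟨w, hw, z, hz, rfl⟩,
        fun h0 => hz0 ?_, ?_⟩
      · have hw0 : w = 0 := by simpa using (Prod.mk_eq_zero.1 h0).1
        rw [hw0, map_zero, zero_add] at hr
        exact hP.apply_eq_zero hp.1 hr
      · rw [add_comm (P z p.1), hr]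
        simp [stretchedCurvatures]
    · exact hroot p hp _ (rootPos_pos _).ne' (eq_root_iff.2 (Or.inr rfl))
    · obtain ⟨z, hz, hyz⟩ := exists_ne_zero_orthogonal hY p.2
      refine ⟨_, (mem_tangentVectors_normalBundle hP hT.pos hp).2
        ⟨0, ⟨inner_zero_right _, fun _ => inner_zero_right _⟩, z, hyz, rfl⟩, fun h0 => hz ?_, ?_⟩
      · have h1 := (Prod.mk_eq_zero.1 h0).2
        simp only [map_zero, add_zero] at h1
        exact hP.apply_eq_zero hp.1 (by simpa using h1)
      · simp [stretchedCurvatures]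
  · rintro _ ⟨p, hp, rfl⟩ _ c hc ⟨v, hv, hv0, hr⟩
    obtain ⟨w, hw, z, hz, rfl⟩ := (mem_tangentVectors_normalBundle hP hT.pos hp).1 hv
    by_cases h2 : c.2 = 0
    · exact ⟨3, by simp [cross, stretchedCurvatures, h2]⟩
    · have hr' : (c.1 / c.2) • T w + T.symm (P z p.1 + P p.2 w) = 0 := by
        have : c.2 • ((c.1 / c.2) • T w + T.symm (P z p.1 + P p.2 w)) = 0 := by
          rw [smul_add, smul_smul, mul_div_cancel₀ _ h2]
          exact hr
        exact (smul_eq_zero.1 this).resolve_left h2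
      have hne : w ≠ 0 ∨ z ≠ 0 := by
        by_contra! h0
        apply hv0
        simp [h0.1, h0.2]
      rcases eigenvalue_cases hP hp.1 hw ((relation_iff hT _ w z).1 hr') hne with h | h
      · refine ⟨1, ?_⟩
        have h1 : c.1 = 0 := by simpa [h2] using h
        simp [cross, stretchedCurvatures, h1]
      · have h3 := (eigenvalue_iff hT hp.2).1 h.2
        rw [← halfSum_normalMap (T := T) hP hp.1, eq_root_iff, div_eq_iff h2, div_eq_iff h2] at h3
        rcases h3 with h3 | h3
        · exact ⟨0, by simp [cross, stretchedCurvatures, h3]⟩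
        · exact ⟨2, by simp [cross, stretchedCurvatures, h3]⟩
  · rintro _ ⟨p, hp, rfl⟩ _ j
    have hs := (contDiff_halfSum (P := P) (T := T) (e := e) (δ := δ)).differentiable (by simp)
      (normalMap P T p) |>.hasFDerivAt
    have hgen : ∀ R : ℝ → ℝ, Differentiable ℝ R → R (halfSum P T e δ (normalMap P T p)) ≠ 0 →
        ∃ D : F × F →L[ℝ] ℝ × ℝ,
        HasFDerivAt (fun q => (R (halfSum P T e δ q), (1 : ℝ))) D (normalMap P T p) ∧
        ∀ v ∈ tangentVectors (normalMap P T '' focalProduct P (1 - δ ^ 2)) (normalMap P T p),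
          R (halfSum P T e δ (normalMap P T p)) • v.1 + (1 : ℝ) • v.2 = 0 → D v = 0 := by
      intro R hR hR0
      refine ⟨_, ((hR _).hasFDerivAt.comp _ hs).prodMk (hasFDerivAt_const _ _), fun v hv hr => ?_⟩
      rw [one_smul] at hr
      simp [tangent_root hP hT hp hv hR0 hr]
    fin_cases j
    · exact hgen rootNeg differentiable_rootNeg (rootNeg_neg _).ne
    · exact ⟨0, hasFDerivAt_const _ _, fun _ _ _ => rfl⟩
    · exact hgen rootPos differentiable_rootPos (rootPos_pos _).ne'
    · exact ⟨0, hasFDerivAt_const _ _, fun _ _ _ => rfl⟩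

theorem principalCurvatures_stretched (hP : IsCliffordSystem P) (hT : IsStretching P T e δ)
    (hY : 2 ≤ Module.finrank ℝ Y) (hF : 2 * Module.finrank ℝ Y < Module.finrank ℝ F) {q : F × F}
    (hq : q ∈ unitNormalBundle (T '' focalSet P)) :
    principalCurvatures (unitNormalBundle (T '' focalSet P)) q =
      {((rootNeg (halfSum P T e δ q) : ℝ) : WithTop ℝ), ((0 : ℝ) : WithTop ℝ),
        ((rootPos (halfSum P T e δ q) : ℝ) : WithTop ℝ), ⊤} := by
  rw [(curvatureSystemOn_stretched hP hT hY hF).principalCurvatures_eq hq (Set.mem_univ q)]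
  ext κ
  simp only [Set.mem_range, Set.mem_insert_iff, Set.mem_singleton_iff]
  constructor
  · rintro ⟨j, rfl⟩
    fin_cases j <;> simp [stretchedCurvatures, affineCoord]
  · rintro (rfl | rfl | rfl | rfl)
    · exact ⟨0, by simp [stretchedCurvatures, affineCoord]⟩
    · exact ⟨1, by simp [stretchedCurvatures, affineCoord]⟩
    · exact ⟨2, by simp [stretchedCurvatures, affineCoord]⟩
    · exact ⟨3, by simp [stretchedCurvatures, affineCoord]⟩

/-- For vanishing half sum the roots are `-1` and `1`, symmetric about `0`. -/
theorem containsHarmonic_stretched (hP : IsCliffordSystem P) (hT : IsStretching P T e δ)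
    (hY : 2 ≤ Module.finrank ℝ Y) (hF : 2 * Module.finrank ℝ Y < Module.finrank ℝ F) {q : F × F}
    (hq : q ∈ unitNormalBundle (T '' focalSet P)) (h0 : halfSum P T e δ q = 0) :
    ContainsHarmonic {c | IsCurvatureDirection (unitNormalBundle (T '' focalSet P)) q c} := by
  have h := (curvatureSystemOn_stretched hP hT hY hF).isCurvatureDirection q hq (Set.mem_univ q)
  have h1 : rootPos 0 = 1 := rootPos_eq one_pos (by norm_num)
  have h2 : rootNeg 0 = -1 := rootNeg_eq (by norm_num) (by norm_num)
  refine containsHarmonic_of_symmetric one_ne_zero ?_ (h 1) ?_ (h 3)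
  · simpa [stretchedCurvatures, h0, h2] using h 0
  · simpa [stretchedCurvatures, h0, h1] using h 2

theorem not_containsHarmonic_stretched (hP : IsCliffordSystem P) (hT : IsStretching P T e δ)
    (hY : 2 ≤ Module.finrank ℝ Y) (hF : 2 * Module.finrank ℝ Y < Module.finrank ℝ F) {q : F × F}
    (hq : q ∈ unitNormalBundle (T '' focalSet P)) (h0 : halfSum P T e δ q ≠ 0) :
    ¬ ContainsHarmonic {c | IsCurvatureDirection (unitNormalBundle (T '' focalSet P)) q c} := by
  refine not_containsHarmonic (rootNeg_neg (halfSum P T e δ q)) (rootPos_pos (halfSum P T e δ q))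
    (fun h => h0 (by unfold rootNeg rootPos at h; linarith)) fun c hc hc0 => ?_
  obtain ⟨j, hj⟩ := (curvatureSystemOn_stretched hP hT hY hF).complete q hq (Set.mem_univ q) c hc0
    hc
  fin_cases j
  · exact Or.inl hj
  · exact Or.inr (Or.inl hj)
  · exact Or.inr (Or.inr (Or.inl hj))
  · exact Or.inr (Or.inr (Or.inr hj))

end CurvatureSystem

/-! ### Small tubes -/

section Tube

variable {F Y : Type*} [NormedAddCommGroup F] [InnerProductSpace ℝ F]
  [NormedAddCommGroup Y] [InnerProductSpace ℝ Y] {P : Y →L[ℝ] F →L[ℝ] F}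
  {T : F ≃L[ℝ] F} {e : Y} {δ : ℝ}

theorem tube_eq (V : Set F) (t : ℝ) :
    tube V t = parallelPoint (Real.cos t) (Real.sin t) '' unitNormalBundle V := by
  ext y
  simp only [tube, Set.mem_image, parallelPoint_apply]
  exact exists_congr fun p => and_congr_right fun _ => eq_comm

theorem IsCliffordSystem.abs_inner_apply_self_le (hP : IsCliffordSystem P) {y : Y}
    (hy : ⟪y, y⟫ ≤ 1) (d : F) : |⟪P y d, d⟫| ≤ ⟪d, d⟫ := by
  have h1 : ‖P y d‖ ^ 2 ≤ ‖d‖ ^ 2 := by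
    rw [← real_inner_self_eq_norm_sq, ← real_inner_self_eq_norm_sq, hP.inner_apply_apply]
    exact mul_le_of_le_one_left real_inner_self_nonneg hy
  have h2 : ‖P y d‖ ≤ ‖d‖ := (sq_le_sq₀ (norm_nonneg _) (norm_nonneg _)).1 h1
  rw [real_inner_self_eq_norm_mul_norm]
  exact (abs_real_inner_le_norm _ _).trans (mul_le_mul_of_nonneg_right h2 (norm_nonneg _))

theorem inner_self_le_opNorm_symm (T : F ≃L[ℝ] F) (d : F) :
    ⟪d, d⟫ ≤ ‖(T.symm : F →L[ℝ] F)‖ ^ 2 * ⟪T d, T d⟫ := by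
  have h := (T.symm : F →L[ℝ] F).le_opNorm (T d)
  simp only [ContinuousLinearEquiv.coe_coe, T.symm_apply_apply] at h
  rw [real_inner_self_eq_norm_sq, real_inner_self_eq_norm_sq, ← mul_pow]
  exact pow_le_pow_left₀ (norm_nonneg _) h 2

theorem eq_zero_of_mul_inner_le {a b : ℝ} (hb : 0 < b)
    (hab : ‖(T.symm : F →L[ℝ] F)‖ ^ 2 * b < a) {d : F} (h : a * ⟪T d, T d⟫ ≤ b * ⟪d, d⟫) :
    T d = 0 := by
  by_contra hne
  have h1 : 0 < ⟪T d, T d⟫ := real_inner_self_pos.2 hne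
  have h2 := mul_le_mul_of_nonneg_left (inner_self_le_opNorm_symm T d) hb.le
  nlinarith

variable [FiniteDimensional ℝ F] [FiniteDimensional ℝ Y]

/-- Suppose two contact elements give the same point, and pair the equation with `T d`, where `d =
x' - x`. On the focal set `⟪P y x, d⟫ = -⟪P y d, d⟫ / 2`, and similarly at `x'` with the opposite
sign, so the normal terms are quadratic in `d` and `a ‖T d‖² ≤ b ‖d‖²`. For small `b / a` this
forces `d = 0`. -/
theorem injOn_parallelPoint_stretched (hP : IsCliffordSystem P) (hT : IsStretching P T e δ)
    {a b : ℝ} (hb : 0 < b) (hab : ‖(T.symm : F →L[ℝ] F)‖ ^ 2 * b < a) :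
    Set.InjOn (parallelPoint a b) (unitNormalBundle (T '' focalSet P)) := by
  rw [unitNormalBundle_stretched hP hT]
  rintro _ ⟨⟨x, y⟩, ⟨hx, hy⟩, rfl⟩ _ ⟨⟨x', y'⟩, ⟨hx', hy'⟩, rfl⟩ h
  simp only [normalMap, parallelPoint_apply] at hx hy hx' hy' h ⊢
  have hy1 : ⟪y, y⟫ ≤ 1 := by linarith [sq_nonneg δ]
  have hy1' : ⟪y', y'⟫ ≤ 1 := by linarith [sq_nonneg δ]
  have e0 := congrArg (fun u => ⟪u, T (x' - x)⟫) h
  simp only [inner_add_left, real_inner_smul_left] at e0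
  rw [hT.inv_symm, hT.inv_symm, T.symm_apply_apply] at e0
  have e1 : ⟪P y (x' - x), x' - x⟫ = -2 * ⟪P y x, x' - x⟫ := by
    simp only [map_sub, inner_sub_left, inner_sub_right, hx.2, hx'.2]
    rw [hP.symm y x', real_inner_comm]
    ring
  have e2 : ⟪P y' (x' - x), x' - x⟫ = 2 * ⟪P y' x', x' - x⟫ := by
    simp only [map_sub, inner_sub_left, inner_sub_right, hx.2, hx'.2]
    rw [hP.symm y' x x', real_inner_comm (P y' x') x]
    ring
  have e3 := abs_le.1 (hP.abs_inner_apply_self_le hy1 (x' - x))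
  have e4 := abs_le.1 (hP.abs_inner_apply_self_le hy1' (x' - x))
  have e5 : ⟪T (x' - x), T (x' - x)⟫ = ⟪T x', T (x' - x)⟫ - ⟪T x, T (x' - x)⟫ := by
    rw [map_sub, inner_sub_left]
  have hd : T (x' - x) = 0 := by
    refine eq_zero_of_mul_inner_le hb hab ?_
    rw [e5]
    nlinarith
  have hT' : T x' = T x := by rwa [map_sub, sub_eq_zero] at hd
  rw [hT'] at h ⊢
  have h2 := add_left_cancel h
  rw [smul_right_injective F hb.ne' h2]

/-- The infinitesimal form of the injectivity estimate: on pairing with `T w` the term `P z x` drops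
out, since `w` is tangent. -/
theorem eq_zero_of_parallelPoint_stretched (hP : IsCliffordSystem P) (hT : IsStretching P T e δ)
    {a b : ℝ} (hb : 0 < b) (hab : ‖(T.symm : F →L[ℝ] F)‖ ^ 2 * b < a) :
    ∀ p ∈ unitNormalBundle (T '' focalSet P),
      ∀ v ∈ tangentVectors (unitNormalBundle (T '' focalSet P)) p,
        parallelPoint a b v = 0 → v = 0 := by
  rw [unitNormalBundle_stretched hP hT]
  rintro _ ⟨⟨x, y⟩, hp, rfl⟩ v hv h
  obtain ⟨w, hw, z, hz, rfl⟩ := (mem_tangentVectors_normalBundle hP hT.pos hp).1 hv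
  obtain ⟨hx, hy⟩ := hp
  simp only [parallelPoint_apply] at hx hy hw h ⊢
  have hy1 : ⟪y, y⟫ ≤ 1 := by linarith [sq_nonneg δ]
  have e0 := congrArg (fun u => ⟪u, T w⟫) h
  simp only [inner_add_left, real_inner_smul_left, inner_zero_left] at e0
  rw [hT.inv_symm, T.symm_apply_apply, inner_add_left, hw.2, zero_add] at e0
  have e3 := abs_le.1 (hP.abs_inner_apply_self_le hy1 w)
  have hw0 : T w = 0 := by
    refine eq_zero_of_mul_inner_le hb hab ?_
    nlinarith
  have h2 : T.symm (P z x + P y w) = 0 := by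
    rw [hw0, smul_zero, zero_add] at h
    exact (smul_eq_zero.1 h).resolve_left hb.ne'
  rw [hw0, h2]
  rfl

theorem exists_pos_forall_tube (K : ℝ) :
    ∃ t₀ : ℝ, 0 < t₀ ∧ ∀ t, 0 < t → t < t₀ → 0 < Real.sin t ∧ K * Real.sin t < Real.cos t := by
  have hc : Continuous fun t => Real.cos t - K * Real.sin t := by fun_prop
  have h1 : ∀ᶠ t in 𝓝 (0 : ℝ), 0 < Real.cos t - K * Real.sin t :=
    hc.continuousAt.eventually (lt_mem_nhds (by simp))
  obtain ⟨r, hr, h⟩ := Metric.eventually_nhds_iff.1 h1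
  refine ⟨min r Real.pi, lt_min hr Real.pi_pos, fun t ht htr => ⟨?_, ?_⟩⟩
  · exact Real.sin_pos_of_pos_of_lt_pi ht (htr.trans_le (min_le_right _ _))
  · refine sub_pos.1 (h ?_)
    rw [Real.dist_eq, sub_zero, abs_of_pos ht]
    exact htr.trans_le (min_le_left _ _)

namespace IsLegendreSubmanifold

variable {B : Set (F × F)} {a b : ℝ}

theorem isProperDupin_hypersurfaceLift (hB : IsLegendreSubmanifold B) (hc : IsCompact B)
    (hab : a ^ 2 + b ^ 2 = 1) (hF : 2 ≤ Module.finrank ℝ F)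
    (hinj : Set.InjOn (parallelPoint a b) B)
    (himm : ∀ p ∈ B, ∀ w ∈ tangentVectors B p, parallelPoint a b w = 0 → w = 0)
    {g : ℕ} {ρ : Fin g → F × F → ℝ × ℝ} (hρ : CurvatureSystemOn g B Set.univ ρ) {ν : F → F}
    (hν : IsUnitNormalField (parallelPoint a b '' B) ν) :
    IsProperDupin g (hypersurfaceLift (parallelPoint a b '' B) ν) := by
  refine hB.isProperDupin_of_isMixedNear
    (fun p _ => ⟨Set.univ, isOpen_univ, Set.mem_univ p, ρ, hρ⟩) ?_
  rintro _ ⟨_, ⟨p, hp, rfl⟩, rfl⟩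
  obtain ⟨ε, -, hm⟩ := hB.isMixedNear_hypersurfaceLift hc hab hF hinj himm hν hp
  exact ⟨a, b, ε, hm⟩

/-- Curvature directions are carried over by `mix`, which multiplies `cross` by `ε = ±1` and so
preserves harmonicity. -/
theorem containsHarmonic_hypersurfaceLift_iff (hB : IsLegendreSubmanifold B) (hc : IsCompact B)
    (hab : a ^ 2 + b ^ 2 = 1) (hF : 2 ≤ Module.finrank ℝ F)
    (hinj : Set.InjOn (parallelPoint a b) B)
    (himm : ∀ p ∈ B, ∀ w ∈ tangentVectors B p, parallelPoint a b w = 0 → w = 0) {ν : F → F}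
    (hν : IsUnitNormalField (parallelPoint a b '' B) ν) {p : F × F} (hp : p ∈ B) :
    ContainsHarmonic {c | IsCurvatureDirection (hypersurfaceLift (parallelPoint a b '' B) ν)
      (parallelPoint a b p, ν (parallelPoint a b p)) c} ↔
      ContainsHarmonic {c | IsCurvatureDirection B p c} := by
  obtain ⟨ε, hε, hm⟩ := hB.isMixedNear_hypersurfaceLift hc hab hF hinj himm hν hp
  have hε0 : ε ≠ 0 := by
    rintro rfl
    simpa using hm.sq_eq
  have hpm : mix a (-(ε * b)) ε (parallelPoint a b p, ν (parallelPoint a b p)) = p := by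
    rw [hε, ← mix_eq, mix_mix hab hm.sq_eq]
  have hab' : a ^ 2 + (-(ε * b)) ^ 2 = 1 := by rw [neg_sq, mul_pow, hm.sq_eq, one_mul, hab]
  constructor
  · refine fun h => h.of_mapsTo hε0 (cross_mix hab') fun c hc' => ?_
    have := hm.isCurvatureDirection_iff (mix a (-(ε * b)) ε c)
    rw [mix_mix' hab hm.sq_eq, hpm] at this
    exact this.1 hc'
  · refine fun h => h.of_mapsTo hε0 (cross_mix hab) fun c hc' => ?_
    have := hm.isCurvatureDirection_iff c
    rw [hpm] at this
    exact this.2 hc'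

end IsLegendreSubmanifold

/-- Small tubes around the stretched focal submanifold. -/
theorem tube_stretched (hP : IsCliffordSystem P) (hT : IsStretching P T e δ)
    (hY : 2 ≤ Module.finrank ℝ Y) (hF : 2 * Module.finrank ℝ Y < Module.finrank ℝ F)
    (hunit : ∀ x ∈ focalSet P, ‖T x‖ = 1) {p q : F × F}
    (hp : p ∈ unitNormalBundle (T '' focalSet P)) (hp0 : halfSum P T e δ p = 0)
    (hq : q ∈ unitNormalBundle (T '' focalSet P)) (hq0 : halfSum P T e δ q ≠ 0) :
    ∃ t₀ : ℝ, 0 < t₀ ∧ ∀ t : ℝ, 0 < t → t < t₀ →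
      (tube (T '' focalSet P) t ⊆ Metric.sphere 0 1 ∧ IsCompact (tube (T '' focalSet P) t) ∧
        IsSubmanifold (Module.finrank ℝ F - 2) (tube (T '' focalSet P) t)) ∧
      (∃ ν, IsUnitNormalField (tube (T '' focalSet P) t) ν) ∧
      ∀ ν, IsUnitNormalField (tube (T '' focalSet P) t) ν →
        IsProperDupin 4 (hypersurfaceLift (tube (T '' focalSet P) t) ν) ∧
        ¬ LieEquivalentToIsoparametric.{u} (hypersurfaceLift (tube (T '' focalSet P) t) ν) := by
  have hF2 : 2 ≤ Module.finrank ℝ F := by omega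
  have hB := isLegendreSubmanifold_unitNormalBundle hP hT hF2 hunit
  have hc := isCompact_unitNormalBundle hP hT
  obtain ⟨t₀, ht₀, h⟩ := exists_pos_forall_tube (‖(T.symm : F →L[ℝ] F)‖ ^ 2)
  refine ⟨t₀, ht₀, fun t ht htt => ?_⟩
  obtain ⟨hs, hK⟩ := h t ht htt
  have hab := Real.cos_sq_add_sin_sq t
  have hinj := injOn_parallelPoint_stretched hP hT hs hK
  have himm := eq_zero_of_parallelPoint_stretched hP hT hs hK
  rw [tube_eq]
  refine ⟨⟨?_, hc.image (ContinuousLinearMap.continuous _), (hB.parallel_embedding hc hinj himm).1⟩,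
    ?_, fun ν hν => ?_⟩
  · rintro _ ⟨r, hr, rfl⟩
    have h1 := (hB.inner_parallel hab hr).1
    rw [real_inner_self_eq_norm_sq] at h1
    exact mem_sphere_zero_iff_norm.2 ((pow_eq_one_iff_of_nonneg (norm_nonneg _) two_ne_zero).1 h1)
  · obtain ⟨ν, hν, -⟩ := hB.exists_parallelNormalField hc hab hinj himm
    exact ⟨ν, hν⟩
  · have hD := hB.isProperDupin_hypersurfaceLift hc hab hF2 hinj himm
      (curvatureSystemOn_stretched hP hT hY hF) hν
    refine ⟨hD, ?_⟩
    refine not_lieEquivalentToIsoparametric hD.legendre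
      (p := (_, ν _)) (q := (_, ν _)) ⟨_, ⟨p, hp, rfl⟩, rfl⟩ ⟨_, ⟨q, hq, rfl⟩, rfl⟩ ?_ ?_
    · rw [hB.containsHarmonic_hypersurfaceLift_iff hc hab hF2 hinj himm hν hp]
      exact containsHarmonic_stretched hP hT hY hF hp hp0
    · rw [hB.containsHarmonic_hypersurfaceLift_iff hc hab hF2 hinj himm hν hq]
      exact not_containsHarmonic_stretched hP hT hY hF hq hq0

end Tube

/-! ### Clifford systems from anticommuting symmetric involutions -/

section CliffordFamily

variable {F ι : Type*} [NormedAddCommGroup F] [InnerProductSpace ℝ F] [Fintype ι]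

/-- The linear family spanned by finitely many operators. -/
noncomputable def operatorFamily (J : ι → F →L[ℝ] F) : EuclideanSpace ℝ ι →L[ℝ] F →L[ℝ] F :=
  ∑ i, (EuclideanSpace.proj i : EuclideanSpace ℝ ι →L[ℝ] ℝ).smulRight (J i)

theorem operatorFamily_apply (J : ι → F →L[ℝ] F) (y : EuclideanSpace ℝ ι) (u : F) :
    operatorFamily J y u = ∑ i, y i • J i u := by
  simp [operatorFamily, sum_apply]

/-- Symmetrize the double sum for `(P y)²`: the off-diagonal terms cancel by anticommutation, and
the diagonal ones add up to `‖y‖²`. -/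
theorem isCliffordSystem_operatorFamily [DecidableEq ι] {J : ι → F →L[ℝ] F}
    (hsymm : ∀ i u v, ⟪J i u, v⟫ = ⟪u, J i v⟫) (hsq : ∀ i u, J i (J i u) = u)
    (hanti : ∀ i j, i ≠ j → ∀ u, J i (J j u) + J j (J i u) = 0) :
    IsCliffordSystem (operatorFamily J) := by
  refine ⟨fun y u v => ?_, fun y u => ?_⟩
  · simp only [operatorFamily_apply, sum_inner, inner_sum, real_inner_smul_left,
      real_inner_smul_right, hsymm]
  · have h1 : operatorFamily J y (operatorFamily J y u) =
        ∑ i, ∑ j, (y i * y j) • J i (J j u) := by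
      rw [operatorFamily_apply, operatorFamily_apply]
      simp only [map_sum, map_smul, Finset.smul_sum, smul_smul]
    have h2 : ∑ i, ∑ j, (y i * y j) • J i (J j u) = ∑ i, ∑ j, (y i * y j) • J j (J i u) := by
      rw [Finset.sum_comm]
      exact Finset.sum_congr rfl fun i _ => Finset.sum_congr rfl fun j _ => by rw [mul_comm]
    have h3 : (2 : ℝ) • operatorFamily J y (operatorFamily J y u) = (2 : ℝ) • ‖y‖ ^ 2 • u := by
      rw [two_smul, congrArg₂ (· + ·) h1 (h1.trans h2), ← Finset.sum_add_distrib,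
        EuclideanSpace.real_norm_sq_eq, Finset.sum_smul, Finset.smul_sum]
      refine Finset.sum_congr rfl fun i _ => ?_
      rw [← Finset.sum_add_distrib, Finset.sum_eq_single i]
      · rw [hsq, sq, two_smul]
      · intro j _ hj
        rw [← smul_add, hanti i j hj.symm, smul_zero]
      · simp
    exact smul_right_injective F two_ne_zero h3

end CliffordFamily

/-! ### The Clifford system of a representation and its focal submanifold -/

section Concrete

variable {n l : ℕ}

/-- `1` and the operators of the representation. -/
noncomputable def stiefelOperator (E : Fin n → Matrix (Fin l) (Fin l) ℝ) :
    Option (Fin n) → EuclideanSpace ℝ (Fin l) →ₗ[ℝ] EuclideanSpace ℝ (Fin l)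
  | none => LinearMap.id
  | some i => Matrix.toEuclideanLin (E i)

/-- The adjoints of the operators `stiefelOperator`. -/
noncomputable def stiefelAdjoint (E : Fin n → Matrix (Fin l) (Fin l) ℝ) :
    Option (Fin n) → EuclideanSpace ℝ (Fin l) →ₗ[ℝ] EuclideanSpace ℝ (Fin l)
  | none => LinearMap.id
  | some i => -Matrix.toEuclideanLin (E i)

variable {E : Fin n → Matrix (Fin l) (Fin l) ℝ}

theorem toEuclideanLin_mul_apply (A B : Matrix (Fin l) (Fin l) ℝ) (u : EuclideanSpace ℝ (Fin l)) :
    Matrix.toEuclideanLin A (Matrix.toEuclideanLin B u) = Matrix.toEuclideanLin (A * B) u := by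
  simp [Matrix.toLpLin_apply, Matrix.mulVec_mulVec]

namespace IsCliffordRepresentation

theorem apply_apply_self (hE : IsCliffordRepresentation E) (i : Fin n)
    (u : EuclideanSpace ℝ (Fin l)) :
    Matrix.toEuclideanLin (E i) (Matrix.toEuclideanLin (E i) u) = -u := by
  rw [toEuclideanLin_mul_apply, hE.sq]
  simp

theorem apply_apply (hE : IsCliffordRepresentation E) {i j : Fin n} (hij : i ≠ j)
    (u : EuclideanSpace ℝ (Fin l)) :
    Matrix.toEuclideanLin (E i) (Matrix.toEuclideanLin (E j) u) =
      -Matrix.toEuclideanLin (E j) (Matrix.toEuclideanLin (E i) u) := by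
  rw [toEuclideanLin_mul_apply, toEuclideanLin_mul_apply, hE.anticomm i j hij, map_neg]
  rfl

theorem inner_stiefelAdjoint (hE : IsCliffordRepresentation E) (i : Option (Fin n))
    (u v : EuclideanSpace ℝ (Fin l)) :
    ⟪stiefelAdjoint E i u, v⟫ = ⟪u, stiefelOperator E i v⟫ := by
  cases i with
  | none => rfl
  | some i =>
    simp only [stiefelAdjoint, stiefelOperator]
    rw [← LinearMap.adjoint_inner_left, ← Matrix.toEuclideanLin_conjTranspose_eq_adjoint,
      Matrix.conjTranspose_eq_transpose_of_trivial, hE.skew, map_neg]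

theorem stiefelAdjoint_stiefelOperator (hE : IsCliffordRepresentation E) (i : Option (Fin n))
    (u : EuclideanSpace ℝ (Fin l)) : stiefelAdjoint E i (stiefelOperator E i u) = u := by
  cases i with
  | none => rfl
  | some i => simp [stiefelAdjoint, stiefelOperator, hE.apply_apply_self]

theorem stiefelOperator_stiefelAdjoint (hE : IsCliffordRepresentation E) (i : Option (Fin n))
    (u : EuclideanSpace ℝ (Fin l)) : stiefelOperator E i (stiefelAdjoint E i u) = u := by
  cases i with
  | none => rfl
  | some i => simp [stiefelAdjoint, stiefelOperator, hE.apply_apply_self]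

/-- With `stiefelOperator_add`, these are the two diagonal blocks of the anticommutator of two
operators `(p, q) ↦ (Aᵀ q, A p)`. -/
theorem stiefelAdjoint_add (hE : IsCliffordRepresentation E) {i j : Option (Fin n)} (hij : i ≠ j)
    (u : EuclideanSpace ℝ (Fin l)) :
    stiefelAdjoint E i (stiefelOperator E j u) + stiefelAdjoint E j (stiefelOperator E i u) = 0 := by
  rcases i with _ | i <;> rcases j with _ | j
  · exact absurd rfl hij
  · simp [stiefelAdjoint, stiefelOperator]
  · simp [stiefelAdjoint, stiefelOperator]
  · simp [stiefelAdjoint, stiefelOperator, hE.apply_apply (fun h => hij (congrArg some h))]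

theorem stiefelOperator_add (hE : IsCliffordRepresentation E) {i j : Option (Fin n)} (hij : i ≠ j)
    (u : EuclideanSpace ℝ (Fin l)) :
    stiefelOperator E i (stiefelAdjoint E j u) + stiefelOperator E j (stiefelAdjoint E i u) = 0 := by
  rcases i with _ | i <;> rcases j with _ | j
  · exact absurd rfl hij
  · simp [stiefelAdjoint, stiefelOperator]
  · simp [stiefelAdjoint, stiefelOperator]
  · simp [stiefelAdjoint, stiefelOperator, hE.apply_apply (fun h => hij (congrArg some h))]

end IsCliffordRepresentation

/-- The operator on `DoubleSpace l` given by an operator on the product. -/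
noncomputable def doubleMap
    (f : EuclideanSpace ℝ (Fin l) × EuclideanSpace ℝ (Fin l) →L[ℝ]
      EuclideanSpace ℝ (Fin l) × EuclideanSpace ℝ (Fin l)) : DoubleSpace l →L[ℝ] DoubleSpace l :=
  ((WithLp.prodContinuousLinearEquiv 2 ℝ (EuclideanSpace ℝ (Fin l))
      (EuclideanSpace ℝ (Fin l))).symm.toContinuousLinearMap ∘L f) ∘L
    (WithLp.prodContinuousLinearEquiv 2 ℝ (EuclideanSpace ℝ (Fin l))
      (EuclideanSpace ℝ (Fin l))).toContinuousLinearMap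

/-- The operators `(p, q) ↦ (p, -q)` and `(p, q) ↦ (Aᵀ q, A p)`, for `A = 1` and `A = E i`. -/
noncomputable def cliffordOperator (E : Fin n → Matrix (Fin l) (Fin l) ℝ) :
    Option (Option (Fin n)) → DoubleSpace l →L[ℝ] DoubleSpace l
  | none => doubleMap ((ContinuousLinearMap.fst ℝ _ _).prod (-ContinuousLinearMap.snd ℝ _ _))
  | some i => doubleMap
      (((stiefelAdjoint E i).toContinuousLinearMap ∘L ContinuousLinearMap.snd ℝ _ _).prod
        ((stiefelOperator E i).toContinuousLinearMap ∘L ContinuousLinearMap.fst ℝ _ _))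

theorem cliffordOperator_none (p : DoubleSpace l) :
    cliffordOperator E none p = WithLp.toLp 2 (p.fst, -p.snd) := rfl

theorem cliffordOperator_some (i : Option (Fin n)) (p : DoubleSpace l) :
    cliffordOperator E (some i) p =
      WithLp.toLp 2 (stiefelAdjoint E i p.snd, stiefelOperator E i p.fst) := rfl

theorem inner_doubleSpace (p q : DoubleSpace l) : ⟪p, q⟫ = ⟪p.fst, q.fst⟫ + ⟪p.snd, q.snd⟫ :=
  WithLp.prod_inner_apply p q

theorem doubleSpace_ext {p q : DoubleSpace l} (h1 : p.fst = q.fst) (h2 : p.snd = q.snd) : p = q :=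
  (WithLp.ofLp_injective 2) (Prod.ext h1 h2)

/-- The Clifford system of a representation. -/
noncomputable def cliffordSystem (E : Fin n → Matrix (Fin l) (Fin l) ℝ) :
    EuclideanSpace ℝ (Option (Option (Fin n))) →L[ℝ] DoubleSpace l →L[ℝ] DoubleSpace l :=
  operatorFamily (cliffordOperator E)

theorem isCliffordSystem_cliffordSystem (hE : IsCliffordRepresentation E) :
    IsCliffordSystem (cliffordSystem E) := by
  refine isCliffordSystem_operatorFamily ?_ ?_ ?_
  · rintro (_ | i) u v
    · rw [cliffordOperator_none, cliffordOperator_none, inner_doubleSpace, inner_doubleSpace]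
      simp only [WithLp.toLp_fst, WithLp.toLp_snd, inner_neg_left, inner_neg_right]
    · have h : ⟪u.fst, stiefelAdjoint E i v.snd⟫ = ⟪stiefelOperator E i u.fst, v.snd⟫ := by
        rw [real_inner_comm, hE.inner_stiefelAdjoint, real_inner_comm]
      simp only [cliffordOperator_some, inner_doubleSpace, WithLp.toLp_fst, WithLp.toLp_snd,
        hE.inner_stiefelAdjoint, h]
      exact add_comm _ _
  · rintro (_ | i) u
    · exact doubleSpace_ext rfl (neg_neg _)
    · exact doubleSpace_ext (hE.stiefelAdjoint_stiefelOperator i _)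
        (hE.stiefelOperator_stiefelAdjoint i _)
  · rintro (_ | i) (_ | j) hij u
    · exact absurd rfl hij
    · refine doubleSpace_ext ?_ ?_
      · simp [cliffordOperator_none, cliffordOperator_some]
      · simp [cliffordOperator_none, cliffordOperator_some]
    · refine doubleSpace_ext ?_ ?_
      · simp [cliffordOperator_none, cliffordOperator_some]
      · simp [cliffordOperator_none, cliffordOperator_some]
    · have h : i ≠ j := fun h => hij (congrArg some h)
      exact doubleSpace_ext (hE.stiefelAdjoint_add h _) (hE.stiefelOperator_add h _)

/-- The vector of the Clifford system that acts as `(p, q) ↦ (p, -q)`. -/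
noncomputable def swapVector (n : ℕ) : EuclideanSpace ℝ (Option (Option (Fin n))) :=
  EuclideanSpace.single none 1

theorem cliffordSystem_single (i : Option (Option (Fin n))) (p : DoubleSpace l) :
    cliffordSystem E (EuclideanSpace.single i 1) p = cliffordOperator E i p := by
  rw [cliffordSystem, operatorFamily_apply, Finset.sum_eq_single i] <;> simp +contextual

theorem mem_focalSet_cliffordSystem {x : DoubleSpace l} :
    x ∈ focalSet (cliffordSystem E) ↔
      ⟪x, x⟫ = 1 ∧ ∀ i, ⟪cliffordOperator E i x, x⟫ = 0 := by
  refine and_congr_right fun _ => ⟨fun h i => ?_, fun h y => ?_⟩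
  · rw [← cliffordSystem_single, h]
  · rw [cliffordSystem, operatorFamily_apply, sum_inner]
    exact Finset.sum_eq_zero fun i _ => by rw [real_inner_smul_left, h, mul_zero]

theorem norm_eq_one_div_sqrt_two_iff {X : Type*} [NormedAddCommGroup X] [InnerProductSpace ℝ X]
    (u : X) : ‖u‖ = 1 / √2 ↔ ⟪u, u⟫ = 1 / 2 := by
  rw [real_inner_self_eq_norm_sq, ← sq_eq_sq₀ (norm_nonneg _) (by positivity), div_pow,
    Real.sq_sqrt (by norm_num), one_pow]

/-- The operator `none` yields `‖u‖ = ‖v‖`, `some none` yields `u ⟂ v`, and `some (some i)` yields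
`E i u ⟂ v`; total norm `1` then fixes both lengths. -/
theorem cliffordStiefel_eq (hE : IsCliffordRepresentation E) :
    cliffordStiefel E = focalSet (cliffordSystem E) := by
  ext p
  have hs : ∀ i, ⟪cliffordOperator E (some i) p, p⟫ =
      2 * ⟪stiefelOperator E i p.fst, p.snd⟫ := by
    intro i
    rw [cliffordOperator_some, inner_doubleSpace]
    simp only [WithLp.toLp_fst, WithLp.toLp_snd]
    rw [hE.inner_stiefelAdjoint, real_inner_comm, two_mul]
  have hn : ⟪cliffordOperator E none p, p⟫ = ⟪p.fst, p.fst⟫ - ⟪p.snd, p.snd⟫ := by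
    rw [cliffordOperator_none, inner_doubleSpace]
    simp only [WithLp.toLp_fst, WithLp.toLp_snd, inner_neg_left]
    ring
  rw [mem_focalSet_cliffordSystem, Option.forall, Option.forall, hn]
  simp only [hs, inner_doubleSpace p p]
  simp only [cliffordStiefel, Set.mem_ofPred_eq, norm_eq_one_div_sqrt_two_iff, stiefelOperator,
    LinearMap.id_apply, mul_eq_zero, OfNat.ofNat_ne_zero, false_or]
  have h1 : ‖p‖ = 1 ↔ ⟪p.fst, p.fst⟫ + ⟪p.snd, p.snd⟫ = 1 := by
    rw [← inner_doubleSpace, real_inner_self_eq_norm_sq,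
      pow_eq_one_iff_of_nonneg (norm_nonneg _) two_ne_zero]
  rw [h1]
  constructor
  · rintro ⟨a, b, c, d, f⟩
    exact ⟨a, by rw [b, c, sub_self], d, f⟩
  · rintro ⟨a, b, d, f⟩
    exact ⟨a, by linarith, by linarith, d, f⟩

theorem finrank_doubleSpace : Module.finrank ℝ (DoubleSpace l) = 2 * l := by
  rw [LinearEquiv.finrank_eq (WithLp.linearEquiv 2 ℝ
    (EuclideanSpace ℝ (Fin l) × EuclideanSpace ℝ (Fin l))), Module.finrank_prod]
  simp [two_mul]

/-- Once `u` is chosen, `v` has to avoid at most `n + 1 < l` directions. -/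
theorem nonempty_cliffordStiefel (hl : n + 1 < l) :
    (cliffordStiefel E).Nonempty := by
  set X := EuclideanSpace ℝ (Fin l)
  have hnorm : ∀ v : X, v ≠ 0 → ∃ c : ℝ, ‖c • v‖ = 1 / √2 := by
    intro v hv
    refine ⟨1 / √2 / ‖v‖, ?_⟩
    rw [norm_smul, Real.norm_of_nonneg (by positivity), div_mul_cancel₀ _ (norm_ne_zero_iff.2 hv)]
  have : Nonempty (Fin l) := ⟨⟨0, by omega⟩⟩
  obtain ⟨u, hu⟩ := exists_ne (0 : X)
  obtain ⟨a, ha⟩ := hnorm u hu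
  set S := Submodule.span ℝ (Set.range fun i => stiefelOperator E i (a • u))
  have h1 : Module.finrank ℝ S ≤ n + 1 := by
    exact (finrank_range_le_card (R := ℝ) fun i => stiefelOperator E i (a • u)).trans (by simp)
  have h2 : Sᗮ ≠ ⊥ := by
    intro h
    have := S.finrank_add_finrank_orthogonal
    rw [h, finrank_bot, finrank_euclideanSpace_fin] at this
    omega
  obtain ⟨v, hvS, hv⟩ := Submodule.exists_mem_ne_zero_of_ne_bot h2
  obtain ⟨b, hb⟩ := hnorm v hv
  have h3 : ∀ i, ⟪stiefelOperator E i (a • u), b • v⟫ = 0 := fun i => by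
    rw [real_inner_smul_right, hvS _ (Submodule.subset_span ⟨i, rfl⟩), mul_zero]
  refine ⟨WithLp.toLp 2 (a • u, b • v), ?_, ha, hb, h3 none, fun i => h3 (some i)⟩
  rw [← pow_eq_one_iff_of_nonneg (norm_nonneg _) two_ne_zero, ← real_inner_self_eq_norm_sq,
    inner_doubleSpace]
  simp only [WithLp.toLp_fst, WithLp.toLp_snd]
  rw [(norm_eq_one_div_sqrt_two_iff _).1 ha, (norm_eq_one_div_sqrt_two_iff _).1 hb]
  norm_num

end Concrete

/-! ### The map `stretch` as a square root of `1 + δ P e` -/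

section Stretch

variable {n l : ℕ} {E : Fin n → Matrix (Fin l) (Fin l) ℝ} {α β : ℝ}

theorem stretch_fst (p : DoubleSpace l) : (stretch α β p).fst = (√2 * α) • p.fst := by
  simp [stretch, smul_smul]

theorem stretch_snd (p : DoubleSpace l) : (stretch α β p).snd = (√2 * β) • p.snd := by
  simp [stretch, smul_smul]

theorem sqrt_two_mul_mul (a b : ℝ) : √2 * a * (√2 * b) = 2 * a * b := by
  have h : √2 * √2 = 2 := Real.mul_self_sqrt (by norm_num)
  linear_combination a * b * h

theorem stretch_stretch {γ ε : ℝ} (p : DoubleSpace l) : stretch α β (stretch γ ε p) =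
    WithLp.toLp 2 ((2 * α * γ) • p.fst, (2 * β * ε) • p.snd) :=
  doubleSpace_ext (by rw [stretch_fst, stretch_fst, smul_smul, sqrt_two_mul_mul]; rfl)
    (by rw [stretch_snd, stretch_snd, smul_smul, sqrt_two_mul_mul]; rfl)

theorem stretch_stretch_eq_self {γ ε : ℝ} (h1 : 2 * α * γ = 1) (h2 : 2 * β * ε = 1)
    (p : DoubleSpace l) : stretch α β (stretch γ ε p) = p := by
  rw [stretch_stretch, h1, h2, one_smul, one_smul]
  rfl

/-- `stretch α β` as a continuous linear map. -/
noncomputable def stretchMap (l : ℕ) (α β : ℝ) : DoubleSpace l →L[ℝ] DoubleSpace l :=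
  doubleMap (((√2 * α) • ContinuousLinearMap.fst ℝ _ _).prod
    ((√2 * β) • ContinuousLinearMap.snd ℝ _ _))

theorem stretchMap_apply (p : DoubleSpace l) : stretchMap l α β p = stretch α β p :=
  doubleSpace_ext (stretch_fst p).symm (stretch_snd p).symm

/-- `stretch α β` as a linear automorphism. -/
noncomputable def stretchEquiv (l : ℕ) (hα : α ≠ 0) (hβ : β ≠ 0) :
    DoubleSpace l ≃L[ℝ] DoubleSpace l :=
  ContinuousLinearEquiv.equivOfInverse (stretchMap l α β)
    (stretchMap l (1 / (2 * α)) (1 / (2 * β)))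
    (fun p => by
      rw [stretchMap_apply, stretchMap_apply,
        stretch_stretch_eq_self (by field_simp) (by field_simp)])
    (fun p => by
      rw [stretchMap_apply, stretchMap_apply,
        stretch_stretch_eq_self (by field_simp) (by field_simp)])

theorem stretchEquiv_apply (hα : α ≠ 0) (hβ : β ≠ 0) (p : DoubleSpace l) :
    stretchEquiv l hα hβ p = stretch α β p := stretchMap_apply p

theorem stretchEquiv_symm_apply (hα : α ≠ 0) (hβ : β ≠ 0) (p : DoubleSpace l) :
    (stretchEquiv l hα hβ).symm p = stretch (1 / (2 * α)) (1 / (2 * β)) p := stretchMap_apply p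

/-- `T²` scales the components by `2 α²` and `2 β²`, which are `1 ± (α² - β²)` because `α² + β² =
1`; moreover `1 - δ² = (2 α β)²` is positive. -/
theorem isStretching_stretchEquiv (hα : α ≠ 0) (hβ : β ≠ 0) (hαβ : α ^ 2 + β ^ 2 = 1) :
    IsStretching (cliffordSystem E) (stretchEquiv l hα hβ) (swapVector n) (α ^ 2 - β ^ 2) where
  symm u v := by
    simp only [stretchEquiv_apply, inner_doubleSpace, stretch_fst, stretch_snd,
      real_inner_smul_left, real_inner_smul_right]
  sq u := by
    rw [swapVector, cliffordSystem_single, stretchEquiv_apply, stretchEquiv_apply,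
      stretch_stretch, cliffordOperator_none]
    refine doubleSpace_ext ?_ ?_
    · simp only [WithLp.add_fst, WithLp.smul_fst, WithLp.toLp_fst]
      calc (2 * α * α) • u.fst = ((α ^ 2 + β ^ 2) + (α ^ 2 - β ^ 2)) • u.fst := by
            congr 1; ring
        _ = _ := by rw [hαβ, add_smul, one_smul]
    · simp only [WithLp.add_snd, WithLp.smul_snd, WithLp.toLp_snd]
      calc (2 * β * β) • u.snd = ((α ^ 2 + β ^ 2) - (α ^ 2 - β ^ 2)) • u.snd := by
            congr 1; ring
        _ = _ := by rw [hαβ, sub_smul, one_smul, smul_neg, sub_eq_add_neg]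
  inner_self := by simp [swapVector]
  sq_lt_one := by
    have h : 0 < (α * β) ^ 2 := by positivity
    nlinarith

theorem norm_stretch (hαβ : α ^ 2 + β ^ 2 = 1) {x : DoubleSpace l} (hx : x ∈ cliffordStiefel E) :
    ‖stretch α β x‖ = 1 := by
  have h1 := (norm_eq_one_div_sqrt_two_iff _).1 hx.2.1
  have h2 := (norm_eq_one_div_sqrt_two_iff _).1 hx.2.2.1
  rw [← pow_eq_one_iff_of_nonneg (norm_nonneg _) two_ne_zero, ← real_inner_self_eq_norm_sq,
    inner_doubleSpace, stretch_fst, stretch_snd, real_inner_smul_left, real_inner_smul_right,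
    real_inner_smul_left, real_inner_smul_right, h1, h2]
  have h : √2 * √2 = 2 := Real.mul_self_sqrt (by norm_num)
  linear_combination (α ^ 2 + β ^ 2) / 2 * h + hαβ

/-- For `c = ±1` the vector `c (2 α β) e` has the squared length `1 - δ²` required of `y`; `c = -1`
corresponds to `ξ` and `c = 1` to `-ξ`. -/
theorem stretch_specialNormal (hα : α ≠ 0) (hβ : β ≠ 0) (c : ℝ) (x : DoubleSpace l) :
    normalMap (cliffordSystem E) (stretchEquiv l hα hβ)
      (x, (c * (2 * α * β)) • swapVector n) =
      (stretch α β x, -c • specialNormal α β (stretch α β x)) := by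
  refine Prod.ext (stretchEquiv_apply hα hβ x) ?_
  simp only [normalMap, map_smul, smul_apply, swapVector, cliffordSystem_single,
    cliffordOperator_none, stretchEquiv_symm_apply]
  refine doubleSpace_ext ?_ ?_
  · simp only [WithLp.smul_fst, stretch_fst, specialNormal, WithLp.toLp_fst, smul_smul]
    congr 1
    field_simp
  · simp only [WithLp.smul_snd, stretch_snd, specialNormal, WithLp.toLp_snd, smul_smul, smul_neg,
      ← neg_smul]
    congr 1
    field_simp

end Stretch

/-! ### The Lie curvature of a quadruple `a < 0 < b < ∞` -/

section LieCurvature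

theorem eq_of_strictMono_of_range {a b : Fin 4 → WithTop ℝ} (ha : StrictMono a) (hb : StrictMono b)
    (h : Set.range a = Set.range b) : a = b := (StrictMono.range_inj ha hb).1 h

theorem range_vecCons_four {A : Type*} (a b c d : A) :
    Set.range ![a, b, c, d] = {a, b, c, d} := by
  ext x
  simp [eq_comm]
  tauto

theorem strictMono_vecCons_four {a b c d : WithTop ℝ} (h1 : a < b) (h2 : b < c) (h3 : c < d) :
    StrictMono ![a, b, c, d] := by
  rw [Fin.strictMono_iff_lt_succ]
  intro i
  fin_cases i <;> assumption

variable {F : Type*} [NormedAddCommGroup F] [InnerProductSpace ℝ F] {B : Set (F × F)} {p : F × F}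
  {a b : ℝ}

/-- A finite set has only one increasing enumeration, so the existential in `HasLieCurvature`
determines `ψ`. -/
theorem hasLieCurvature_iff (ha : a < 0) (hb : 0 < b)
    (h : principalCurvatures B p = {(a : WithTop ℝ), ((0 : ℝ) : WithTop ℝ), (b : WithTop ℝ), ⊤})
    {ψ : ℝ} : HasLieCurvature B p ψ ↔ ψ = a / (a - b) := by
  have hcr : crossRatio (a : WithTop ℝ) ((0 : ℝ) : WithTop ℝ) (b : WithTop ℝ) ⊤ = a / (a - b) := by
    simp only [crossRatio, homDiff, homCoord_coe, homCoord_top]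
    simp
  have h1 : (a : WithTop ℝ) < ((0 : ℝ) : WithTop ℝ) := WithTop.coe_lt_coe.2 ha
  have h2 : ((0 : ℝ) : WithTop ℝ) < (b : WithTop ℝ) := WithTop.coe_lt_coe.2 hb
  have h3 : (b : WithTop ℝ) < ⊤ := WithTop.coe_lt_top b
  constructor
  · rintro ⟨κ₁, κ₂, κ₃, κ₄, h12, h23, h34, hκ, rfl⟩
    have := eq_of_strictMono_of_range (strictMono_vecCons_four h12 h23 h34)
      (strictMono_vecCons_four h1 h2 h3)
      (by rw [range_vecCons_four, range_vecCons_four, ← hκ, h])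
    have e0 : κ₁ = a := congrFun this 0
    have e1 : κ₂ = ((0 : ℝ) : WithTop ℝ) := congrFun this 1
    have e2 : κ₃ = b := congrFun this 2
    have e3 : κ₄ = ⊤ := congrFun this 3
    rw [e0, e1, e2, e3, hcr]
  · rintro rfl
    exact ⟨_, _, _, _, h1, h2, h3, h, hcr⟩

end LieCurvature

/-! ### The stretched submanifold and a normal with vanishing half sum -/

section Stretched

variable {F Y : Type*} [NormedAddCommGroup F] [InnerProductSpace ℝ F] [FiniteDimensional ℝ F]
  [NormedAddCommGroup Y] [InnerProductSpace ℝ Y] [FiniteDimensional ℝ Y]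
  {P : Y →L[ℝ] F →L[ℝ] F} {T : F ≃L[ℝ] F} {e : Y} {δ : ℝ}

theorem isSubmanifold_stretched (hP : IsCliffordSystem P) {k : ℕ}
    (hk : k + (1 + Module.finrank ℝ Y) = Module.finrank ℝ F) (T : F ≃L[ℝ] F) :
    IsSubmanifold k (T '' focalSet P) := by
  refine ((isSubmanifold_focalSet hP hk).image_of_embedding T.contDiff
    (eventually_preimage_of_isCompact isCompact_focalSet T.continuous T.injective.injOn)
    fun p _ w _ h => ?_).1
  rw [T.fderiv] at h
  exact T.map_eq_zero_iff.1 h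

theorem exists_halfSum_eq_zero (hP : IsCliffordSystem P) (hT : IsStretching P T e δ)
    (hY : 2 ≤ Module.finrank ℝ Y) (hne : (focalSet P).Nonempty) :
    ∃ p ∈ unitNormalBundle (T '' focalSet P), halfSum P T e δ p = 0 := by
  obtain ⟨x, hx⟩ := hne
  obtain ⟨z, hz, hez⟩ := exists_ne_zero_orthogonal hY e
  rw [unitNormalBundle_stretched hP hT]
  -- A vector orthogonal to `e`, rescaled to the length required of `y`.
  refine ⟨_, ⟨(x, (√(1 - δ ^ 2) / ‖z‖) • z), ⟨hx, ?_⟩, rfl⟩, ?_⟩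
  · simp only
    rw [real_inner_self_eq_norm_sq, norm_smul, Real.norm_of_nonneg (by positivity),
      div_mul_cancel₀ _ (norm_ne_zero_iff.2 hz), Real.sq_sqrt hT.pos.le]
  · rw [halfSum_normalMap hP hx, real_inner_smul_right, hez, mul_zero, mul_zero]

end Stretched

/-! ### The normals `±ξ` -/

section SpecialNormal

variable {n l : ℕ} {E : Fin n → Matrix (Fin l) (Fin l) ℝ} {α β : ℝ}

theorem normalMap_mem (hE : IsCliffordRepresentation E) (hα : α ≠ 0) (hβ : β ≠ 0)
    (hαβ : α ^ 2 + β ^ 2 = 1) {x : DoubleSpace l} (hx : x ∈ focalSet (cliffordSystem E)) {c : ℝ}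
    (hc : c ^ 2 = 1) :
    (stretch α β x, -c • specialNormal α β (stretch α β x)) ∈
        unitNormalBundle (stretchEquiv l hα hβ '' focalSet (cliffordSystem E)) ∧
      halfSum (cliffordSystem E) (stretchEquiv l hα hβ) (swapVector n) (α ^ 2 - β ^ 2)
        (stretch α β x, -c • specialNormal α β (stretch α β x)) =
        c * (α ^ 2 - β ^ 2) / (2 * α * β) := by
  have hP := isCliffordSystem_cliffordSystem hE
  have hT := isStretching_stretchEquiv (E := E) (l := l) hα hβ hαβ
  have h1 : 1 - (α ^ 2 - β ^ 2) ^ 2 = (2 * α * β) ^ 2 := by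
    linear_combination (-(α ^ 2 + β ^ 2) - 1) * hαβ
  rw [← stretch_specialNormal (E := E) hα hβ]
  constructor
  · rw [unitNormalBundle_stretched hP hT]
    refine ⟨_, ⟨hx, ?_⟩, rfl⟩
    simp only [real_inner_smul_left, real_inner_smul_right, hT.inner_self]
    rw [h1]
    linear_combination (2 * α * β) ^ 2 * hc
  · rw [halfSum_normalMap hP hx, real_inner_smul_right, hT.inner_self, h1]
    field_simp

end SpecialNormal

end LieSphere

/-! ### The main theorem -/

open LieSphere in
theorem mainTheorem1 (l m : ℕ) (hm : 1 ≤ m) (hl : m + 1 < l)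
    (E : Fin (m - 1) → Matrix (Fin l) (Fin l) ℝ) (hE : IsCliffordRepresentation E)
    (α β : ℝ) (hα : 0 < α) (hβ : 0 < β) (hαβ : α ^ 2 + β ^ 2 = 1) (hne : α ≠ 1 / √2)
    (V : Set (DoubleSpace l)) (hV : V = stretchedStiefel E α β)
    (B : Set (DoubleSpace l × DoubleSpace l)) (hB : B = unitNormalBundle V) :
    -- `V` is a compact submanifold of the unit sphere, of codimension `m + 1`
    (V ⊆ Metric.sphere 0 1 ∧ IsCompact V ∧ IsSubmanifold (2 * l - 1 - (m + 1)) V) ∧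
    -- it is proper Dupin with four principal curvatures, including `∞`
    (IsProperDupin 4 B ∧ ∀ p ∈ B, ⊤ ∈ principalCurvatures B p) ∧
    -- principal curvatures and Lie curvature at `ξ(u, v)` and at `-ξ(u, v)`
    (∀ p ∈ V,
      ((p, specialNormal α β p) ∈ B ∧
        principalCurvatures B (p, specialNormal α β p) =
          {((-(α / β) : ℝ) : WithTop ℝ), ((0 : ℝ) : WithTop ℝ), ((β / α : ℝ) : WithTop ℝ), ⊤} ∧
        HasLieCurvature B (p, specialNormal α β p) (α ^ 2)) ∧
      ((p, -specialNormal α β p) ∈ B ∧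
        principalCurvatures B (p, -specialNormal α β p) =
          {((-(β / α) : ℝ) : WithTop ℝ), ((0 : ℝ) : WithTop ℝ), ((α / β : ℝ) : WithTop ℝ), ⊤} ∧
        HasLieCurvature B (p, -specialNormal α β p) (β ^ 2))) ∧
    -- the Lie curvature is not constant
    (¬ ∃ c : ℝ, ∀ p ∈ B, HasLieCurvature B p c) ∧
    -- `V` is not Lie equivalent to an isoparametric hypersurface
    (¬ LieEquivalentToIsoparametric.{u} B) ∧
    -- every sufficiently small tube over `V` is a compact embedded proper Dupin hypersurface with
    -- four principal curvatures that is not Lie equivalent to an isoparametric hypersurface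
    (∃ t₀ : ℝ, 0 < t₀ ∧ ∀ t : ℝ, 0 < t → t < t₀ →
      (tube V t ⊆ Metric.sphere 0 1 ∧ IsCompact (tube V t) ∧
        IsSubmanifold (2 * l - 2) (tube V t)) ∧
      (∃ ν, IsUnitNormalField (tube V t) ν) ∧
      ∀ ν, IsUnitNormalField (tube V t) ν →
        IsProperDupin 4 (hypersurfaceLift (tube V t) ν) ∧
        ¬ LieEquivalentToIsoparametric.{u} (hypersurfaceLift (tube V t) ν)) := by
  have hP := isCliffordSystem_cliffordSystem hE
  have hT := isStretching_stretchEquiv (E := E) (l := l) hα.ne' hβ.ne' hαβ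
  have hVT : V = stretchEquiv l hα.ne' hβ.ne' '' focalSet (cliffordSystem E) := by
    rw [hV, stretchedStiefel, cliffordStiefel_eq hE]
    exact Set.image_congr fun x _ => (stretchEquiv_apply hα.ne' hβ.ne' x).symm
  have hYr : Module.finrank ℝ (EuclideanSpace ℝ (Option (Option (Fin (m - 1))))) = m + 1 := by
    rw [finrank_euclideanSpace]
    simp only [Fintype.card_option, Fintype.card_fin]
    omega
  have hFr := finrank_doubleSpace (l := l)
  have hY : 2 ≤ Module.finrank ℝ (EuclideanSpace ℝ (Option (Option (Fin (m - 1))))) := by omega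
  -- `2 (m + 1) < 2 l`: the bound on `l` is what the eigenspace count in `exists_eigenvector` needs.
  have hF : 2 * Module.finrank ℝ (EuclideanSpace ℝ (Option (Option (Fin (m - 1))))) <
      Module.finrank ℝ (DoubleSpace l) := by omega
  have hunit : ∀ x ∈ focalSet (cliffordSystem E), ‖stretchEquiv l hα.ne' hβ.ne' x‖ = 1 := by
    intro x hx
    rw [stretchEquiv_apply]
    exact norm_stretch hαβ (E := E) (by rwa [cliffordStiefel_eq hE])
  have hfoc : (focalSet (cliffordSystem E)).Nonempty := by
    rw [← cliffordStiefel_eq hE]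
    exact nonempty_cliffordStiefel (by omega)
  -- If `α² = β²`, then `δ = 0`, the half sum vanishes identically and every point is harmonic.
  have hne' : α ^ 2 ≠ β ^ 2 := by
    intro h
    apply hne
    rw [eq_div_iff (by positivity), ← sq_eq_sq₀ (by positivity) zero_le_one, mul_pow,
      Real.sq_sqrt (by norm_num)]
    linarith
  have hLeg := isLegendreSubmanifold_unitNormalBundle hP hT (by omega) hunit
  have hsys := curvatureSystemOn_stretched hP hT hY hF
  have hcurv := fun q hq => principalCurvatures_stretched hP hT hY hF (q := q) hq
  have hspecial := fun x hx c hc => normalMap_mem hE hα.ne' hβ.ne' hαβ (x := x) hx (c := c) hc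
  obtain ⟨p, hp, hp0⟩ := exists_halfSum_eq_zero hP hT hY hfoc
  obtain ⟨q, hq, hq0⟩ : ∃ q ∈ unitNormalBundle (stretchEquiv l hα.ne' hβ.ne' ''
      focalSet (cliffordSystem E)), halfSum (cliffordSystem E) (stretchEquiv l hα.ne' hβ.ne')
        (swapVector (m - 1)) (α ^ 2 - β ^ 2) q ≠ 0 := by
    obtain ⟨x, hx⟩ := hfoc
    obtain ⟨h1, h2⟩ := hspecial x hx 1 (one_pow 2)
    refine ⟨_, h1, ?_⟩
    rw [h2, one_mul]
    exact div_ne_zero (sub_ne_zero.2 hne') (by positivity)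
  have hsum : 0 < β / α + α / β := by positivity
  have hpoint : ∀ x ∈ focalSet (cliffordSystem E),
      ((stretch α β x, specialNormal α β (stretch α β x)) ∈
          unitNormalBundle (stretchEquiv l hα.ne' hβ.ne' '' focalSet (cliffordSystem E)) ∧
        principalCurvatures
          (unitNormalBundle (stretchEquiv l hα.ne' hβ.ne' '' focalSet (cliffordSystem E)))
          (stretch α β x, specialNormal α β (stretch α β x)) =
          {((-(α / β) : ℝ) : WithTop ℝ), ((0 : ℝ) : WithTop ℝ), ((β / α : ℝ) : WithTop ℝ), ⊤}) ∧
      ((stretch α β x, -specialNormal α β (stretch α β x)) ∈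
          unitNormalBundle (stretchEquiv l hα.ne' hβ.ne' '' focalSet (cliffordSystem E)) ∧
        principalCurvatures
          (unitNormalBundle (stretchEquiv l hα.ne' hβ.ne' '' focalSet (cliffordSystem E)))
          (stretch α β x, -specialNormal α β (stretch α β x)) =
          {((-(β / α) : ℝ) : WithTop ℝ), ((0 : ℝ) : WithTop ℝ), ((α / β : ℝ) : WithTop ℝ), ⊤}) := by
    intro x hx
    obtain ⟨h1, h2⟩ := hspecial x hx (-1) (by norm_num)
    obtain ⟨h3, h4⟩ := hspecial x hx 1 (one_pow 2)
    rw [neg_neg, one_smul] at h1 h2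
    rw [neg_one_smul] at h3 h4
    refine ⟨⟨h1, ?_⟩, h3, ?_⟩
    · rw [hcurv _ h1, h2, rootNeg_eq (κ := -(α / β)) (neg_lt_zero.2 (by positivity))
        (by field_simp; ring), rootPos_eq (κ := β / α) (by positivity) (by field_simp; ring)]
    · rw [hcurv _ h3, h4, rootNeg_eq (κ := -(β / α)) (neg_lt_zero.2 (by positivity))
        (by field_simp; ring), rootPos_eq (κ := α / β) (by positivity) (by field_simp; ring)]
  have hψ : -(α / β) / (-(α / β) - β / α) = α ^ 2 := by
    rw [div_eq_iff (by linarith)]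
    field_simp
    linear_combination hαβ
  have hψ' : -(β / α) / (-(β / α) - α / β) = β ^ 2 := by
    rw [div_eq_iff (by linarith)]
    field_simp
    linear_combination hαβ
  have hLie : ∀ x ∈ focalSet (cliffordSystem E), ∀ c : ℝ,
      (HasLieCurvature
        (unitNormalBundle (stretchEquiv l hα.ne' hβ.ne' '' focalSet (cliffordSystem E)))
        (stretch α β x, specialNormal α β (stretch α β x)) c ↔ c = α ^ 2) ∧
      (HasLieCurvature
        (unitNormalBundle (stretchEquiv l hα.ne' hβ.ne' '' focalSet (cliffordSystem E)))
        (stretch α β x, -specialNormal α β (stretch α β x)) c ↔ c = β ^ 2) := by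
    intro x hx c
    rw [hasLieCurvature_iff (neg_lt_zero.2 (by positivity)) (by positivity) (hpoint x hx).1.2,
      hasLieCurvature_iff (neg_lt_zero.2 (by positivity)) (by positivity) (hpoint x hx).2.2, hψ, hψ']
    exact ⟨Iff.rfl, Iff.rfl⟩
  subst hVT hB
  refine ⟨⟨?_, isCompact_focalSet.image (ContinuousLinearEquiv.continuous _),
    isSubmanifold_stretched hP (by omega) _⟩, ⟨?_, ?_⟩, ?_, ?_, ?_, ?_⟩
  · rintro _ ⟨x, hx, rfl⟩
    exact mem_sphere_zero_iff_norm.2 (hunit x hx)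
  · exact hLeg.isProperDupin fun r _ => ⟨Set.univ, isOpen_univ, Set.mem_univ r, _, hsys⟩
  · intro r hr
    rw [hcurv r hr]
    simp
  · rintro _ ⟨x, hx, rfl⟩
    rw [stretchEquiv_apply]
    exact ⟨⟨(hpoint x hx).1.1, (hpoint x hx).1.2, (hLie x hx _).1.2 rfl⟩,
      (hpoint x hx).2.1, (hpoint x hx).2.2, (hLie x hx _).2.2 rfl⟩
  · rintro ⟨c, hc⟩
    obtain ⟨x, hx⟩ := hfoc
    exact hne' (((hLie x hx c).1.1 (hc _ (hpoint x hx).1.1)).symm.trans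
      ((hLie x hx c).2.1 (hc _ (hpoint x hx).2.1)))
  -- Comparing `ξ` with `-ξ` would not suffice: the cross-ratios `α²` and `β² = 1 - α²` arise from
  -- each other by reordering the spheres. A point with half sum `0`, where the cross-ratio is `1 /
  -- 2`, is compared with one where it is not.
  · exact not_lieEquivalentToIsoparametric hLeg hp hq
      (containsHarmonic_stretched hP hT hY hF hp hp0)
      (not_containsHarmonic_stretched hP hT hY hF hq hq0)
  · obtain ⟨t₀, ht₀, h⟩ := tube_stretched hP hT hY hF hunit hp hp0 hq hq0
    rw [hFr] at h
    exact ⟨t₀, ht₀, h⟩
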